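/- A function $m:(0,\infty)\to\mathbf R$ is completely monotone if it is smooth and $(-1)^n m^{(n)}\ge 0$ on $(0,\infty)$ for all $n\ge 0$. A function $\psi:(0,\infty)\to\mathbf R$ is a complete Bernstein function if $\psi(z)=c_1+c_2z+\int_0^\infty(1-e^{-zs})\,m(s)\,ds$ for $z>0$, where $c_1,c_2\ge 0$ and $m$ is a completely monotone function on $(0,\infty)$ with $\int_0^\infty\min(1,s)\,m(s)\,ds<\infty$. It is regularly varying of order $\alpha$ at infinity if $\lim_{x\to\infty}\psi(kx)/\psi(x)=k^\alpha$ for every $k>0$. Write $\mathcal LF(\xi)=\int_0^\infty e^{-\xi x}F(x)\,dx$, and $f\sim g$ if $f/g\to 1$. **Lemma.** Let $\psi$ be a complete Bernstein function which is unbounded on $(0,\infty)$ and regularly varying of order $\alpha\in[0,1]$ at infinity, and let $\lambda>0$. Then there is a unique bounded continuous function $F_\lambda:(0,\infty)\to\mathbf R$ such that $$\mathcal L F_\lambda(\xi)=\frac{\lambda}{\lambda^2+\xi^2}\,\exp\left(\frac1\pi\int_0^\infty\frac{\xi}{\xi^2+\zeta^2}\,\log\frac{\psi'(\lambda^2)(\lambda^2-\zeta^2)}{\psi(\lambda^2)-\psi(\zeta^2)}\,d\zeta\right)$$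 for all $\xi\in\mathbf C$ with $\operatorname{Re}\xi>0$ (this is the generalized eigenfunction of the half-line problem for the symmetric Lévy process with exponent $\psi(\xi^2)$ in case $\psi(0^+)=0$), and it satisfies $$\mathcal L F_\lambda(\xi)\sim\sqrt{\frac{\lambda^2\psi'(\lambda^2)}{\xi^2\,\psi(\xi^2)}}\quad\text{as }\xi\to\infty,\ \xi\in\mathbf R,$$ $$F_\lambda(x)\sim\frac{1}{\Gamma(1+\alpha)}\sqrt{\frac{\lambda^2\psi'(\lambda^2)}{\psi(x^{-2})}}\quad\text{as }x\to0^+ .$$ -/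

import Mathlib

open Filter Topology MeasureTheory Set Asymptotics
open scoped ContDiff

namespace HalfLine

/-- `f` is completely monotone on `(0, ∞)`: smooth there, with `(-1)ⁿ f⁽ⁿ⁾ ≥ 0` for all `n`. -/
def IsCompletelyMonotone (f : ℝ → ℝ) : Prop :=
  ContDiffOn ℝ ∞ f (Ioi 0) ∧
    ∀ n : ℕ, ∀ z : ℝ, 0 < z → 0 ≤ (-1 : ℝ) ^ n * iteratedDeriv n f z

/-- `f` is (on `(0, ∞)`) a complete Bernstein function: a Bernstein function
`f(z) = c₁ + c₂ z + ∫₀^∞ (1 - e^{-zs}) m(s) ds` whose Lévy measure `m(s) ds`, with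
`∫₀^∞ min(1, s) m(s) ds < ∞`, has a completely monotone density `m`. -/
def IsCompleteBernstein (f : ℝ → ℝ) : Prop :=
  ∃ (c₁ c₂ : ℝ) (m : ℝ → ℝ), 0 ≤ c₁ ∧ 0 ≤ c₂ ∧ IsCompletelyMonotone m ∧
    IntegrableOn (fun s : ℝ => min 1 s * m s) (Ioi 0) ∧
    ∀ z : ℝ, 0 < z →
      f z = c₁ + c₂ * z + ∫ s in Ioi (0 : ℝ), (1 - Real.exp (-(z * s))) * m s

/-- `f` is regularly varying of order `α` at infinity. -/
def IsRegularlyVaryingAtTop (f : ℝ → ℝ) (α : ℝ) : Prop :=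
  ∀ k : ℝ, 0 < k → Tendsto (fun x : ℝ => f (k * x) / f x) atTop (𝓝 (k ^ α))

/-- The Laplace transform `∫₀^∞ e^{-ξx} F(x) dx` of a function `F` on `(0, ∞)`. -/
noncomputable def laplaceTransform (F : ℝ → ℝ) (ξ : ℂ) : ℂ :=
  ∫ x in Ioi (0 : ℝ), Complex.exp (-(ξ * (x : ℂ))) * (F x : ℂ)

/-- The explicit Laplace transform, on `Re ξ > 0`, of the eigenfunction `F_l` (`l` is `λ`):
`l / (l² + ξ²) * exp ((1/π) ∫₀^∞ ξ / (ξ² + ζ²)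
  * log (ψ'(l²) (l² - ζ²) / (ψ(l²) - ψ(ζ²))) dζ)`.
At `ζ = l`, where the argument of the logarithm is `0 / 0` and extends continuously to `1`,
the convention `log (0 / 0) = 0` gives the value of the continuous extension. -/
noncomputable def eigenLaplace (ψ : ℝ → ℝ) (l : ℝ) (ξ : ℂ) : ℂ :=
  (l : ℂ) / ((l : ℂ) ^ 2 + ξ ^ 2) *
    Complex.exp ((1 / (Real.pi : ℂ)) * ∫ ζ in Ioi (0 : ℝ),
      ξ / (ξ ^ 2 + (ζ : ℂ) ^ 2) *
        ((Real.log (deriv ψ (l ^ 2) * (l ^ 2 - ζ ^ 2) / (ψ (l ^ 2) - ψ (ζ ^ 2))) : ℝ) : ℂ))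

/-- `F` is the eigenfunction `F_l` on `(0, ∞)` (`l` is `λ`): the bounded continuous function on
`(0, ∞)` characterized by its Laplace transform. -/
def IsEigenfunctionFor (ψ : ℝ → ℝ) (l : ℝ) (F : ℝ → ℝ) : Prop :=
  ContinuousOn F (Ioi 0) ∧ (∃ C : ℝ, ∀ x : ℝ, 0 < x → |F x| ≤ C) ∧
    ∀ ξ : ℂ, 0 < ξ.re → laplaceTransform F ξ = eigenLaplace ψ l ξ

end HalfLine

/-! Put `a = l²` and let `h(z) = (z - a) / (ψ(z) - ψ(a))` (`recipSlope`). For real `ξ > 0` the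
exponential in `eigenLaplace` is `√ψ'(a)` times the Wiener–Hopf factor of `h`. The heart of the
matter is that this factor is again a complete Bernstein function, that is `∫ ξ / (ξ (1 - u) + u)
dν(u)` for a finite measure `ν` on `[0, 1]` (`IsCompleteBernstein.isWHFactorable`). The product of
this kernel with `l / (l² + ξ²)` is the Laplace transform of an explicit bounded function, a
sinusoid minus a decaying exponential (`laplace_eigenKernel`). The superposition of these over `ν`
is `F`, and the identity theorem extends the formula to `Re ξ > 0`.

The Bernstein property is proved by rational approximation. If `1 / h` is a finite sum `∑ qᵢ / (z +
sᵢ)` with positive weights, its zeros and poles interlace. The Wiener–Hopf factor is then a constant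
times `∏ (ξ + √sᵢ) / ∏ (ξ + √rᵢ)`, whose zeros and poles interlace again, and partial fractions have
the right signs. General `ψ` is reached by expanding `m` in powers of `1 - s/A` with nonnegative
coefficients and replacing `1 - e^{-zs}` by `1 - (1 - s/A)^{Az}`: each term then integrates to a
rational function of `z` whose difference quotient is a positive multiple of `1 / (z + t)`. Limits
are taken with weak compactness for `ν` and dominated convergence for the logarithmic integral; the
latter rests on `log h` being 1-Lipschitz as a function of `log z`.

Regular variation gives `h(kz)/h(z) → k^{1-α}`, and the same Lipschitz bound yields that the factor
is asymptotic to `√h(ξ²)` (`IsWHFactorable.tendsto_wienerHopf_div`), because `∫ log t / (1 + t²) dt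
= 0`. This is the asymptotics of the transform. The asymptotics of `F` follows by Karamata's theorem
(`tendsto_div_of_laplace`), since `F` is nonnegative and increasing near `0`
(`eigenSuperposition_near_zero`). Uniqueness and Karamata's theorem both use that the values of a
Laplace transform at positive integers are moments in the variable `e^{-y}`, together with
Weierstrass approximation. -/

namespace HalfLine

/-! ### Complete Bernstein functions as integrals over a compact parameter space -/

/-- The kernel `ξ / (ξ (1 - u) + u)` of complete Bernstein functions, with the Stieltjes
parameter `s = u / (1 - u) ∈ [0, ∞]` compactified to `u ∈ [0, 1]`. -/
noncomputable def cbfKernel (ξ : ℝ) (u : unitInterval) : ℝ := ξ / (ξ * (1 - u) + u)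

/-- `f` has, on `(0, ∞)`, an integral representation with kernel `cbfKernel`. -/
def HasCBFRep (f : ℝ → ℝ) : Prop :=
  ∃ ν : Measure unitInterval, IsFiniteMeasure ν ∧
    ∀ ξ : ℝ, 0 < ξ → f ξ = ∫ u, cbfKernel ξ u ∂ν

theorem cbfKernel_denom_pos {ξ : ℝ} (hξ : 0 < ξ) (u : unitInterval) :
    0 < ξ * (1 - u) + (u : ℝ) := by
  obtain ⟨u, h0, h1⟩ := u
  rcases h0.eq_or_lt with h | h
  · simp [← h, hξ]
  · have := mul_nonneg hξ.le (sub_nonneg.2 h1)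
    simp only; linarith

theorem continuous_cbfKernel {ξ : ℝ} (hξ : 0 < ξ) : Continuous (cbfKernel ξ) := by
  unfold cbfKernel
  exact Continuous.div (by fun_prop) (by fun_prop) fun u => (cbfKernel_denom_pos hξ u).ne'

/-- At `ξ = 1` the integral is the total mass of the measure, so convergence at this one point
bounds the masses of a whole sequence. -/
theorem cbfKernel_one (u : unitInterval) : cbfKernel 1 u = 1 := by simp [cbfKernel]

/-- The integral representations are closed under pointwise limits. -/
theorem HasCBFRep.of_tendsto {f : ℕ → ℝ → ℝ} {g : ℝ → ℝ} (hf : ∀ n, HasCBFRep (f n))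
    (hlim : ∀ ξ : ℝ, 0 < ξ → Tendsto (fun n => f n ξ) atTop (𝓝 (g ξ))) : HasCBFRep g := by
  choose ν' hfin hν using hf
  let ν : ℕ → FiniteMeasure unitInterval := fun n => ⟨ν' n, hfin n⟩
  have hmass : ∀ n, ((ν n).mass : ℝ) = f n 1 := fun n => by
    rw [hν n 1 one_pos, integral_congr_ae (Eventually.of_forall cbfKernel_one), integral_const,
      smul_eq_mul, mul_one]
    rfl
  obtain ⟨C, hC⟩ := (hlim 1 one_pos).bddAbove_range
  have hle : ∀ n, (ν n).mass ≤ C.toNNReal := fun n => by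
    have : ((ν n).mass : ℝ) ≤ C := by rw [hmass]; exact hC ⟨n, rfl⟩
    exact NNReal.le_toNNReal_of_coe_le this
  -- Measures of mass at most `C` on a compact space form a weakly compact set. An ultrafilter finer
  -- than `atTop` plays the role of a convergent subsequence.
  obtain ⟨μ, -, hμ⟩ := (isCompact_setOfPred_finiteMeasure_le_of_compactSpace unitInterval
    C.toNNReal).ultrafilter_le_nhds ((Ultrafilter.of atTop).map ν)
      (le_principal_iff.2 (Filter.mem_map.2 (univ_mem' hle)))
  have hμ' : Tendsto ν (Ultrafilter.of (atTop : Filter ℕ)) (𝓝 μ) := hμ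
  refine ⟨μ, inferInstance, fun ξ hξ => ?_⟩
  have h1 := (FiniteMeasure.tendsto_iff_forall_integral_tendsto.1 hμ')
    (BoundedContinuousFunction.mkOfCompact ⟨cbfKernel ξ, continuous_cbfKernel hξ⟩)
  have h2 : Tendsto (fun n => f n ξ) (Ultrafilter.of (atTop : Filter ℕ)) (𝓝 (g ξ)) :=
    (hlim ξ hξ).mono_left (Ultrafilter.of_le _)
  refine tendsto_nhds_unique h2 ?_
  simp_rw [hν _ ξ hξ]
  exact h1

theorem integrable_of_continuous_unitInterval {E : Type*} [NormedAddCommGroup E]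
    {f : unitInterval → E} (hf : Continuous f)
    (ν : Measure unitInterval) [IsFiniteMeasure ν] : Integrable f ν := by
  rw [← integrableOn_univ]
  exact hf.continuousOn.integrableOn_compact isCompact_univ

theorem HasCBFRep.add {f g : ℝ → ℝ} (hf : HasCBFRep f) (hg : HasCBFRep g) :
    HasCBFRep (fun ξ => f ξ + g ξ) := by
  obtain ⟨μ, _, hμ⟩ := hf
  obtain ⟨ν, _, hν⟩ := hg
  refine ⟨μ + ν, inferInstance, fun ξ hξ => ?_⟩
  rw [integral_add_measure (integrable_of_continuous_unitInterval (continuous_cbfKernel hξ) _)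
    (integrable_of_continuous_unitInterval (continuous_cbfKernel hξ) _), ← hμ ξ hξ, ← hν ξ hξ]

theorem HasCBFRep.const_mul {f : ℝ → ℝ} (hf : HasCBFRep f) {c : ℝ} (hc : 0 ≤ c) :
    HasCBFRep (fun ξ => c * f ξ) := by
  obtain ⟨ν, _, hν⟩ := hf
  refine ⟨c.toNNReal • ν, inferInstance, fun ξ hξ => ?_⟩
  rw [integral_smul_nnreal_measure, NNReal.smul_def,
    Real.coe_toNNReal _ hc, smul_eq_mul, ← hν ξ hξ]

theorem HasCBFRep.kernel {c : ℝ} (hc : 0 ≤ c) (u : unitInterval) :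
    HasCBFRep (fun ξ => c * cbfKernel ξ u) := by
  have : HasCBFRep (fun ξ => cbfKernel ξ u) :=
    ⟨Measure.dirac u, inferInstance, fun ξ _ => (integral_dirac _ _).symm⟩
  exact this.const_mul hc

theorem HasCBFRep.congr {f g : ℝ → ℝ} (hf : HasCBFRep f) (h : ∀ ξ, 0 < ξ → g ξ = f ξ) :
    HasCBFRep g := by
  obtain ⟨ν, hfin, hν⟩ := hf
  exact ⟨ν, hfin, fun ξ hξ => (h ξ hξ).trans (hν ξ hξ)⟩

theorem HasCBFRep.const {c : ℝ} (hc : 0 ≤ c) : HasCBFRep (fun _ => c) :=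
  (HasCBFRep.kernel hc 0).congr fun ξ hξ => by simp [cbfKernel, hξ.ne']

theorem HasCBFRep.id : HasCBFRep (fun ξ => ξ) :=
  (HasCBFRep.kernel zero_le_one 1).congr fun ξ hξ => by simp [cbfKernel]

theorem HasCBFRep.div_add {r : ℝ} (hr : 0 < r) : HasCBFRep (fun ξ => ξ / (ξ + r)) := by
  have h1 : 0 < 1 + r := by linarith
  -- The Stieltjes parameter `r` corresponds to `u = r / (1 + r)`, where the kernel equals `(1 + r)
  -- ξ / (ξ + r)`.
  refine (HasCBFRep.kernel (c := 1 / (1 + r)) (by positivity)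
    ⟨r / (1 + r), by positivity, by rw [div_le_one h1]; linarith⟩).congr fun ξ hξ => ?_
  have : ξ + r ≠ 0 := by positivity
  simp only [cbfKernel]
  have e : ξ * (1 - r / (1 + r)) + r / (1 + r) = (ξ + r) / (1 + r) := by field_simp; ring
  rw [e]; field_simp

theorem HasCBFRep.sum {ι : Type*} (s : Finset ι) {f : ι → ℝ → ℝ} (hf : ∀ i ∈ s, HasCBFRep (f i)) :
    HasCBFRep (fun ξ => ∑ i ∈ s, f i ξ) := by
  classical
  induction s using Finset.induction_on with
  | empty => simpa using HasCBFRep.const le_rfl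
  | insert i s hi ih =>
    refine ((hf i (by simp)).add (ih fun j hj => hf j (by simp [hj]))).congr fun ξ _ => ?_
    rw [Finset.sum_insert hi]

/-! ### Interlacing zeros and poles -/

/-- Multiplication by `(ξ + σₙ)/(ξ + ρₙ)` rescales each old residue by `(σₙ - ρᵢ)/(ρₙ - ρᵢ)`, which
is positive because `ρᵢ < σₙ < ρₙ`. It creates the new residue `(ρₙ - σₙ)(1 + ∑ vᵢ/(ρₙ - ρᵢ))`, so
signs persist by induction. -/
theorem prod_interlacing_eq_one_sub_sum (σ ρ : ℕ → ℝ) (n : ℕ) (h0 : ∀ i < n, 0 < σ i)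
    (h1 : ∀ i < n, σ i < ρ i) (h2 : ∀ i, ∀ j < n, i < j → ρ i < σ j) :
    ∃ v : ℕ → ℝ, (∀ i < n, 0 ≤ v i) ∧ ∀ ξ : ℝ, 0 ≤ ξ →
      ∏ i ∈ Finset.range n, (ξ + σ i) / (ξ + ρ i) =
        1 - ∑ i ∈ Finset.range n, v i / (ξ + ρ i) := by
  induction n with
  | zero => exact ⟨0, by simp, by simp⟩
  | succ n ih =>
    obtain ⟨v, hv, hprod⟩ := ih (fun i hi => h0 i (by omega)) (fun i hi => h1 i (by omega))
      (fun i j hj => h2 i j (by omega))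
    have hσρ : σ n < ρ n := h1 n (by omega)
    have hρσ : ∀ i < n, ρ i < σ n := fun i hi => h2 i n (by omega) hi
    have hS : 0 ≤ ∑ i ∈ Finset.range n, v i / (ρ n - ρ i) := Finset.sum_nonneg fun i hi => by
      have hi := Finset.mem_range.1 hi
      exact div_nonneg (hv i hi) (by linarith [hρσ i hi])
    refine ⟨fun i => if i < n then v i * (σ n - ρ i) / (ρ n - ρ i) else
      (ρ n - σ n) * (1 + ∑ i ∈ Finset.range n, v i / (ρ n - ρ i)), fun i hi => ?_, fun ξ hξ => ?_⟩
    · dsimp only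
      split_ifs with h
      · have := hρσ i h
        exact div_nonneg (mul_nonneg (hv i h) (by linarith)) (by linarith)
      · exact mul_nonneg (by linarith) (by linarith)
    · rw [Finset.prod_range_succ, hprod ξ hξ, Finset.sum_range_succ]
      have hn : ξ + ρ n ≠ 0 := by have := h0 n (by omega); linarith
      have e1 : ∑ i ∈ Finset.range n, (if i < n then v i * (σ n - ρ i) / (ρ n - ρ i) else
          (ρ n - σ n) * (1 + ∑ i ∈ Finset.range n, v i / (ρ n - ρ i))) / (ξ + ρ i) =
          ∑ i ∈ Finset.range n, ((v i / (ξ + ρ i)) * ((ξ + σ n) / (ξ + ρ n))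
            - (ρ n - σ n) / (ξ + ρ n) * (v i / (ρ n - ρ i))) := by
        refine Finset.sum_congr rfl fun i hi => ?_
        have hi := Finset.mem_range.1 hi
        rw [if_pos hi]
        have a1 : ξ + ρ i ≠ 0 := by have := h0 i (by omega); have := h1 i (by omega); linarith
        have a2 : ρ n - ρ i ≠ 0 := by have := hρσ i hi; linarith
        field_simp
        ring
      rw [e1, Finset.sum_sub_distrib, ← Finset.sum_mul, ← Finset.mul_sum]
      simp only [lt_irrefl, if_false]
      field_simp
      ring

/-- Products with interlacing zeros and poles are complete Bernstein functions. -/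
theorem HasCBFRep.prod_interlacing (σ ρ : ℕ → ℝ) (n : ℕ) (h0 : ∀ i ≤ n, 0 < σ i)
    (h1 : ∀ i < n, σ i < ρ i) (h2 : ∀ i, ∀ j ≤ n, i < j → ρ i < σ j) :
    HasCBFRep fun ξ => (∏ i ∈ Finset.range (n + 1), (ξ + σ i)) /
      ∏ i ∈ Finset.range n, (ξ + ρ i) := by
  obtain ⟨v, hv, hprod⟩ := prod_interlacing_eq_one_sub_sum σ ρ n (fun i hi => h0 i hi.le) h1
    (fun i j hj => h2 i j hj.le)
  have hρ : ∀ i < n, 0 < ρ i := fun i hi => (h0 i hi.le).trans (h1 i hi)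
  have hσn := h0 n le_rfl
  -- This constant is the value of the whole quotient at `ξ = 0`.
  have hc : 0 ≤ σ n * (1 - ∑ i ∈ Finset.range n, v i / (0 + ρ i)) := by
    rw [← hprod 0 le_rfl]
    refine mul_nonneg hσn.le (Finset.prod_nonneg fun i hi => ?_)
    have hi := Finset.mem_range.1 hi
    have := hρ i hi
    have := h0 i hi.le
    positivity
  -- The extra factor `ξ + σₙ` acts through `v (ξ + σₙ)/(ξ + ρ) = v σₙ/ρ - (v (σₙ - ρ)/ρ) · ξ/(ξ +
  -- ρ)`. The minus sign cancels the one in `1 - ∑`, leaving nonnegative coefficients.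
  have key : HasCBFRep fun ξ => (ξ + σ n * (1 - ∑ i ∈ Finset.range n, v i / (0 + ρ i))) +
      ∑ i ∈ Finset.range n, v i * (σ n - ρ i) / ρ i * (ξ / (ξ + ρ i)) := by
    refine (HasCBFRep.id.add (HasCBFRep.const hc)).add (HasCBFRep.sum _ fun i hi => ?_)
    have hi := Finset.mem_range.1 hi
    refine (HasCBFRep.div_add (hρ i hi)).const_mul ?_
    exact div_nonneg (mul_nonneg (hv i hi) (by linarith [h2 i n le_rfl hi])) (hρ i hi).le
  refine key.congr fun ξ hξ => ?_
  have e := hprod ξ hξ.le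
  rw [Finset.prod_div_distrib] at e
  rw [Finset.prod_range_succ, mul_div_right_comm, e, mul_sub, mul_one, sub_mul, one_mul,
    Finset.sum_mul, Finset.mul_sum]
  have : ∀ i ∈ Finset.range n, v i * (σ n - ρ i) / ρ i * (ξ / (ξ + ρ i)) =
      σ n * (v i / (0 + ρ i)) - v i / (ξ + ρ i) * (ξ + σ n) := by
    intro i hi
    have := hρ i (Finset.mem_range.1 hi)
    have : ξ + ρ i ≠ 0 := by positivity
    field_simp
    ring
  rw [Finset.sum_congr rfl this, Finset.sum_sub_distrib]
  ring

/-- The zeros of a rational Stieltjes function interlace with its poles. -/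
theorem exists_interlacing_zeros (s q : ℕ → ℝ) (n : ℕ) (hs0 : 0 < s 0) (hs : StrictMono s)
    (hq : ∀ i, 0 < q i) :
    ∃ (r : ℕ → ℝ) (C : ℝ), 0 < C ∧ (∀ i, s i < r i ∧ r i < s (i + 1)) ∧ ∀ z : ℝ, 0 < z →
      ∑ i ∈ Finset.range (n + 1), q i / (z + s i) =
        C * (∏ i ∈ Finset.range n, (z + r i)) / ∏ i ∈ Finset.range (n + 1), (z + s i) := by
  classical
  have hspos : ∀ i, 0 < s i := fun i => hs0.trans_le (hs.monotone (Nat.zero_le i))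
  set P : Polynomial ℝ := ∑ i ∈ Finset.range (n + 1), Polynomial.C (q i) *
    ∏ j ∈ (Finset.range (n + 1)).erase i, (Polynomial.X + Polynomial.C (s j)) with hP
  have hPe : ∀ z, P.eval z = ∑ i ∈ Finset.range (n + 1), q i *
      ∏ j ∈ (Finset.range (n + 1)).erase i, (z + s j) := fun z => by
    simp [hP, Polynomial.eval_finsetSum, Polynomial.eval_prod]
  have hPs : ∀ i ∈ Finset.range (n + 1), P.eval (-s i) =
      q i * ∏ j ∈ (Finset.range (n + 1)).erase i, (-s i + s j) := fun i hi => by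
    rw [hPe, Finset.sum_eq_single_of_mem i hi]
    intro j _ hji
    rw [Finset.prod_eq_zero (i := i) (by simp [hji.symm]; simpa using hi) (by ring), mul_zero]
  -- At `-sᵢ` only one summand of the numerator `P` survives. No pole lies between `sᵢ` and `sᵢ₊₁`,
  -- so all factors belonging to other poles have equal signs at both points, and only the pair `(i,
  -- i + 1)` produces a sign change.
  have hsign : ∀ i < n, P.eval (-s i) * P.eval (-s (i + 1)) < 0 := by
    intro i hi
    rw [hPs i (by simp; omega), hPs (i + 1) (by simp; omega)]
    rw [← Finset.mul_prod_erase _ _ (a := i + 1) (show i + 1 ∈ _ by simp; omega),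
      ← Finset.mul_prod_erase ((Finset.range (n + 1)).erase (i + 1)) _ (a := i)
        (show i ∈ _ by simp; omega), Finset.erase_right_comm]
    have hlt : s i < s (i + 1) := hs (by omega)
    have hpos : 0 < (∏ x ∈ ((Finset.range (n + 1)).erase (i + 1)).erase i, (-s i + s x)) *
        ∏ x ∈ ((Finset.range (n + 1)).erase (i + 1)).erase i, (-s (i + 1) + s x) := by
      rw [← Finset.prod_mul_distrib]
      refine Finset.prod_pos fun j hj => ?_
      simp only [Finset.mem_erase] at hj
      rcases lt_or_gt_of_ne hj.1 with h | h
      · have := hs h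
        nlinarith
      · have : s (i + 1) < s j := hs (by have := hj.2.1; omega)
        nlinarith
    have := mul_pos (mul_pos (hq i) (hq (i + 1))) hpos
    nlinarith [mul_pos this (mul_pos (sub_pos.2 hlt) (sub_pos.2 hlt))]
  have hroot : ∀ i, ∃ x, s i < x ∧ x < s (i + 1) ∧ (i < n → P.eval (-x) = 0) := by
    intro i
    have hlt : s i < s (i + 1) := hs (by omega)
    by_cases hi : i < n
    swap
    -- Beyond the actual zeros, midpoints serve as fillers that keep the whole sequence interlacing.
    · exact ⟨(s i + s (i + 1)) / 2, by linarith, by linarith, fun h => absurd h hi⟩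
    have hcont : ContinuousOn (fun x => P.eval (-x)) (Icc (s i) (s (i + 1))) :=
      (P.continuous.comp continuous_neg).continuousOn
    have hsg := hsign i hi
    rcases lt_trichotomy (P.eval (-s i)) 0 with h | h | h
    · have h' : 0 < P.eval (-s (i + 1)) := by by_contra hc; nlinarith
      obtain ⟨x, hx, hx0⟩ := intermediate_value_Ioo hlt.le hcont ⟨h, h'⟩
      exact ⟨x, hx.1, hx.2, fun _ => hx0⟩
    · rw [h, zero_mul] at hsg; exact absurd hsg (lt_irrefl _)
    · have h' : P.eval (-s (i + 1)) < 0 := by by_contra hc; nlinarith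
      obtain ⟨x, hx, hx0⟩ := intermediate_value_Ioo' hlt.le hcont ⟨h', h⟩
      exact ⟨x, hx.1, hx.2, fun _ => hx0⟩
  choose r hr1 hr2 hr0 using hroot
  have hrpos : ∀ i, 0 < r i := fun i => (hspos i).trans (hr1 i)
  have hrmono : StrictMono r := strictMono_nat_of_lt_succ fun i => (hr2 i).trans (hr1 (i + 1))
  have hP0 : 0 < P.eval 0 := by
    rw [hPe]
    exact Finset.sum_pos (fun i _ => mul_pos (hq i) (Finset.prod_pos fun j _ => by
      rw [zero_add]; exact hspos j)) (by simp)
  have hprodr : 0 < ∏ i ∈ Finset.range n, r i := Finset.prod_pos fun i _ => hrpos i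
  set C := P.eval 0 / ∏ i ∈ Finset.range n, r i with hC
  have hdeg : P.degree < (n + 1 : ℕ) := by
    refine (Polynomial.degree_sum_le _ _).trans_lt ?_
    rw [Finset.sup_lt_iff (by exact WithBot.bot_lt_coe _)]
    intro i hi
    rw [Polynomial.degree_C_mul (hq i).ne', Polynomial.degree_prod]
    simp only [Polynomial.degree_X_add_C, Finset.sum_const, Finset.card_erase_of_mem hi,
      Finset.card_range, nsmul_one]
    exact_mod_cast Nat.lt_succ_self n
  have hPeq : P = Polynomial.C C * ∏ i ∈ Finset.range n, (Polynomial.X + Polynomial.C (r i)) := by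
    have hdeg' : (Polynomial.C C * ∏ i ∈ Finset.range n,
        (Polynomial.X + Polynomial.C (r i))).degree < (n + 1 : ℕ) := by
      rw [Polynomial.degree_C_mul (div_pos hP0 hprodr).ne', Polynomial.degree_prod]
      simp only [Polynomial.degree_X_add_C, Finset.sum_const,
        Finset.card_range, nsmul_one]
      exact_mod_cast Nat.lt_succ_self n
    -- Both polynomials have degree at most `n` and agree at `n + 1` points: the `n` zeros and,
    -- under index `n`, the origin, where agreement is the choice of `C`.
    refine Polynomial.eq_of_degrees_lt_of_eval_index_eq (s := Finset.range (n + 1))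
      (v := fun i => if i < n then -r i else 0) ?_ (by simpa using hdeg) (by simpa using hdeg') ?_
    · intro i hi j hj hij
      dsimp only at hij
      split_ifs at hij with h1 h2 h2
      · exact hrmono.injective (neg_injective hij)
      · have := hrpos i; linarith
      · have := hrpos j; linarith
      · simp at hi hj; omega
    · intro i hi
      split_ifs with h
      · rw [hr0 i h, Polynomial.eval_mul, Polynomial.eval_prod,
          Finset.prod_eq_zero (Finset.mem_range.2 h) (by simp), mul_zero]
      · rw [Polynomial.eval_mul, Polynomial.eval_prod]
        simp only [Polynomial.eval_C, Polynomial.eval_add, Polynomial.eval_X, zero_add]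
        rw [hC, div_mul_cancel₀ _ hprodr.ne']
  refine ⟨r, C, div_pos hP0 hprodr, fun i => ⟨hr1 i, hr2 i⟩, fun z hz => ?_⟩
  have hz' : ∀ i, z + s i ≠ 0 := fun i => by have := hspos i; positivity
  have hev : P.eval z = C * ∏ i ∈ Finset.range n, (z + r i) := by
    rw [hPeq]; simp [Polynomial.eval_prod]
  rw [← hev, hPe, Finset.sum_div]
  refine Finset.sum_congr rfl fun i hi => ?_
  rw [← Finset.mul_prod_erase _ _ hi]
  have : ∏ j ∈ (Finset.range (n + 1)).erase i, (z + s j) ≠ 0 :=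
    Finset.prod_ne_zero_iff.2 fun j _ => hz' j
  have := hz' i
  field_simp

/-! ### Poisson integrals of logarithms -/

theorem integrableOn_inv_one_add_sq : IntegrableOn (fun ζ : ℝ => (1 + ζ ^ 2)⁻¹) (Ioi 0) :=
  integrable_inv_one_add_sq.integrableOn

theorem integrableOn_abs_log_div : IntegrableOn (fun ζ : ℝ => (1 + ζ ^ 2)⁻¹ * |Real.log ζ|) (Ioi 0) := by
  have hm : Measurable fun ζ : ℝ => (1 + ζ ^ 2)⁻¹ * |Real.log ζ| := by fun_prop
  rw [← Ioc_union_Ioi_eq_Ioi (zero_le_one' ℝ)]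
  refine IntegrableOn.union ?_ ?_
  · have h1 : IntegrableOn (fun ζ : ℝ => |Real.log ζ|) (Ioc 0 1) :=
      ((intervalIntegral.intervalIntegrable_log' (a := 0) (b := 1)).1).abs
    refine h1.mono' hm.aestronglyMeasurable ?_
    refine Eventually.of_forall fun ζ => ?_
    rw [Real.norm_of_nonneg (by positivity)]
    exact mul_le_of_le_one_left (abs_nonneg _) (inv_le_one_of_one_le₀ (by nlinarith [sq_nonneg ζ]))
  · have h1 : IntegrableOn (fun ζ : ℝ => 2 * ζ ^ (-(3 / 2) : ℝ)) (Ioi 1) :=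
      (integrableOn_Ioi_rpow_of_lt (by norm_num) one_pos).const_mul 2
    refine h1.mono' hm.aestronglyMeasurable ?_
    refine (ae_restrict_mem measurableSet_Ioi).mono fun ζ hζ => ?_
    have hζ1 : (1 : ℝ) < ζ := hζ
    have hζ0 : 0 < ζ := by linarith
    rw [Real.norm_of_nonneg (by positivity), abs_of_nonneg (Real.log_nonneg hζ1.le)]
    have h2 := Real.log_le_rpow_div hζ0.le (ε := 1 / 2) (by norm_num)
    have h3 : (1 + ζ ^ 2)⁻¹ ≤ (ζ ^ 2)⁻¹ := inv_anti₀ (by positivity) (by linarith)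
    calc (1 + ζ ^ 2)⁻¹ * Real.log ζ ≤ (ζ ^ 2)⁻¹ * (ζ ^ (1 / 2 : ℝ) / (1 / 2)) :=
          mul_le_mul h3 h2 (Real.log_nonneg hζ1.le) (by positivity)
      _ = 2 * ζ ^ (-(3 / 2) : ℝ) := by
          have : (ζ ^ 2)⁻¹ = ζ ^ (-2 : ℝ) := by
            rw [Real.rpow_neg hζ0.le]; norm_cast
          rw [this, mul_div_assoc', ← Real.rpow_add hζ0]; norm_num; ring

theorem poisson_le {ξ : ℝ} (hξ : 0 < ξ) (ζ : ℝ) :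
    ξ / (ξ ^ 2 + ζ ^ 2) ≤ (ξ + ξ⁻¹) * (1 + ζ ^ 2)⁻¹ := by
  rw [← div_eq_mul_inv, div_le_div_iff₀ (by positivity) (by positivity)]
  have : (ξ + ξ⁻¹) * (ξ ^ 2 + ζ ^ 2) = ξ ^ 3 + ξ * ζ ^ 2 + ξ + ξ⁻¹ * ζ ^ 2 := by
    field_simp; ring
  rw [this]
  have : 0 ≤ ξ⁻¹ * ζ ^ 2 := by positivity
  have : 0 ≤ ξ ^ 3 := by positivity
  nlinarith

theorem integrableOn_log_bound (A B : ℝ) :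
    IntegrableOn (fun ζ : ℝ => (1 + ζ ^ 2)⁻¹ * (A + B * |Real.log ζ|)) (Ioi 0) := by
  have := (integrableOn_inv_one_add_sq.mul_const A).add (integrableOn_abs_log_div.const_mul B)
  refine this.congr (Eventually.of_forall fun ζ => ?_)
  simp only [Pi.add_apply]; ring

theorem integrableOn_poisson_mul {ξ : ℝ} (hξ : 0 < ξ) {G : ℝ → ℝ} {A B : ℝ}
    (hG : AEStronglyMeasurable G (volume.restrict (Ioi 0)))
    (hb : ∀ᵐ ζ ∂volume.restrict (Ioi (0 : ℝ)), |G ζ| ≤ A + B * |Real.log ζ|) :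
    IntegrableOn (fun ζ => ξ / (ξ ^ 2 + ζ ^ 2) * G ζ) (Ioi 0) := by
  have hw : Measurable fun ζ : ℝ => ξ / (ξ ^ 2 + ζ ^ 2) := by fun_prop
  refine ((integrableOn_log_bound A B).const_mul (ξ + ξ⁻¹)).mono' (hw.aestronglyMeasurable.mul hG) ?_
  refine hb.mono fun ζ hζ => ?_
  rw [norm_mul, Real.norm_of_nonneg (by positivity), Real.norm_eq_abs, ← mul_assoc]
  exact mul_le_mul (poisson_le hξ ζ) hζ (abs_nonneg _) (by positivity)

theorem integrableOn_poisson {ξ : ℝ} (hξ : 0 < ξ) :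
    IntegrableOn (fun ζ => ξ / (ξ ^ 2 + ζ ^ 2)) (Ioi 0) := by
  have := integrableOn_poisson_mul hξ (G := fun _ => 1) (A := 1) (B := 0)
    aestronglyMeasurable_const (by simp)
  simpa using this

theorem integrableOn_poisson_log {ξ : ℝ} (hξ : 0 < ξ) :
    IntegrableOn (fun ζ => ξ / (ξ ^ 2 + ζ ^ 2) * Real.log ζ) (Ioi 0) :=
  integrableOn_poisson_mul hξ (A := 0) (B := 1) Real.measurable_log.aestronglyMeasurable (by simp)

theorem integral_poisson_comp {ξ : ℝ} (hξ : 0 < ξ) (f : ℝ → ℝ) :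
    ∫ ζ in Ioi (0 : ℝ), ξ / (ξ ^ 2 + ζ ^ 2) * f ζ =
      ∫ t in Ioi (0 : ℝ), (1 + t ^ 2)⁻¹ * f (ξ * t) := by
  have := integral_comp_mul_left_Ioi (fun ζ => ξ / (ξ ^ 2 + ζ ^ 2) * f ζ) 0 hξ
  rw [mul_zero, smul_eq_mul] at this
  rw [eq_comm, inv_mul_eq_iff_eq_mul₀ hξ.ne'] at this
  rw [this, ← integral_const_mul]
  refine integral_congr_ae (Eventually.of_forall fun t => ?_)
  have : 1 + t ^ 2 ≠ 0 := by positivity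
  have : ξ ^ 2 + (ξ * t) ^ 2 ≠ 0 := by positivity
  simp only
  field_simp

theorem integral_poisson {ξ : ℝ} (hξ : 0 < ξ) :
    ∫ ζ in Ioi (0 : ℝ), ξ / (ξ ^ 2 + ζ ^ 2) = Real.pi / 2 := by
  have := integral_poisson_comp hξ fun _ => 1
  simp only [mul_one] at this
  rw [this, integral_Ioi_inv_one_add_sq]
  simp

/-- The substitution `t ↦ 1/t` preserves `dt / (1 + t²)` and changes the sign of `log t`. -/
theorem integral_inv_one_add_sq_mul_log :
    ∫ t in Ioi (0 : ℝ), (1 + t ^ 2)⁻¹ * Real.log t = 0 := by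
  have h := integral_comp_rpow_Ioi (fun t : ℝ => (1 + t ^ 2)⁻¹ * Real.log t) (p := -1) (by norm_num)
  have : ∫ x in Ioi (0 : ℝ), (|(-1 : ℝ)| * x ^ ((-1 : ℝ) - 1)) •
      ((1 + (x ^ (-1 : ℝ)) ^ 2)⁻¹ * Real.log (x ^ (-1 : ℝ))) =
      ∫ x in Ioi (0 : ℝ), -((1 + x ^ 2)⁻¹ * Real.log x) := by
    refine setIntegral_congr_fun measurableSet_Ioi fun x hx => ?_
    have hx : 0 < x := hx
    have e : x ^ ((-1 : ℝ) - 1) = (x ^ 2)⁻¹ := by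
      rw [show (-1 : ℝ) - 1 = -2 by norm_num, Real.rpow_neg hx.le]; norm_cast
    simp only [abs_neg, abs_one, one_mul, e, smul_eq_mul, Real.rpow_neg_one, Real.log_inv]
    field_simp
    ring
  rw [this, integral_neg] at h
  linarith

theorem integral_poisson_log {ξ : ℝ} (hξ : 0 < ξ) :
    ∫ ζ in Ioi (0 : ℝ), ξ / (ξ ^ 2 + ζ ^ 2) * Real.log ζ = Real.pi / 2 * Real.log ξ := by
  rw [integral_poisson_comp hξ]
  have h1 : ∫ t in Ioi (0 : ℝ), (1 + t ^ 2)⁻¹ * Real.log (ξ * t) =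
      ∫ t in Ioi (0 : ℝ), ((1 + t ^ 2)⁻¹ * Real.log ξ + (1 + t ^ 2)⁻¹ * Real.log t) := by
    refine setIntegral_congr_fun measurableSet_Ioi fun x hx => ?_
    have hx : 0 < x := hx
    rw [Real.log_mul hξ.ne' hx.ne', mul_add]
  have h2 : IntegrableOn (fun t : ℝ => (1 + t ^ 2)⁻¹ * Real.log t) (Ioi 0) := by
    simpa using integrableOn_poisson_log one_pos
  rw [h1, integral_add (integrableOn_inv_one_add_sq.mul_const _) h2,
    integral_inv_one_add_sq_mul_log, integral_mul_const, integral_Ioi_inv_one_add_sq]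
  simp

/-- Partial fractions in `ζ²` reduce to two Poisson kernels of mass `π/2`. The case `τ = ξ`, where
they degenerate, is a null set in the later integration over `τ`. -/
theorem integral_poisson_mul_poisson {ξ τ : ℝ} (hξ : 0 < ξ) (hτ : 0 < τ) (h : τ ≠ ξ) :
    ∫ ζ in Ioi (0 : ℝ), ξ / (ξ ^ 2 + ζ ^ 2) * (2 * τ / (τ ^ 2 + ζ ^ 2)) = Real.pi / (ξ + τ) := by
  have hne : τ - ξ ≠ 0 := sub_ne_zero.2 h
  have hne' : τ + ξ ≠ 0 := by positivity
  have e : ∀ ζ : ℝ, ξ / (ξ ^ 2 + ζ ^ 2) * (2 * τ / (τ ^ 2 + ζ ^ 2)) =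
      2 * τ / ((τ - ξ) * (τ + ξ)) * (ξ / (ξ ^ 2 + ζ ^ 2)) -
        2 * ξ / ((τ - ξ) * (τ + ξ)) * (τ / (τ ^ 2 + ζ ^ 2)) := fun ζ => by
    have : ξ ^ 2 + ζ ^ 2 ≠ 0 := by positivity
    have : τ ^ 2 + ζ ^ 2 ≠ 0 := by positivity
    field_simp
    ring
  simp_rw [e]
  rw [integral_sub ((integrableOn_poisson hξ).const_mul _) ((integrableOn_poisson hτ).const_mul _),
    integral_const_mul, integral_const_mul, integral_poisson hξ, integral_poisson hτ]
  field_simp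
  ring

theorem abs_log_add_sub_le {s z w : ℝ} (hs : 0 ≤ s) (hz : 0 < z) (hw : 0 < w) :
    |Real.log (z + s) - Real.log (w + s)| ≤ |Real.log z - Real.log w| := by
  wlog hzw : w ≤ z generalizing z w
  · rw [abs_sub_comm, abs_sub_comm (Real.log z)]
    exact this hw hz (le_of_not_ge hzw)
  have h1 : Real.log w ≤ Real.log z := Real.log_le_log hw hzw
  have h2 : Real.log (w + s) ≤ Real.log (z + s) := Real.log_le_log (by linarith) (by linarith)
  rw [abs_of_nonneg (by linarith), abs_of_nonneg (by linarith),
    ← Real.log_div (by linarith) (by linarith), ← Real.log_div hz.ne' hw.ne']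
  refine Real.log_le_log (div_pos (by linarith) (by linarith)) ?_
  rw [div_le_div_iff₀ (by linarith) hw]
  nlinarith

theorem abs_le_of_log_lipschitz {G : ℝ → ℝ} {z₀ z : ℝ}
    (h : |G (z ^ 2) - G z₀| ≤ |Real.log (z ^ 2) - Real.log z₀|) :
    |G (z ^ 2)| ≤ (|G z₀| + |Real.log z₀|) + 2 * |Real.log z| := by
  have h1 : |Real.log (z ^ 2) - Real.log z₀| ≤ 2 * |Real.log z| + |Real.log z₀| := by
    rw [Real.log_pow]
    refine (abs_sub _ _).trans ?_
    rw [abs_mul]; simp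
  have h2 := abs_sub_abs_le_abs_sub (G (z ^ 2)) (G z₀)
  linarith

theorem integrableOn_poisson_mul_log_add {ξ s : ℝ} (hξ : 0 < ξ) (hs : 0 ≤ s) :
    IntegrableOn (fun ζ => ξ / (ξ ^ 2 + ζ ^ 2) * Real.log (ζ ^ 2 + s)) (Ioi 0) := by
  have hm : Measurable fun ζ : ℝ => Real.log (ζ ^ 2 + s) :=
    Real.measurable_log.comp (by fun_prop)
  refine integrableOn_poisson_mul hξ (A := |Real.log (1 + s)| + |Real.log 1|) (B := 2)
    hm.aestronglyMeasurable ?_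
  refine (ae_restrict_mem measurableSet_Ioi).mono fun ζ hζ => ?_
  have hζ : 0 < ζ := hζ
  exact abs_le_of_log_lipschitz (G := fun z => Real.log (z + s))
    (abs_log_add_sub_le hs (by positivity) one_pos)

theorem intervalIntegral_two_mul_div {ζ σ : ℝ} (hζ : 0 < ζ) :
    ∫ τ in (0 : ℝ)..σ, 2 * τ / (τ ^ 2 + ζ ^ 2) = Real.log (ζ ^ 2 + σ ^ 2) - 2 * Real.log ζ := by
  have hne : ∀ τ : ℝ, τ ^ 2 + ζ ^ 2 ≠ 0 := fun τ => by positivity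
  rw [intervalIntegral.integral_eq_sub_of_hasDerivAt
    (f := fun τ => Real.log (τ ^ 2 + ζ ^ 2))]
  · rw [add_comm]; simp
  · intro τ _
    have h1 : HasDerivAt (fun τ : ℝ => τ ^ 2 + ζ ^ 2) (2 * τ) τ := by
      simpa using (hasDerivAt_pow 2 τ).add_const (ζ ^ 2)
    exact h1.log (hne τ)
  · exact (Continuous.div (by fun_prop) (by fun_prop) hne).intervalIntegrable _ _

theorem intervalIntegral_pi_div {ξ σ : ℝ} (hξ : 0 < ξ) (hσ : 0 ≤ σ) :
    ∫ τ in (0 : ℝ)..σ, Real.pi / (ξ + τ) = Real.pi * (Real.log (ξ + σ) - Real.log ξ) := by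
  have hpos : ∀ τ ∈ uIcc 0 σ, 0 < ξ + τ := fun τ hτ => by
    rw [uIcc_of_le hσ] at hτ
    linarith [hτ.1]
  rw [intervalIntegral.integral_eq_sub_of_hasDerivAt
    (f := fun τ => Real.pi * Real.log (ξ + τ))]
  · simp; ring
  · intro τ hτ
    have := (((hasDerivAt_id τ).const_add ξ).log (hpos τ hτ).ne').const_mul Real.pi
    simpa [div_eq_mul_inv] using this
  · refine (ContinuousOn.div (by fun_prop) (by fun_prop) fun τ hτ => ?_).intervalIntegrable
    exact (hpos τ hτ).ne'

/-- Write `log(ζ² + σ²) - 2 log ζ = ∫₀^σ 2τ/(τ² + ζ²) dτ`. By Fubini the inner integral becomes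
`π/(ξ + τ)`, which integrates back to a logarithm. -/
theorem integral_poisson_mul_log_add_sq {ξ σ : ℝ} (hξ : 0 < ξ) (hσ : 0 ≤ σ) :
    ∫ ζ in Ioi (0 : ℝ), ξ / (ξ ^ 2 + ζ ^ 2) * Real.log (ζ ^ 2 + σ ^ 2) =
      Real.pi * Real.log (ξ + σ) := by
  set f : ℝ → ℝ → ℝ := fun ζ τ => ξ / (ξ ^ 2 + ζ ^ 2) * (2 * τ / (τ ^ 2 + ζ ^ 2)) with hf
  have hnn : ∀ ζ τ, 0 ≤ τ → 0 ≤ f ζ τ := fun ζ τ hτ => by simp only [hf]; positivity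
  have hin : ∀ ζ, 0 < ζ → ∫ τ in Ioc 0 σ, f ζ τ =
      ξ / (ξ ^ 2 + ζ ^ 2) * Real.log (ζ ^ 2 + σ ^ 2) -
        2 * (ξ / (ξ ^ 2 + ζ ^ 2) * Real.log ζ) := fun ζ hζ => by
    rw [integral_const_mul, ← intervalIntegral.integral_of_le hσ, intervalIntegral_two_mul_div hζ]
    ring
  have hI := integrableOn_poisson_mul_log_add hξ (sq_nonneg σ)
  have hI' := (integrableOn_poisson_log hξ).const_mul 2
  have hint : Integrable (Function.uncurry f)
      ((volume.restrict (Ioi 0)).prod (volume.restrict (Ioc 0 σ))) := by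
    have hm : Measurable (Function.uncurry f) := by
      simp only [hf, Function.uncurry_def]; fun_prop
    rw [integrable_prod_iff hm.aestronglyMeasurable]
    constructor
    · refine (ae_restrict_mem measurableSet_Ioi).mono fun ζ hζ => ?_
      have hζ : 0 < ζ := hζ
      have : Continuous fun τ => f ζ τ := by
        simp only [hf]
        exact continuous_const.mul (Continuous.div (by fun_prop) (by fun_prop)
          fun τ => by positivity)
      exact (this.integrableOn_Icc (a := 0) (b := σ)).mono_set Ioc_subset_Icc_self
    · refine (hI.sub hI').congr ?_
      refine (ae_restrict_mem measurableSet_Ioi).mono fun ζ hζ => ?_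
      simp only [Pi.sub_apply, Function.uncurry]
      rw [← hin ζ hζ]
      exact setIntegral_congr_fun measurableSet_Ioc fun τ hτ =>
        (Real.norm_of_nonneg (hnn ζ τ hτ.1.le)).symm
  have hsw := integral_integral_swap hint
  have h1 : ∫ ζ in Ioi (0 : ℝ), ∫ τ in Ioc 0 σ, f ζ τ =
      (∫ ζ in Ioi (0 : ℝ), ξ / (ξ ^ 2 + ζ ^ 2) * Real.log (ζ ^ 2 + σ ^ 2)) -
        2 * (Real.pi / 2 * Real.log ξ) := by
    rw [← integral_poisson_log hξ, ← integral_const_mul, ← integral_sub hI hI']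
    exact setIntegral_congr_fun measurableSet_Ioi hin
  have h2 : ∫ τ in Ioc 0 σ, ∫ ζ in Ioi (0 : ℝ), f ζ τ =
      Real.pi * (Real.log (ξ + σ) - Real.log ξ) := by
    rw [← intervalIntegral_pi_div hξ hσ, intervalIntegral.integral_of_le hσ]
    refine setIntegral_congr_ae measurableSet_Ioc ?_
    filter_upwards [volume.ae_ne ξ] with τ hτ hτ'
    exact integral_poisson_mul_poisson hξ hτ'.1 hτ
  rw [h1, h2] at hsw
  linarith

theorem integral_poisson_mul_log_add {ξ s : ℝ} (hξ : 0 < ξ) (hs : 0 ≤ s) :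
    ∫ ζ in Ioi (0 : ℝ), ξ / (ξ ^ 2 + ζ ^ 2) * Real.log (ζ ^ 2 + s) =
      Real.pi * Real.log (ξ + √s) := by
  have := integral_poisson_mul_log_add_sq hξ (Real.sqrt_nonneg s)
  rwa [Real.sq_sqrt hs] at this

/-! ### Wiener–Hopf factors: the rational case and limits -/

/-- The Wiener–Hopf factor of `ξ ↦ h (ξ²)`. -/
noncomputable def wienerHopf (h : ℝ → ℝ) (ξ : ℝ) : ℝ :=
  Real.exp (Real.pi⁻¹ * ∫ ζ in Ioi (0 : ℝ), ξ / (ξ ^ 2 + ζ ^ 2) * Real.log (h (ζ ^ 2)))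

/-- The Wiener–Hopf factor of the reciprocal of a rational Stieltjes function. -/
theorem HasCBFRep.wienerHopf_rational (s q : ℕ → ℝ) (n : ℕ) (hs0 : 0 < s 0) (hs : StrictMono s)
    (hq : ∀ i, 0 < q i) :
    HasCBFRep (wienerHopf fun z => (∑ i ∈ Finset.range (n + 1), q i / (z + s i))⁻¹) := by
  obtain ⟨r, C, hC, hr, hfac⟩ := exists_interlacing_zeros s q n hs0 hs hq
  have hspos : ∀ i, 0 < s i := fun i => hs0.trans_le (hs.monotone (Nat.zero_le i))
  have hrpos : ∀ i, 0 < r i := fun i => (hspos i).trans (hr i).1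
  -- A factor `ζ² + s` of the argument contributes `ξ + √s`, and the constant `C` contributes its
  -- square root since the Poisson kernel has mass `π/2`. Square roots preserve interlacing.
  have key : HasCBFRep fun ξ => (√C)⁻¹ * ((∏ i ∈ Finset.range (n + 1), (ξ + √(s i))) /
      ∏ i ∈ Finset.range n, (ξ + √(r i))) := by
    refine (HasCBFRep.prod_interlacing _ _ n (fun i _ => Real.sqrt_pos.2 (hspos i))
      (fun i _ => Real.sqrt_lt_sqrt (hspos i).le (hr i).1) fun i j _ hij => ?_).const_mul
        (by positivity)
    exact Real.sqrt_lt_sqrt (hrpos i).le ((hr i).2.trans_le (hs.monotone hij))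
  refine key.congr fun ξ hξ => ?_
  have hlog : ∀ ζ ∈ Ioi (0 : ℝ), ξ / (ξ ^ 2 + ζ ^ 2) *
      Real.log ((∑ i ∈ Finset.range (n + 1), q i / (ζ ^ 2 + s i))⁻¹) =
      (∑ i ∈ Finset.range (n + 1), ξ / (ξ ^ 2 + ζ ^ 2) * Real.log (ζ ^ 2 + s i)) -
      (∑ i ∈ Finset.range n, ξ / (ξ ^ 2 + ζ ^ 2) * Real.log (ζ ^ 2 + r i)) -
        ξ / (ξ ^ 2 + ζ ^ 2) * Real.log C := by
    intro ζ hζ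
    have hζ : 0 < ζ := hζ
    have h1 : ∀ i ∈ Finset.range (n + 1), ζ ^ 2 + s i ≠ 0 := fun i _ => by
      have := hspos i; positivity
    have h2 : ∀ i ∈ Finset.range n, ζ ^ 2 + r i ≠ 0 := fun i _ => by
      have := hrpos i; positivity
    have h2' := Finset.prod_ne_zero_iff.2 h2
    rw [hfac _ (by positivity), inv_div, Real.log_div (Finset.prod_ne_zero_iff.2 h1)
      (mul_ne_zero hC.ne' h2'), Real.log_mul hC.ne' h2', Real.log_prod h1, Real.log_prod h2,
      ← Finset.mul_sum, ← Finset.mul_sum]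
    ring
  have hi1 := fun i => integrableOn_poisson_mul_log_add hξ (hspos i).le
  have hi2 := fun i => integrableOn_poisson_mul_log_add hξ (hrpos i).le
  rw [wienerHopf, setIntegral_congr_fun measurableSet_Ioi hlog, integral_sub, integral_sub,
    integral_finsetSum _ fun i _ => hi1 i, integral_finsetSum _ fun i _ => hi2 i,
    integral_mul_const, integral_poisson hξ]
  rotate_left
  · exact integrable_finsetSum _ fun i _ => hi1 i
  · exact integrable_finsetSum _ fun i _ => hi2 i
  · exact (integrable_finsetSum _ fun i _ => hi1 i).sub (integrable_finsetSum _ fun i _ => hi2 i)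
  · exact (integrableOn_poisson hξ).mul_const _
  simp_rw [integral_poisson_mul_log_add hξ (hspos _).le, integral_poisson_mul_log_add hξ (hrpos _).le]
  rw [← Finset.mul_sum, ← Finset.mul_sum]
  have e : Real.pi⁻¹ * (Real.pi * ∑ i ∈ Finset.range (n + 1), Real.log (ξ + √(s i)) -
      Real.pi * ∑ i ∈ Finset.range n, Real.log (ξ + √(r i)) - Real.pi / 2 * Real.log C) =
      Real.log ((√C)⁻¹ * ((∏ i ∈ Finset.range (n + 1), (ξ + √(s i))) /
      ∏ i ∈ Finset.range n, (ξ + √(r i)))) := by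
    have h1 : ∀ i ∈ Finset.range (n + 1), ξ + √(s i) ≠ 0 := fun i _ => by positivity
    have h2 : ∀ i ∈ Finset.range n, ξ + √(r i) ≠ 0 := fun i _ => by positivity
    have h1' := Finset.prod_ne_zero_iff.2 h1
    have h2' := Finset.prod_ne_zero_iff.2 h2
    rw [Real.log_mul (by positivity) (div_ne_zero h1' h2'), Real.log_div h1' h2', Real.log_inv,
      Real.log_sqrt hC.le, Real.log_prod h1, Real.log_prod h2]
    have := Real.pi_pos.ne'
    field_simp
    ring
  rw [e, Real.exp_log]
  positivity

/-- `h` is positive and `log h` is 1-Lipschitz in `log z` off the point `a`, and the Wiener–Hopf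
factor of `h` has an integral representation. -/
structure IsWHFactorable (a : ℝ) (h : ℝ → ℝ) : Prop where
  pos : ∀ z, 0 < z → z ≠ a → 0 < h z
  lip : ∀ z w, 0 < z → z ≠ a → 0 < w → w ≠ a →
    |Real.log (h z) - Real.log (h w)| ≤ |Real.log z - Real.log w|
  meas : AEStronglyMeasurable (fun ζ => Real.log (h (ζ ^ 2))) (volume.restrict (Ioi 0))
  rep : HasCBFRep (wienerHopf h)

theorem ae_sq_ne {a : ℝ} : ∀ᵐ ζ ∂volume.restrict (Ioi (0 : ℝ)), 0 < ζ ∧ ζ ^ 2 ≠ a := by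
  filter_upwards [ae_restrict_mem measurableSet_Ioi,
    ae_restrict_of_ae (volume.ae_ne (√a))] with ζ h1 h2
  have h1 : 0 < ζ := h1
  refine ⟨h1, fun h => h2 ?_⟩
  rw [← h, Real.sqrt_sq h1.le]

/-- The Lipschitz condition is what makes the class closed: values of `log (h n)` at the single
point `a + 1` are bounded because they converge, and the condition spreads this to a bound `M + |log
(a + 1)| + 2 |log ζ|` at `ζ²`, integrable against the Poisson kernel. The point `a` is excluded
because a difference quotient is `0/0` there; it costs only a null set. -/
theorem IsWHFactorable.of_tendsto {a : ℝ} (ha : 0 < a) {h : ℕ → ℝ → ℝ} {g : ℝ → ℝ}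
    (hh : ∀ n, IsWHFactorable a (h n))
    (hlim : ∀ z, 0 < z → z ≠ a → Tendsto (fun n => h n z) atTop (𝓝 (g z)))
    (hg : ∀ z, 0 < z → z ≠ a → 0 < g z) : IsWHFactorable a g := by
  have hlog : ∀ z, 0 < z → z ≠ a →
      Tendsto (fun n => Real.log (h n z)) atTop (𝓝 (Real.log (g z))) :=
    fun z hz hza => (hlim z hz hza).log (hg z hz hza).ne'
  have haelim : ∀ᵐ ζ ∂volume.restrict (Ioi (0 : ℝ)),
      Tendsto (fun n => Real.log (h n (ζ ^ 2))) atTop (𝓝 (Real.log (g (ζ ^ 2)))) :=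
    ae_sq_ne.mono fun ζ hζ => hlog _ (pow_pos hζ.1 2) hζ.2
  refine ⟨hg, fun z w hz hza hw hwa => ?_, ?_, ?_⟩
  · exact le_of_tendsto (((hlog z hz hza).sub (hlog w hw hwa)).abs)
      (Eventually.of_forall fun n => (hh n).lip z w hz hza hw hwa)
  · exact aestronglyMeasurable_of_tendsto_ae atTop (fun n => (hh n).meas) haelim
  · refine HasCBFRep.of_tendsto (fun n => (hh n).rep) fun ξ hξ => ?_
    refine (Real.continuous_exp.tendsto _).comp (Tendsto.const_mul _ ?_)
    have ha1 : a + 1 ≠ a := by simp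
    obtain ⟨M, hM⟩ := (hlog (a + 1) (by linarith) ha1).abs.bddAbove_range
    have hint := ((integrableOn_log_bound (M + |Real.log (a + 1)|) 2).const_mul (ξ + ξ⁻¹))
    have hw : Measurable fun ζ : ℝ => ξ / (ξ ^ 2 + ζ ^ 2) := by fun_prop
    refine tendsto_integral_of_dominated_convergence _
      (fun n => hw.aestronglyMeasurable.mul (hh n).meas) hint ?_ ?_
    · intro n
      refine (ae_sq_ne (a := a)).mono fun ζ hζ => ?_
      have h1 := abs_le_of_log_lipschitz (G := fun z => Real.log (h n z)) (z := ζ)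
        ((hh n).lip (ζ ^ 2) (a + 1) (pow_pos hζ.1 2) hζ.2 (by linarith) ha1)
      have h2 : |Real.log (h n (a + 1))| ≤ M := hM ⟨n, rfl⟩
      rw [norm_mul, Real.norm_of_nonneg (by positivity), Real.norm_eq_abs, ← mul_assoc]
      exact mul_le_mul (poisson_le hξ ζ) (by linarith) (abs_nonneg _) (by positivity)
    · exact haelim.mono fun ζ hζ => hζ.const_mul _

/-- Reciprocals of rational Stieltjes functions. -/
theorem IsWHFactorable.rational (a : ℝ) (s q : ℕ → ℝ) (n : ℕ) (hs0 : 0 < s 0) (hs : StrictMono s)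
    (hq : ∀ i, 0 < q i) :
    IsWHFactorable a fun z => (∑ i ∈ Finset.range (n + 1), q i / (z + s i))⁻¹ := by
  have hspos : ∀ i, 0 < s i := fun i => hs0.trans_le (hs.monotone (Nat.zero_le i))
  have hpos : ∀ z, 0 < z → 0 < ∑ i ∈ Finset.range (n + 1), q i / (z + s i) := fun z hz =>
    Finset.sum_pos (fun i _ => div_pos (hq i) (by linarith [hspos i])) (by simp)
  refine ⟨fun z hz _ => inv_pos.2 (hpos z hz), fun z w hz hza hw hwa => ?_, ?_,
    HasCBFRep.wienerHopf_rational s q n hs0 hs hq⟩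
  · wlog hwz : w ≤ z generalizing z w
    · rw [abs_sub_comm, abs_sub_comm (Real.log z)]
      exact this w z hw hwa hz hza (le_of_not_ge hwz)
    -- The sum `S(z)` decreases while `z S(z)` increases. Hence `log (1/S)` increases, and no faster
    -- than `log z`.
    have h1 : ∑ i ∈ Finset.range (n + 1), q i / (z + s i) ≤
        ∑ i ∈ Finset.range (n + 1), q i / (w + s i) := Finset.sum_le_sum fun i _ =>
      div_le_div_of_nonneg_left (hq i).le (by linarith [hspos i]) (by linarith)
    have h2 : w * ∑ i ∈ Finset.range (n + 1), q i / (w + s i) ≤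
        z * ∑ i ∈ Finset.range (n + 1), q i / (z + s i) := by
      rw [Finset.mul_sum, Finset.mul_sum]
      refine Finset.sum_le_sum fun i _ => ?_
      have := hspos i
      have := hq i
      rw [mul_div_assoc', mul_div_assoc', div_le_div_iff₀ (by linarith) (by linarith)]
      have : 0 ≤ q i * s i * (z - w) :=
        mul_nonneg (by positivity) (by linarith)
      nlinarith
    have h3 := Real.log_le_log (hpos z hz) h1
    have h4 := Real.log_le_log (mul_pos hw (hpos w hw)) h2
    rw [Real.log_mul hw.ne' (hpos w hw).ne', Real.log_mul hz.ne' (hpos z hz).ne'] at h4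
    have h5 := Real.log_le_log hw hwz
    rw [Real.log_inv, Real.log_inv, abs_of_nonneg (by linarith), abs_of_nonneg (by linarith)]
    linarith
  · refine Measurable.aestronglyMeasurable ?_
    refine Real.measurable_log.comp ?_
    fun_prop

/-! ### Taylor expansion of completely monotone functions -/

section CompletelyMonotone

variable {m : ℝ → ℝ}

theorem IsCompletelyMonotone.nonneg (hm : IsCompletelyMonotone m) {s : ℝ} (hs : 0 < s) :
    0 ≤ m s := by
  simpa using hm.2 0 s hs

theorem IsCompletelyMonotone.contDiffAt (hm : IsCompletelyMonotone m) {s : ℝ} (hs : 0 < s) :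
    ContDiffAt ℝ ∞ m s := hm.1.contDiffAt (Ioi_mem_nhds hs)

theorem IsCompletelyMonotone.aestronglyMeasurable (hm : IsCompletelyMonotone m) :
    AEStronglyMeasurable m (volume.restrict (Ioi 0)) :=
  hm.1.continuousOn.aestronglyMeasurable measurableSet_Ioi

/-- The coefficients of the Taylor expansion of `m` at `A` in powers of `1 - s / A`. -/
noncomputable def taylorWeight (m : ℝ → ℝ) (A : ℝ) (k : ℕ) : ℝ :=
  ((-1 : ℝ) ^ k * iteratedDeriv k m A) * A ^ k / (k.factorial : ℝ)

theorem IsCompletelyMonotone.taylorWeight_nonneg (hm : IsCompletelyMonotone m) {A : ℝ} (hA : 0 < A)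
    (k : ℕ) : 0 ≤ taylorWeight m A k :=
  div_nonneg (mul_nonneg (hm.2 k A hA) (by positivity)) (by positivity)

/-- Expanding at a point `A` to the right of `s` pairs the alternating signs of the derivatives with
powers of `s - A < 0`, so every term and the remainder are nonnegative. -/
theorem IsCompletelyMonotone.eq_taylor_add_remainder (hm : IsCompletelyMonotone m) {A s : ℝ}
    (hs : 0 < s) (hsA : s < A) (n : ℕ) :
    m s = ∑ k ∈ Finset.range (n + 1), taylorWeight m A k * (1 - s / A) ^ k +
      ∫ t in s..A, (t - s) ^ n / (n.factorial : ℝ) *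
        ((-1 : ℝ) ^ (n + 1) * iteratedDeriv (n + 1) m t) := by
  have hA : 0 < A := hs.trans hsA
  have hpos : ∀ t ∈ uIcc A s, 0 < t := fun t ht => by
    rw [uIcc_of_ge hsA.le] at ht; exact hs.trans_le ht.1
  have hcd : ∀ N : ℕ, ContDiffOn ℝ N m (uIcc A s) := fun N =>
    (hm.1.of_le (by exact_mod_cast le_top)).mono hpos
  have hu : UniqueDiffOn ℝ (uIcc A s) := uniqueDiffOn_uIcc hsA.ne'
  have hid : ∀ k, ∀ t ∈ uIcc A s, iteratedDerivWithin k m (uIcc A s) t = iteratedDeriv k m t :=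
    fun k t ht => iteratedDerivWithin_eq_iteratedDeriv hu
      ((hm.contDiffAt (hpos t ht)).of_le (by exact_mod_cast le_top)) ht
  have h := taylor_integral_remainder (hcd (n + 1))
  rw [taylor_within_apply, sub_eq_iff_eq_add'] at h
  rw [h]
  congr 1
  · refine Finset.sum_congr rfl fun k _ => ?_
    rw [hid k A left_mem_uIcc, taylorWeight, smul_eq_mul]
    have e : (s - A) ^ k = (-1) ^ k * (A ^ k * (1 - s / A) ^ k) := by
      rw [← mul_pow, ← mul_pow]; congr 1; field_simp; ring
    rw [e]
    field_simp
  · rw [intervalIntegral.integral_symm, ← intervalIntegral.integral_neg]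
    refine intervalIntegral.integral_congr fun t ht => ?_
    simp only [smul_eq_mul]
    rw [hid _ t (by rwa [uIcc_comm])]
    have e : (s - t) ^ n = (-1) ^ n * (t - s) ^ n := by rw [← mul_pow]; congr 1; ring
    rw [e, pow_succ]
    ring

theorem IsCompletelyMonotone.remainder_intervalIntegrable (hm : IsCompletelyMonotone m) {A s y : ℝ}
    (hs : 0 < s) (hsA : s ≤ A) (n : ℕ) :
    IntervalIntegrable (fun t => (t - y) ^ n / (n.factorial : ℝ) *
        ((-1 : ℝ) ^ (n + 1) * iteratedDeriv (n + 1) m t)) volume s A := by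
  refine ContinuousOn.intervalIntegrable ?_
  rw [uIcc_of_le hsA]
  refine ContinuousOn.mul (by fun_prop) (continuousOn_const.mul fun t ht => ?_)
  have ht0 : 0 < t := hs.trans_le ht.1
  have : ContinuousOn (iteratedDeriv (n + 1) m) (Ioi 0) := by
    have h1 := hm.1.continuousOn_iteratedDerivWithin (m := n + 1)
      (by exact_mod_cast le_top) (uniqueDiffOn_Ioi 0)
    refine h1.congr fun x hx => ?_
    exact (iteratedDerivWithin_of_isOpen isOpen_Ioi hx).symm
  exact ((this t ht0).continuousAt (Ioi_mem_nhds ht0)).continuousWithinAt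

/-- Bernstein's argument. Nonnegative terms force the remainder `R n y` to be at most `m y`. With `y
= s/2` and `c = (A - s)/(A - y) < 1`, one has `t - s ≤ c (t - y)` for `t ≤ A`, so `R n s ≤ cⁿ R n y
≤ cⁿ m y → 0`. -/
theorem IsCompletelyMonotone.tendsto_taylor (hm : IsCompletelyMonotone m) {A s : ℝ}
    (hs : 0 < s) (hsA : s < A) :
    (∀ n, ∑ k ∈ Finset.range n, taylorWeight m A k * (1 - s / A) ^ k ≤ m s) ∧
    Tendsto (fun n => ∑ k ∈ Finset.range n, taylorWeight m A k * (1 - s / A) ^ k)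
      atTop (𝓝 (m s)) := by
  have hA : 0 < A := hs.trans hsA
  set R : ℕ → ℝ → ℝ := fun n y => ∫ t in y..A, (t - y) ^ n / (n.factorial : ℝ) *
        ((-1 : ℝ) ^ (n + 1) * iteratedDeriv (n + 1) m t) with hR
  have hint : ∀ n y y', 0 < y' → ∀ t ∈ Icc y' A, y ≤ y' → 0 ≤ (t - y) ^ n / (n.factorial : ℝ) *
        ((-1 : ℝ) ^ (n + 1) * iteratedDeriv (n + 1) m t) := fun n y y' hy t ht hyy =>
    mul_nonneg (div_nonneg (pow_nonneg (by linarith [ht.1]) _) (by positivity))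
      (hm.2 _ _ (hy.trans_le ht.1))
  have hRnn : ∀ n y, 0 < y → y < A → 0 ≤ R n y := fun n y hy hyA =>
    intervalIntegral.integral_nonneg hyA.le fun t ht => hint n y y hy t ht le_rfl
  have hterm : ∀ y, y < A → ∀ k, 0 ≤ taylorWeight m A k * (1 - y / A) ^ k := fun y hy k =>
    mul_nonneg (hm.taylorWeight_nonneg hA k)
      (pow_nonneg (sub_nonneg.2 ((div_le_one hA).2 hy.le)) _)
  have hRle : ∀ n y, 0 < y → y < A → R n y ≤ m y := fun n y hy hyA => by
    rw [hm.eq_taylor_add_remainder hy hyA n]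
    have := Finset.sum_nonneg fun k (_ : k ∈ Finset.range (n + 1)) => hterm y hyA k
    simp only [hR]; linarith
  constructor
  · intro n
    rcases n with _ | n
    · simpa using hm.nonneg hs
    · rw [hm.eq_taylor_add_remainder hs hsA n]
      have := hRnn n s hs hsA
      simp only [hR] at this; linarith
  · set y := s / 2 with hy
    have hy0 : 0 < y := by positivity
    have hys : y < s := by simp only [hy]; linarith
    have hyA : y < A := hys.trans hsA
    set c := (A - s) / (A - y) with hc
    have hc0 : 0 ≤ c := div_nonneg (by linarith) (by linarith)
    have hc1 : c < 1 := by rw [hc, div_lt_one (by linarith)]; linarith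
    have hbound : ∀ n, R n s ≤ c ^ n * m y := fun n => by
      refine le_trans ?_ (mul_le_mul_of_nonneg_left (hRle n y hy0 hyA) (pow_nonneg hc0 n))
      have h1 : R n s ≤ c ^ n * ∫ t in s..A, (t - y) ^ n / (n.factorial : ℝ) *
          ((-1 : ℝ) ^ (n + 1) * iteratedDeriv (n + 1) m t) := by
        rw [← intervalIntegral.integral_const_mul]
        refine intervalIntegral.integral_mono_on hsA.le
          (hm.remainder_intervalIntegrable hs hsA.le n)
          ((hm.remainder_intervalIntegrable hs hsA.le n).const_mul _) fun t ht => ?_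
        rw [← mul_assoc (c ^ n), mul_div_assoc', ← mul_pow]
        refine mul_le_mul_of_nonneg_right ?_ (hm.2 _ _ (hs.trans_le ht.1))
        refine div_le_div_of_nonneg_right (pow_le_pow_left₀ (by linarith [ht.1]) ?_ n)
          (by positivity)
        rw [hc, div_mul_eq_mul_div, le_div_iff₀ (by linarith)]
        nlinarith [mul_nonneg (sub_nonneg.2 ht.2) (sub_nonneg.2 hys.le)]
      refine h1.trans (mul_le_mul_of_nonneg_left ?_ (pow_nonneg hc0 n))
      have h2 := intervalIntegral.integral_add_adjacent_intervals
        (hm.remainder_intervalIntegrable (y := y) hy0 hys.le n)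
        (hm.remainder_intervalIntegrable (y := y) hs hsA.le n)
      have h3 : 0 ≤ ∫ t in y..s, (t - y) ^ n / (n.factorial : ℝ) *
          ((-1 : ℝ) ^ (n + 1) * iteratedDeriv (n + 1) m t) :=
        intervalIntegral.integral_nonneg hys.le fun t ht =>
          hint n y y hy0 t ⟨ht.1, ht.2.trans hsA.le⟩ le_rfl
      simp only [hR]; linarith
    have hR0 : Tendsto (fun n => R n s) atTop (𝓝 0) := by
      refine squeeze_zero (fun n => hRnn n s hs hsA) hbound ?_
      simpa using (tendsto_pow_atTop_nhds_zero_of_lt_one hc0 hc1).mul_const (m y)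
    rw [← tendsto_add_atTop_iff_nat 1]
    have : (fun n => ∑ k ∈ Finset.range (n + 1), taylorWeight m A k * (1 - s / A) ^ k) =
        fun n => m s - R n s := funext fun n => by
      have := hm.eq_taylor_add_remainder hs hsA n
      simp only [hR]; linarith
    rw [this]
    simpa using hR0.const_sub (m s)

end CompletelyMonotone

/-! ### Rational approximation of the Lévy integral -/

variable {m : ℝ → ℝ}

theorem IsCompletelyMonotone.integrableOn_mul (hm : IsCompletelyMonotone m)
    (hint : IntegrableOn (fun s : ℝ => min 1 s * m s) (Ioi 0)) {f : ℝ → ℝ} {C : ℝ}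
    (hf : AEStronglyMeasurable f (volume.restrict (Ioi 0)))
    (hb : ∀ s, 0 < s → |f s| ≤ C * min 1 s) :
    IntegrableOn (fun s => f s * m s) (Ioi 0) := by
  refine (hint.const_mul C).mono' (hf.mul hm.aestronglyMeasurable) ?_
  refine (ae_restrict_mem measurableSet_Ioi).mono fun s hs => ?_
  have hs : 0 < s := hs
  rw [norm_mul, Real.norm_eq_abs, Real.norm_of_nonneg (hm.nonneg hs), ← mul_assoc]
  exact mul_le_mul_of_nonneg_right (hb s hs) (hm.nonneg hs)

theorem one_sub_exp_bounds {z s : ℝ} (hz : 0 < z) (hs : 0 < s) :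
    0 ≤ 1 - Real.exp (-(z * s)) ∧ 1 - Real.exp (-(z * s)) ≤ (z + 1) * min 1 s := by
  have h1 : Real.exp (-(z * s)) ≤ 1 := Real.exp_le_one_iff.2 (by nlinarith)
  have h2 := Real.add_one_le_exp (-(z * s))
  have h3 := Real.exp_pos (-(z * s))
  refine ⟨by linarith, ?_⟩
  rcases min_cases (1 : ℝ) s with h | h <;> rw [h.1] <;> nlinarith

theorem integrableOn_one_sub_exp_mul (hm : IsCompletelyMonotone m)
    (hint : IntegrableOn (fun s : ℝ => min 1 s * m s) (Ioi 0)) {z : ℝ} (hz : 0 < z) :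
    IntegrableOn (fun s => (1 - Real.exp (-(z * s))) * m s) (Ioi 0) :=
  hm.integrableOn_mul hint (C := z + 1) (by fun_prop) fun s hs => by
    rw [abs_of_nonneg (one_sub_exp_bounds hz hs).1]; exact (one_sub_exp_bounds hz hs).2

/-- The approximation `1 - (1 - s/A)^{Az}` of `1 - e^{-zs}`. -/
noncomputable def powKernel (A z s : ℝ) : ℝ := 1 - (1 - s / A) ^ (A * z)

/-- The majorant is the one valid for `1 - e^{-zs}` and does not depend on `A`, which permits
dominated convergence as `A → ∞`. -/
theorem powKernel_bounds {A z s : ℝ} (hA : 1 ≤ A) (hz : 0 < z) (hs : 0 < s) (hsA : s < A) :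
    0 ≤ powKernel A z s ∧ powKernel A z s ≤ (z + 1) * min 1 s := by
  have hA0 : 0 < A := by linarith
  have hq1 : s / A < 1 := (div_lt_one hA0).2 hsA
  have hq0 : 0 < s / A := by positivity
  have hp : 0 < A * z := by positivity
  have h1 : (1 - s / A) ^ (A * z) ≤ 1 := Real.rpow_le_one (by linarith) (by linarith) hp.le
  have h2 : 0 ≤ (1 - s / A) ^ (A * z) := Real.rpow_nonneg (by linarith) _
  -- For `A z ≥ 1` this is Bernoulli's inequality; for `A z ≤ 1` the power is at least its base `1 -
  -- s/A ≥ 1 - s`.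
  have h3 : 1 - (z + 1) * s ≤ (1 - s / A) ^ (A * z) := by
    rcases le_total 1 (A * z) with h | h
    · have := one_add_mul_self_le_rpow_one_add (s := -(s / A)) (by linarith) h
      rw [← sub_eq_add_neg] at this
      have e : A * z * -(s / A) = -(z * s) := by field_simp
      rw [e] at this
      linarith
    · have := Real.rpow_le_rpow_of_exponent_ge (x := 1 - s / A) (by linarith) (by linarith) h
      rw [Real.rpow_one] at this
      have h4 : s / A ≤ s := div_le_self hs.le hA
      nlinarith
  unfold powKernel
  refine ⟨by linarith, ?_⟩
  rcases min_cases (1 : ℝ) s with h | h <;> rw [h.1] <;> linarith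

theorem measurable_powKernel (A z : ℝ) : Measurable (powKernel A z) := by
  unfold powKernel; fun_prop

theorem integrableOn_powKernel_mul (hm : IsCompletelyMonotone m)
    (hint : IntegrableOn (fun s : ℝ => min 1 s * m s) (Ioi 0)) {A z : ℝ} (hA : 1 ≤ A) (hz : 0 < z) :
    IntegrableOn (fun s => powKernel A z s * m s) (Ioo 0 A) := by
  have hsub : Ioo 0 A ⊆ Ioi (0 : ℝ) := fun s hs => hs.1
  refine (IntegrableOn.mono_set (hint.const_mul (z + 1)) hsub).mono'
    ((measurable_powKernel A z).aestronglyMeasurable.mul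
      (hm.aestronglyMeasurable.mono_set hsub)) ?_
  refine (ae_restrict_mem measurableSet_Ioo).mono fun s hs => ?_
  have hb := powKernel_bounds hA hz hs.1 hs.2
  rw [norm_mul, Real.norm_of_nonneg hb.1, Real.norm_of_nonneg (hm.nonneg hs.1), ← mul_assoc]
  exact mul_le_mul_of_nonneg_right hb.2 (hm.nonneg hs.1)

/-- The reason for replacing the exponential: powers of `1 - s/A` integrate exactly. With `t = (k +
1)/A` the value is `1/t - 1/(t + z)`, and its difference quotient between `a` and `z` is `1/((t +
a)(t + z))`, a positive multiple of a Stieltjes kernel. -/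
theorem integral_powKernel_mul_pow {A z : ℝ} (hA : 0 < A) (hz : 0 < z) (k : ℕ) :
    IntegrableOn (fun s => powKernel A z s * (1 - s / A) ^ k) (Ioo 0 A) ∧
    ∫ s in Ioo 0 A, powKernel A z s * (1 - s / A) ^ k =
      z / ((k + 1) / A * ((k + 1) / A + z)) := by
  have hp : 0 < A * z := by positivity
  have hcont : ContinuousOn (fun s : ℝ => powKernel A z s * (1 - s / A) ^ k) (Icc 0 A) := by
    unfold powKernel
    refine ContinuousOn.mul (continuousOn_const.sub ?_) (by fun_prop)
    exact ContinuousOn.rpow_const (by fun_prop) fun s _ => Or.inr hp.le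
  refine ⟨(hcont.integrableOn_Icc).mono_set Ioo_subset_Icc_self, ?_⟩
  rw [← integral_Ioc_eq_integral_Ioo, ← intervalIntegral.integral_of_le hA.le]
  have hk : (0 : ℝ) < k + 1 := by positivity
  have hd : ∀ s ∈ Ioo 0 A, HasDerivAt (fun s => -A * ((1 - s / A) ^ (k + 1 : ℝ) / (k + 1)) +
      A * ((1 - s / A) ^ (k + 1 + A * z) / (k + 1 + A * z)))
      (powKernel A z s * (1 - s / A) ^ k) s := by
    intro s hs
    have hx : 0 < 1 - s / A := sub_pos.2 ((div_lt_one hA).2 hs.2)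
    have h0 : HasDerivAt (fun s : ℝ => 1 - s / A) (-(1 / A)) s :=
      ((hasDerivAt_id s).div_const A).const_sub 1
    have h1 := h0.rpow_const (p := k + 1) (Or.inl hx.ne')
    have h2 := h0.rpow_const (p := k + 1 + A * z) (Or.inl hx.ne')
    refine (((h1.div_const (k + 1)).const_mul (-A)).add
      ((h2.div_const (k + 1 + A * z)).const_mul A)).congr_deriv ?_
    have e1 : (k + 1 : ℝ) - 1 = k := by ring
    have e2 : (k + 1 + A * z : ℝ) - 1 = k + A * z := by ring
    rw [e1, e2, Real.rpow_add hx, Real.rpow_natCast, powKernel]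
    have : (k + 1 + A * z : ℝ) ≠ 0 := by positivity
    field_simp
    ring
  rw [intervalIntegral.integral_eq_sub_of_hasDerivAt_of_le hA.le ?_ hd]
  · have h3 : (k + 1 + A * z : ℝ) ≠ 0 := by positivity
    rw [div_self hA.ne', sub_self, Real.zero_rpow hk.ne', Real.zero_rpow h3]
    simp only [zero_div, sub_zero, Real.one_rpow, mul_zero, add_zero]
    field_simp
    ring
  · exact (hcont.mono (by rw [uIcc_of_le hA.le])).intervalIntegrable
  · refine ContinuousOn.add (continuousOn_const.mul (ContinuousOn.div_const ?_ _))
      (continuousOn_const.mul (ContinuousOn.div_const ?_ _))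
    · exact ContinuousOn.rpow_const (by fun_prop) fun s _ => Or.inr hk.le
    · exact ContinuousOn.rpow_const (by fun_prop) fun s _ => Or.inr (by positivity)

theorem tendsto_sum_taylorWeight (hm : IsCompletelyMonotone m)
    (hint : IntegrableOn (fun s : ℝ => min 1 s * m s) (Ioi 0)) {A z : ℝ} (hA : 1 ≤ A) (hz : 0 < z) :
    Tendsto (fun n => ∑ k ∈ Finset.range n, taylorWeight m A k *
      (z / ((k + 1) / A * ((k + 1) / A + z)))) atTop
      (𝓝 (∫ s in Ioo 0 A, powKernel A z s * m s)) := by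
  have hA0 : 0 < A := by linarith
  have e : ∀ n, ∑ k ∈ Finset.range n, taylorWeight m A k *
      (z / ((k + 1) / A * ((k + 1) / A + z))) = ∫ s in Ioo 0 A, powKernel A z s *
        ∑ k ∈ Finset.range n, taylorWeight m A k * (1 - s / A) ^ k := fun n => by
    have : ∀ s, powKernel A z s * ∑ k ∈ Finset.range n, taylorWeight m A k * (1 - s / A) ^ k =
        ∑ k ∈ Finset.range n, taylorWeight m A k * (powKernel A z s * (1 - s / A) ^ k) :=
      fun s => by rw [Finset.mul_sum]; exact Finset.sum_congr rfl fun k _ => by ring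
    simp_rw [this]
    rw [integral_finsetSum _ fun k _ => (integral_powKernel_mul_pow hA0 hz k).1.const_mul _]
    refine Finset.sum_congr rfl fun k _ => ?_
    rw [integral_const_mul, (integral_powKernel_mul_pow hA0 hz k).2]
  simp_rw [e]
  refine tendsto_integral_of_dominated_convergence (fun s => powKernel A z s * m s)
    (fun n => ?_) (integrableOn_powKernel_mul hm hint hA hz) (fun n => ?_) ?_
  · exact (measurable_powKernel A z).aestronglyMeasurable.mul (by fun_prop)
  · refine (ae_restrict_mem measurableSet_Ioo).mono fun s hs => ?_
    have hb := powKernel_bounds hA hz hs.1 hs.2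
    have hnn : 0 ≤ ∑ k ∈ Finset.range n, taylorWeight m A k * (1 - s / A) ^ k :=
      Finset.sum_nonneg fun k _ => mul_nonneg (hm.taylorWeight_nonneg hA0 k)
        (pow_nonneg (sub_nonneg.2 ((div_le_one hA0).2 hs.2.le)) _)
    rw [norm_mul, Real.norm_of_nonneg hb.1, Real.norm_of_nonneg hnn]
    exact mul_le_mul_of_nonneg_left ((hm.tendsto_taylor hs.1 hs.2).1 n) hb.1
  · refine (ae_restrict_mem measurableSet_Ioo).mono fun s hs => ?_
    exact (hm.tendsto_taylor hs.1 hs.2).2.const_mul _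

theorem tendsto_powKernel {z s : ℝ} :
    Tendsto (fun n : ℕ => powKernel (n + 1) z s) atTop (𝓝 (1 - Real.exp (-(z * s)))) := by
  have h1 : Tendsto (fun n : ℕ => (n : ℝ) + 1) atTop atTop :=
    tendsto_atTop_add_const_right _ _ tendsto_natCast_atTop_atTop
  have h2 := ((Real.tendsto_one_add_div_rpow_exp (-s)).comp h1).rpow_const (p := z)
    (Or.inl (Real.exp_pos _).ne')
  rw [← Real.exp_mul, show -s * z = -(z * s) by ring] at h2
  refine (h2.const_sub 1).congr' ?_
  filter_upwards [h1.eventually_gt_atTop s] with n hn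
  have hn0 : (0 : ℝ) < n + 1 := by positivity
  have : 0 ≤ 1 + -s / (n + 1 : ℝ) := by
    rw [neg_div, ← sub_eq_add_neg, sub_nonneg, div_le_one hn0]; exact hn.le
  simp only [Function.comp, powKernel]
  rw [← Real.rpow_mul this, neg_div, ← sub_eq_add_neg]

theorem tendsto_integral_powKernel (hm : IsCompletelyMonotone m)
    (hint : IntegrableOn (fun s : ℝ => min 1 s * m s) (Ioi 0)) {z : ℝ} (hz : 0 < z) :
    Tendsto (fun n : ℕ => ∫ s in Ioo 0 ((n : ℝ) + 1), powKernel (n + 1) z s * m s) atTop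
      (𝓝 (∫ s in Ioi (0 : ℝ), (1 - Real.exp (-(z * s))) * m s)) := by
  have e : ∀ n : ℕ, ∫ s in Ioo 0 ((n : ℝ) + 1), powKernel (n + 1) z s * m s =
      ∫ s in Ioi (0 : ℝ), (Iio ((n : ℝ) + 1)).indicator
        (fun s => powKernel (n + 1) z s * m s) s := fun n => by
    rw [setIntegral_indicator measurableSet_Iio, Ioi_inter_Iio]
  simp_rw [e]
  refine tendsto_integral_of_dominated_convergence (fun s => (z + 1) * (min 1 s * m s))
    (fun n => ?_) (hint.const_mul _) (fun n => ?_) ?_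
  · exact ((measurable_powKernel _ z).aestronglyMeasurable.mul hm.aestronglyMeasurable).indicator
      measurableSet_Iio
  · refine (ae_restrict_mem measurableSet_Ioi).mono fun s hs => ?_
    have hs : 0 < s := hs
    have hmin : 0 ≤ min 1 s := le_min zero_le_one hs.le
    by_cases h : s ∈ Iio ((n : ℝ) + 1)
    · rw [indicator_of_mem h]
      have hb := powKernel_bounds (A := n + 1) (by linarith [n.cast_nonneg (α := ℝ)]) hz hs h
      rw [norm_mul, Real.norm_of_nonneg hb.1, Real.norm_of_nonneg (hm.nonneg hs), ← mul_assoc]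
      exact mul_le_mul_of_nonneg_right hb.2 (hm.nonneg hs)
    · rw [indicator_of_notMem h, norm_zero]
      have := hm.nonneg hs
      positivity
  · refine (ae_restrict_mem measurableSet_Ioi).mono fun s hs => ?_
    refine (tendsto_powKernel.mul_const (m s)).congr' ?_
    have h1 : Tendsto (fun n : ℕ => (n : ℝ) + 1) atTop atTop :=
      tendsto_atTop_add_const_right _ _ tendsto_natCast_atTop_atTop
    filter_upwards [h1.eventually_gt_atTop s] with n hn
    rw [indicator_of_mem (show s ∈ Iio ((n : ℝ) + 1) from hn)]

/-- The reciprocal slope of a complete Bernstein function is factorable. -/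
theorem IsWHFactorable.of_levy {c : ℝ} (hc : 0 ≤ c) (hm : IsCompletelyMonotone m)
    (hint : IntegrableOn (fun s : ℝ => min 1 s * m s) (Ioi 0)) {a : ℝ} (ha : 0 < a)
    {ψ : ℝ → ℝ} {c₁ : ℝ} (hψ : ∀ z, 0 < z →
      ψ z = c₁ + c * z + ∫ s in Ioi (0 : ℝ), (1 - Real.exp (-(z * s))) * m s)
    (hmono : ∀ z w, 0 < w → w < z → ψ w < ψ z) :
    IsWHFactorable a fun z => (z - a) / (ψ z - ψ a) := by
  have hslope : ∀ z, 0 < z → z ≠ a → 0 < (ψ z - ψ a) / (z - a) := fun z hz hza => by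
    rcases lt_or_gt_of_ne hza with h | h
    · exact div_pos_of_neg_of_neg (sub_neg.2 (hmono a z hz h)) (sub_neg.2 h)
    · exact div_pos (sub_pos.2 (hmono z a ha h)) (sub_pos.2 h)
  set Φ : ℕ → ℝ → ℝ := fun N z => ∫ s in Ioo 0 ((N : ℝ) + 1), powKernel (N + 1) z s * m s with hΦ
  -- the perturbation that keeps all weights positive
  set p : ℕ → ℝ → ℝ := fun N z =>
    ∑' k : ℕ, (1 / ((N : ℝ) + 1)) * ((1 / 2) ^ k / (z + ((k : ℝ) + 1) / (N + 1))) with hp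
  have hpterm : ∀ (N : ℕ) z, 0 < z → ∀ k : ℕ,
      0 ≤ (1 / ((N : ℝ) + 1)) * ((1 / 2) ^ k / (z + ((k : ℝ) + 1) / (N + 1))) ∧
      (1 / ((N : ℝ) + 1)) * ((1 / 2) ^ k / (z + ((k : ℝ) + 1) / (N + 1))) ≤
      (1 / ((N : ℝ) + 1)) * ((1 / 2) ^ k * (1 / z)) := fun N z hz k => by
    refine ⟨by positivity, mul_le_mul_of_nonneg_left ?_ (by positivity)⟩
    rw [mul_one_div]
    exact div_le_div_of_nonneg_left (by positivity) hz
      (le_add_of_nonneg_right (by positivity))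
  have hsumb : ∀ (N : ℕ) (z : ℝ), HasSum
      (fun k : ℕ => (1 / ((N : ℝ) + 1)) * ((1 / 2) ^ k * (1 / z)))
      ((1 / ((N : ℝ) + 1)) * (2 * (1 / z))) := fun N z =>
    (hasSum_geometric_two.mul_right _).mul_left _
  have hpsum : ∀ (N : ℕ) z, 0 < z → Summable fun k : ℕ =>
      (1 / ((N : ℝ) + 1)) * ((1 / 2) ^ k / (z + ((k : ℝ) + 1) / (N + 1))) := fun N z hz =>
    Summable.of_nonneg_of_le (fun k => (hpterm N z hz k).1) (fun k => (hpterm N z hz k).2)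
      (hsumb N z).summable
  have hppos : ∀ N z, 0 < z → 0 < p N z := fun N z hz =>
    (hpsum N z hz).tsum_pos (fun k => (hpterm N z hz k).1) 0 (by positivity)
  have hple : ∀ N z, 0 < z → p N z ≤ (1 / ((N : ℝ) + 1)) * (2 * (1 / z)) := fun N z hz => by
    rw [← (hsumb N z).tsum_eq]
    exact (hpsum N z hz).tsum_le_tsum (fun k => (hpterm N z hz k).2) (hsumb N z).summable
  have hp0 : ∀ z, 0 < z → Tendsto (fun N => p N z) atTop (𝓝 0) := fun z hz => by
    refine squeeze_zero (fun N => (hppos N z hz).le) (fun N => hple N z hz) ?_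
    simpa using (tendsto_one_div_add_atTop_nhds_zero_nat (𝕜 := ℝ)).mul_const (2 * (1 / z))
  have hΦnn : ∀ N z, 0 < z → z ≠ a → 0 ≤ (Φ N z - Φ N a) / (z - a) := fun N z hz hza => by
    have hA : (1 : ℝ) ≤ N + 1 := by linarith [N.cast_nonneg (α := ℝ)]
    have hmonoΦ : ∀ w z, 0 < w → w ≤ z → Φ N w ≤ Φ N z := fun w z hw hwz => by
      refine setIntegral_mono_on (integrableOn_powKernel_mul hm hint hA hw)
        (integrableOn_powKernel_mul hm hint hA (hw.trans_le hwz)) measurableSet_Ioo fun s hs => ?_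
      refine mul_le_mul_of_nonneg_right ?_ (hm.nonneg hs.1)
      have hq : s / ((N : ℝ) + 1) < 1 := (div_lt_one (by linarith)).2 hs.2
      have hq' : 0 ≤ s / ((N : ℝ) + 1) := div_nonneg hs.1.le (by linarith)
      unfold powKernel
      have := Real.rpow_le_rpow_of_exponent_ge (x := 1 - s / ((N : ℝ) + 1)) (by linarith)
        (by linarith) (show ((N : ℝ) + 1) * w ≤ ((N : ℝ) + 1) * z by gcongr)
      linarith
    rcases lt_or_gt_of_ne hza with h | h
    · exact div_nonneg_of_nonpos (sub_nonpos.2 (hmonoΦ z a hz h.le)) (sub_neg.2 h).le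
    · exact div_nonneg (sub_nonneg.2 (hmonoΦ a z ha h.le)) (sub_pos.2 h).le
  -- Two successive limits are taken: here `A = N + 1` is fixed and the number `n` of Taylor terms
  -- grows; afterwards `N → ∞`, which also removes `p N`.
  have step : ∀ N, IsWHFactorable a fun z => (c + (Φ N z - Φ N a) / (z - a) + p N z)⁻¹ := by
    intro N
    have hA : (1 : ℝ) ≤ N + 1 := by linarith [N.cast_nonneg (α := ℝ)]
    have hA0 : (0 : ℝ) < N + 1 := by linarith
    set t : ℕ → ℝ := fun k => ((k : ℝ) + 1) / (N + 1) with ht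
    have htpos : ∀ k, 0 < t k := fun k => by simp only [ht]; positivity
    -- The last index `k = n` of the sum carries the drift: a pole at `t n → ∞` with weight `c * t
    -- n` contributes `c t_n/(z + t_n) → c`. The constant `c₁` cancels in the difference quotient.
    set q : ℕ → ℕ → ℝ := fun n k => (if k < n then taylorWeight m (N + 1) k / (t k + a)
      else c * t n) + (1 / ((N : ℝ) + 1)) * (1 / 2) ^ k with hq
    have hqpos : ∀ n k, 0 < q n k := fun n k => by
      simp only [hq]
      refine add_pos_of_nonneg_of_pos ?_ (by positivity)
      split_ifs
      · exact div_nonneg (hm.taylorWeight_nonneg hA0 k) (by linarith [htpos k])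
      · exact mul_nonneg hc (htpos n).le
    refine IsWHFactorable.of_tendsto ha (fun n => IsWHFactorable.rational a t (q n) n (htpos 0)
      (strictMono_nat_of_lt_succ fun k => ?_) (hqpos n)) (fun z hz hza => ?_) fun z hz hza => ?_
    · simp only [ht]; push_cast; gcongr; linarith
    · refine Tendsto.inv₀ ?_ ?_
      · have hexp : ∀ n, ∑ i ∈ Finset.range (n + 1), q n i / (z + t i) =
            c * (t n / (z + t n)) +
            ((∑ k ∈ Finset.range n, taylorWeight m (N + 1) k * (z / (t k * (t k + z)))) -
              ∑ k ∈ Finset.range n, taylorWeight m (N + 1) k * (a / (t k * (t k + a)))) / (z - a) +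
            ∑ k ∈ Finset.range (n + 1), (1 / ((N : ℝ) + 1)) * ((1 / 2) ^ k / (z + t k)) := by
          intro n
          have h1 : ∀ i ∈ Finset.range (n + 1), q n i / (z + t i) =
              (if i < n then taylorWeight m (N + 1) i / (t i + a) else c * t n) / (z + t i) +
              (1 / ((N : ℝ) + 1)) * ((1 / 2) ^ i / (z + t i)) := fun i _ => by
            simp only [hq]; ring
          rw [Finset.sum_congr rfl h1, Finset.sum_add_distrib]
          congr 1
          rw [Finset.sum_range_succ, if_neg (lt_irrefl n), add_comm, ← Finset.sum_sub_distrib,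
            Finset.sum_div, mul_div_assoc]
          congr 1
          refine Finset.sum_congr rfl fun k hk => ?_
          rw [if_pos (Finset.mem_range.1 hk)]
          have := htpos k
          have h2 : z - a ≠ 0 := sub_ne_zero.2 hza
          have h3 : t k + a ≠ 0 := by positivity
          have h4 : z + t k ≠ 0 := by positivity
          have h5 : t k + z ≠ 0 := by positivity
          field_simp
          ring
        simp_rw [hexp]
        have htt : Tendsto t atTop atTop := by
          simp only [ht]
          exact (tendsto_atTop_add_const_right _ _ tendsto_natCast_atTop_atTop).atTop_div_const hA0
        have hl1 : Tendsto (fun n => c * (t n / (z + t n))) atTop (𝓝 c) := by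
          have : Tendsto (fun n => 1 - z * (z + t n)⁻¹) atTop (𝓝 (1 - z * 0)) :=
            ((tendsto_inv_atTop_zero.comp (tendsto_atTop_add_const_left _ z htt)).const_mul
              z).const_sub 1
          have := this.const_mul c
          rw [mul_zero, sub_zero, mul_one] at this
          refine this.congr fun n => ?_
          have : z + t n ≠ 0 := by have := htpos n; positivity
          field_simp
          ring
        have hl2 := tendsto_sum_taylorWeight hm hint hA hz
        have hl3 := tendsto_sum_taylorWeight hm hint hA ha
        have hl4 := (tendsto_add_atTop_iff_nat 1).2 (hpsum N z hz).hasSum.tendsto_sum_nat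
        exact (hl1.add ((hl2.sub hl3).div_const _)).add hl4
      · have := hΦnn N z hz hza
        have := hppos N z hz
        positivity
    · have := hΦnn N z hz hza
      have := hppos N z hz
      positivity
  refine IsWHFactorable.of_tendsto ha step (fun z hz hza => ?_) fun z hz hza => ?_
  · have h1 : Tendsto (fun N => c + (Φ N z - Φ N a) / (z - a) + p N z) atTop
        (𝓝 ((ψ z - ψ a) / (z - a))) := by
      have e : (ψ z - ψ a) / (z - a) = c + ((∫ s in Ioi (0 : ℝ), (1 - Real.exp (-(z * s))) * m s) -
          ∫ s in Ioi (0 : ℝ), (1 - Real.exp (-(a * s))) * m s) / (z - a) + 0 := by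
        have h2 : z - a ≠ 0 := sub_ne_zero.2 hza
        rw [hψ z hz, hψ a ha]
        field_simp
        ring
      rw [e]
      exact (((tendsto_integral_powKernel hm hint hz).sub
        (tendsto_integral_powKernel hm hint ha)).div_const _).const_add c |>.add (hp0 z hz)
    have := h1.inv₀ (hslope z hz hza).ne'
    rwa [inv_div] at this
  · have := inv_pos.2 (hslope z hz hza)
    rwa [inv_div] at this

/-! ### Strict positivity of slopes, and regular variation of the reciprocal slope -/

/-- If the sum vanished, then `c = 0` and `m = 0` almost everywhere, so `ψ` would be constant. With
suitable `f` the sum is a difference quotient of `ψ` or the derivative of `ψ`. -/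
theorem integral_mul_pos_of_unbounded {ψ m : ℝ → ℝ} {c₁ c : ℝ} (hc : 0 ≤ c)
    (hm : IsCompletelyMonotone m)
    (hψ : ∀ z, 0 < z → ψ z = c₁ + c * z + ∫ s in Ioi (0 : ℝ), (1 - Real.exp (-(z * s))) * m s)
    (hunb : ¬ BddAbove (ψ '' Ioi 0)) {f : ℝ → ℝ} (hf : ∀ s, 0 < s → 0 < f s)
    (hfi : IntegrableOn (fun s => f s * m s) (Ioi 0)) :
    0 < c + ∫ s in Ioi (0 : ℝ), f s * m s := by
  have hnn : 0 ≤ᵐ[volume.restrict (Ioi 0)] fun s => f s * m s :=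
    (ae_restrict_mem measurableSet_Ioi).mono fun s hs => mul_nonneg (hf s hs).le (hm.nonneg hs)
  have hI := integral_nonneg_of_ae hnn
  by_contra hcon
  have hc0 : c = 0 := by linarith
  have hI0 : ∫ s in Ioi (0 : ℝ), f s * m s = 0 := by linarith
  have hm0 : ∀ᵐ s ∂volume.restrict (Ioi (0 : ℝ)), m s = 0 := by
    filter_upwards [(integral_eq_zero_iff_of_nonneg_ae hnn hfi).1 hI0,
      ae_restrict_mem measurableSet_Ioi] with s h1 h2
    exact (mul_eq_zero.1 h1).resolve_left (hf s h2).ne'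
  refine hunb ⟨c₁, ?_⟩
  rintro _ ⟨z, hz, rfl⟩
  rw [hψ z hz, hc0, integral_congr_ae (g := fun _ => (0 : ℝ))
    (hm0.mono fun s hs => by simp [hs])]
  simp

theorem IsCompleteBernstein.strictMonoOn {ψ : ℝ → ℝ} (h : IsCompleteBernstein ψ)
    (hunb : ¬ BddAbove (ψ '' Ioi 0)) {z w : ℝ} (hw : 0 < w) (hwz : w < z) : ψ w < ψ z := by
  obtain ⟨c₁, c, m, -, hc, hm, hint, hψ⟩ := h
  have hz := hw.trans hwz
  have hi := (integrableOn_one_sub_exp_mul hm hint hz).sub (integrableOn_one_sub_exp_mul hm hint hw)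
  have hi' : IntegrableOn (fun s =>
      ((Real.exp (-(w * s)) - Real.exp (-(z * s))) / (z - w)) * m s) (Ioi 0) := by
    refine (hi.div_const (z - w)).congr (Eventually.of_forall fun s => ?_)
    simp only [Pi.sub_apply]; ring
  have hzw : 0 < z - w := sub_pos.2 hwz
  have hpos := integral_mul_pos_of_unbounded hc hm hψ hunb (fun s hs => div_pos (sub_pos.2
    (Real.exp_lt_exp.2 (by nlinarith))) hzw) hi'
  have e : ∫ s in Ioi (0 : ℝ), ((Real.exp (-(w * s)) - Real.exp (-(z * s))) / (z - w)) * m s =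
      ((∫ s in Ioi (0 : ℝ), (1 - Real.exp (-(z * s))) * m s) -
        ∫ s in Ioi (0 : ℝ), (1 - Real.exp (-(w * s))) * m s) / (z - w) := by
    rw [← integral_sub (integrableOn_one_sub_exp_mul hm hint hz)
      (integrableOn_one_sub_exp_mul hm hint hw), ← integral_div]
    exact integral_congr_ae (Eventually.of_forall fun s => by ring)
  rw [e] at hpos
  have := mul_pos hpos hzw
  rw [add_mul, div_mul_cancel₀ _ hzw.ne'] at this
  rw [hψ z hz, hψ w hw]
  linarith

theorem IsCompleteBernstein.deriv_pos {ψ : ℝ → ℝ} (h : IsCompleteBernstein ψ)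
    (hunb : ¬ BddAbove (ψ '' Ioi 0)) {a : ℝ} (ha : 0 < a) : 0 < deriv ψ a := by
  obtain ⟨c₁, c, m, -, hc, hm, hint, hψ⟩ := h
  -- Majorant for differentiation under the integral on `z > a/2`.
  have hb : ∀ s : ℝ, 0 < s → s * Real.exp (-(a / 2 * s)) ≤ (1 + 2 / a) * min 1 s := fun s hs => by
    have h1 : s * Real.exp (-(a / 2 * s)) ≤ s :=
      mul_le_of_le_one_right hs.le (Real.exp_le_one_iff.2 (by have := mul_pos ha hs; linarith))
    have h2 : s * Real.exp (-(a / 2 * s)) ≤ 2 / a := by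
      rw [Real.exp_neg, ← div_eq_mul_inv, div_le_div_iff₀ (Real.exp_pos _) ha]
      have := Real.add_one_le_exp (a / 2 * s)
      linarith
    have h3 : 0 < 2 / a := by positivity
    rcases min_cases (1 : ℝ) s with h | h <;> rw [h.1] <;> nlinarith
  have hbi : IntegrableOn (fun s => s * Real.exp (-(a / 2 * s)) * m s) (Ioi 0) :=
    hm.integrableOn_mul hint (by fun_prop) fun s hs => by
      rw [abs_of_nonneg (by positivity)]; exact hb s hs
  have hd := hasDerivAt_integral_of_dominated_loc_of_deriv_le
    (μ := volume.restrict (Ioi (0 : ℝ))) (F := fun z s => (1 - Real.exp (-(z * s))) * m s)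
    (F' := fun z s => s * Real.exp (-(z * s)) * m s) (x₀ := a)
    (bound := fun s => s * Real.exp (-(a / 2 * s)) * m s) (Ioi_mem_nhds (show a / 2 < a by linarith))
    ((eventually_gt_nhds ha).mono fun z hz => (integrableOn_one_sub_exp_mul hm hint hz).1)
    (integrableOn_one_sub_exp_mul hm hint ha)
    ((Continuous.aestronglyMeasurable (by fun_prop)).mul hm.aestronglyMeasurable) ?_ hbi ?_
  rotate_left
  · refine (ae_restrict_mem measurableSet_Ioi).mono fun s hs z hz => ?_
    have hs : 0 < s := hs
    have hz : a / 2 < z := hz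
    rw [norm_mul, norm_mul, Real.norm_of_nonneg (hm.nonneg hs), Real.norm_of_nonneg hs.le,
      Real.norm_of_nonneg (Real.exp_pos _).le]
    refine mul_le_mul_of_nonneg_right (mul_le_mul_of_nonneg_left ?_ hs.le) (hm.nonneg hs)
    exact Real.exp_le_exp.2 (by nlinarith)
  · refine Eventually.of_forall fun s z _ => ?_
    have h1 : HasDerivAt (fun z : ℝ => -(z * s)) (-s) z := by
      exact (hasDerivAt_mul_const s).fun_neg
    refine ((h1.exp.const_sub 1).mul_const (m s)).congr_deriv ?_
    ring
  have hlin : HasDerivAt (fun z : ℝ => c₁ + c * z) c a := by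
    simpa using ((hasDerivAt_id a).const_mul c).const_add c₁
  have hψd : HasDerivAt ψ (c + ∫ s in Ioi (0 : ℝ), s * Real.exp (-(a * s)) * m s) a :=
    (hlin.add hd.2).congr_of_eventuallyEq ((eventually_gt_nhds ha).mono fun z hz => hψ z hz)
  rw [hψd.deriv]
  exact integral_mul_pos_of_unbounded hc hm hψ hunb (fun s hs => by positivity) hd.1

/-- The reciprocal slope `(z - a) / (ψ z - ψ a)`. -/
noncomputable def recipSlope (ψ : ℝ → ℝ) (a z : ℝ) : ℝ := (z - a) / (ψ z - ψ a)

theorem IsCompleteBernstein.isWHFactorable {ψ : ℝ → ℝ} (h : IsCompleteBernstein ψ)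
    (hunb : ¬ BddAbove (ψ '' Ioi 0)) {a : ℝ} (ha : 0 < a) :
    IsWHFactorable a (recipSlope ψ a) := by
  have hmono : ∀ z w, 0 < w → w < z → ψ w < ψ z := fun z w hw hwz => h.strictMonoOn hunb hw hwz
  obtain ⟨c₁, c, m, -, hc, hm, hint, hψ⟩ := h
  exact IsWHFactorable.of_levy hc hm hint ha hψ hmono

theorem IsCompleteBernstein.tendsto_atTop {ψ : ℝ → ℝ} (h : IsCompleteBernstein ψ)
    (hunb : ¬ BddAbove (ψ '' Ioi 0)) : Tendsto ψ atTop atTop := by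
  refine Filter.tendsto_atTop.2 fun b => ?_
  have : ∃ z, 0 < z ∧ b < ψ z := by
    by_contra hcon
    push Not at hcon
    exact hunb ⟨b, by rintro _ ⟨z, hz, rfl⟩; exact hcon z hz⟩
  obtain ⟨z, hz, hbz⟩ := this
  filter_upwards [eventually_gt_atTop z] with x hx
  exact (hbz.trans (h.strictMonoOn hunb hz hx)).le

/-- As `ψ → ∞`, the constants `a` and `ψ a` are negligible, leaving `k / k^α`. -/
theorem tendsto_recipSlope_ratio {ψ : ℝ → ℝ} {α a : ℝ} (htop : Tendsto ψ atTop atTop)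
    (hreg : IsRegularlyVaryingAtTop ψ α) {k : ℝ} (hk : 0 < k) :
    Tendsto (fun z => recipSlope ψ a (k * z) / recipSlope ψ a z) atTop (𝓝 (k ^ (1 - α))) := by
  have hkt : Tendsto (fun z : ℝ => k * z) atTop atTop := tendsto_id.const_mul_atTop hk
  have h1 : Tendsto (fun z : ℝ => a / z) atTop (𝓝 0) := tendsto_const_nhds.div_atTop tendsto_id
  have h2 : Tendsto (fun z => ψ a / ψ z) atTop (𝓝 0) := tendsto_const_nhds.div_atTop htop
  have h3 : Tendsto (fun z => ((k - a / z) / (1 - a / z)) *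
      ((1 - ψ a / ψ z) / (ψ (k * z) / ψ z - ψ a / ψ z))) atTop
      (𝓝 (((k - 0) / (1 - 0)) * ((1 - 0) / (k ^ α - 0)))) :=
    ((h1.const_sub k).div (h1.const_sub 1) (by norm_num)).mul
      ((h2.const_sub 1).div ((hreg k hk).sub h2) (by simpa using (Real.rpow_pos_of_pos hk α).ne'))
  have e : ((k - 0) / (1 - 0)) * ((1 - 0) / (k ^ α - 0)) = k ^ (1 - α) := by
    rw [Real.rpow_sub hk, Real.rpow_one]; simp; rfl
  rw [e] at h3
  refine h3.congr' ?_
  filter_upwards [eventually_gt_atTop 0, eventually_gt_atTop a,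
    htop.eventually_gt_atTop 0, htop.eventually_gt_atTop (ψ a),
    hkt.eventually (htop.eventually_gt_atTop (ψ a)), hkt.eventually_gt_atTop a]
    with z hz hza hψz hψa hψk hka
  have e1 : z - a ≠ 0 := by linarith
  have e2 : ψ z - ψ a ≠ 0 := by linarith
  have e3 : ψ (k * z) - ψ a ≠ 0 := by linarith
  have r1 : k - a / z = (k * z - a) / z := by field_simp
  have r2 : 1 - a / z = (z - a) / z := by field_simp
  have r3 : 1 - ψ a / ψ z = (ψ z - ψ a) / ψ z := by field_simp
  rw [r1, r2, r3, ← sub_div, recipSlope, recipSlope]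
  field_simp

/-! ### Asymptotics of the Wiener–Hopf factor and of the transform on the real axis -/

theorem IsWHFactorable.log_bound {a : ℝ} (ha : 0 < a) {h : ℝ → ℝ} (hh : IsWHFactorable a h) :
    ∃ A, ∀ᵐ ζ ∂volume.restrict (Ioi (0 : ℝ)), |Real.log (h (ζ ^ 2))| ≤ A + 2 * |Real.log ζ| :=
  ⟨_, ae_sq_ne.mono fun ζ hζ => abs_le_of_log_lipschitz (G := fun z => Real.log (h z))
    (hh.lip (ζ ^ 2) (a + 1) (pow_pos hζ.1 2) hζ.2 (by linarith) (by simp))⟩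

theorem IsWHFactorable.integrableOn {a : ℝ} (ha : 0 < a) {h : ℝ → ℝ} (hh : IsWHFactorable a h)
    {ξ : ℝ} (hξ : 0 < ξ) :
    IntegrableOn (fun ζ => ξ / (ξ ^ 2 + ζ ^ 2) * Real.log (h (ζ ^ 2))) (Ioi 0) := by
  obtain ⟨A, hA⟩ := hh.log_bound ha
  exact integrableOn_poisson_mul hξ hh.meas hA

/-- The Wiener–Hopf factor of a function `h` with `h(kz)/h(z) → k^β` is asymptotic to
`√(h (ξ²))`. -/
theorem IsWHFactorable.tendsto_wienerHopf_div {a : ℝ} (ha : 0 < a) {h : ℝ → ℝ}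
    (hh : IsWHFactorable a h) {β : ℝ}
    (hreg : ∀ k, 0 < k → Tendsto (fun z => h (k * z) / h z) atTop (𝓝 (k ^ β))) :
    Tendsto (fun ξ => wienerHopf h ξ / √(h (ξ ^ 2))) atTop (𝓝 1) := by
  have hlarge : ∀ᶠ ξ : ℝ in atTop, 0 < ξ ∧ ξ ^ 2 ≠ a := by
    filter_upwards [eventually_gt_atTop 0, eventually_gt_atTop (√a)] with ξ h1 h2
    exact ⟨h1, ((Real.sqrt_lt' h1).1 h2).ne'⟩
  have hint : ∀ ξ, 0 < ξ → IntegrableOn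
      (fun t => (1 + t ^ 2)⁻¹ * Real.log (h ((ξ * t) ^ 2))) (Ioi 0) := fun ξ hξ => by
    have h1 := (integrableOn_Ioi_comp_mul_left_iff
      (fun ζ => ξ / (ξ ^ 2 + ζ ^ 2) * Real.log (h (ζ ^ 2))) 0 hξ).2
        (by rw [mul_zero]; exact hh.integrableOn ha hξ)
    refine (h1.const_mul ξ).congr (Eventually.of_forall fun t => ?_)
    have : 1 + t ^ 2 ≠ 0 := by positivity
    have : ξ ^ 2 + (ξ * t) ^ 2 ≠ 0 := by positivity
    simp only
    field_simp
  -- The substitution `ζ = ξt` and subtraction of the mean value `log h(ξ²)` leave an integrand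
  -- dominated by `2 |log t| / (1 + t²)`: the Lipschitz condition does the work of Potter's bounds.
  -- The pointwise limit is a multiple of `log t / (1 + t²)`, whose integral is zero.
  have key : Tendsto (fun ξ => ∫ t in Ioi (0 : ℝ), (1 + t ^ 2)⁻¹ *
      (Real.log (h ((ξ * t) ^ 2)) - Real.log (h (ξ ^ 2)))) atTop
      (𝓝 (∫ t in Ioi (0 : ℝ), (2 * β) * ((1 + t ^ 2)⁻¹ * Real.log t))) := by
    refine tendsto_integral_filter_of_dominated_convergence
      (fun t => 2 * ((1 + t ^ 2)⁻¹ * |Real.log t|)) ?_ ?_ (integrableOn_abs_log_div.const_mul 2) ?_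
    · filter_upwards [eventually_gt_atTop 0] with ξ hξ
      refine (((hint ξ hξ).sub (integrableOn_inv_one_add_sq.mul_const (Real.log (h (ξ ^ 2))))).congr
        (Eventually.of_forall fun t => ?_)).1
      simp only [Pi.sub_apply]; ring
    · filter_upwards [hlarge] with ξ hξ
      filter_upwards [ae_restrict_mem measurableSet_Ioi,
        ae_restrict_of_ae (volume.ae_ne (√a / ξ))] with t ht hta
      have ht : 0 < t := ht
      have hne : (ξ * t) ^ 2 ≠ a := fun hc => hta (by
        rw [← hc, Real.sqrt_sq (mul_pos hξ.1 ht).le]; field_simp [hξ.1.ne'])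
      have hb := hh.lip ((ξ * t) ^ 2) (ξ ^ 2) (pow_pos (mul_pos hξ.1 ht) 2) hne
        (pow_pos hξ.1 2) hξ.2
      have e : Real.log ((ξ * t) ^ 2) - Real.log (ξ ^ 2) = 2 * Real.log t := by
        rw [Real.log_pow, Real.log_pow, Real.log_mul hξ.1.ne' ht.ne']; push_cast; ring
      rw [e, abs_mul, abs_two] at hb
      rw [norm_mul, Real.norm_of_nonneg (by positivity), Real.norm_eq_abs, mul_left_comm]
      exact mul_le_mul_of_nonneg_left hb (by positivity)
    · refine (ae_restrict_mem measurableSet_Ioi).mono fun t ht => ?_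
      have ht : 0 < t := ht
      have hsq : Tendsto (fun ξ : ℝ => ξ ^ 2) atTop atTop := tendsto_pow_atTop two_ne_zero
      have h1 := ((hreg (t ^ 2) (by positivity)).comp hsq).log
        (Real.rpow_pos_of_pos (by positivity) β).ne'
      have e : Real.log ((t ^ 2) ^ β) = 2 * β * Real.log t := by
        rw [Real.log_rpow (by positivity), Real.log_pow]; push_cast; ring
      rw [e] at h1
      have h2 := h1.const_mul ((1 + t ^ 2)⁻¹)
      rw [mul_left_comm] at h2
      refine h2.congr' ?_
      have hlt : Tendsto (fun ξ : ℝ => ξ * t) atTop atTop := tendsto_id.atTop_mul_const ht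
      filter_upwards [hlarge, hlt.eventually hlarge] with ξ h3 h4
      simp only [Function.comp]
      rw [← mul_pow, mul_comm t ξ, Real.log_div (hh.pos _ (pow_pos h4.1 2) h4.2).ne'
        (hh.pos _ (pow_pos h3.1 2) h3.2).ne']
  rw [integral_const_mul, integral_inv_one_add_sq_mul_log, mul_zero] at key
  have key2 := (Real.continuous_exp.tendsto _).comp (key.const_mul Real.pi⁻¹)
  rw [mul_zero, Real.exp_zero] at key2
  refine key2.congr' ?_
  filter_upwards [hlarge] with ξ hξ
  have hp := hh.pos _ (pow_pos hξ.1 2) hξ.2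
  have hs : √(h (ξ ^ 2)) = Real.exp (Real.log (h (ξ ^ 2)) / 2) := by
    rw [Real.exp_half, Real.exp_log hp]
  simp only [Function.comp]
  rw [wienerHopf, hs, ← Real.exp_sub,
    integral_poisson_comp hξ.1 (fun ζ => Real.log (h (ζ ^ 2)))]
  congr 1
  simp_rw [mul_sub]
  rw [integral_sub (hint ξ hξ.1) (integrableOn_inv_one_add_sq.mul_const _), integral_mul_const,
    integral_Ioi_inv_one_add_sq]
  have := Real.pi_pos.ne'
  generalize ∫ t in Ioi (0 : ℝ), (1 + t ^ 2)⁻¹ * Real.log (h ((ξ * t) ^ 2)) = I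
  simp only [Real.arctan_zero, sub_zero]
  field_simp

/-- The constant `ψ'(l²)` splits off from the logarithm and contributes `√ψ'(l²)` since the Poisson
kernel has mass `π/2`; the point `ζ = l` is null. -/
theorem eigenLaplace_ofReal {ψ : ℝ → ℝ} (h : IsCompleteBernstein ψ)
    (hunb : ¬ BddAbove (ψ '' Ioi 0)) {l : ℝ} (hl : 0 < l) {ξ : ℝ} (hξ : 0 < ξ) :
    eigenLaplace ψ l (ξ : ℂ) = ((l / (l ^ 2 + ξ ^ 2) *
      (√(deriv ψ (l ^ 2)) * wienerHopf (recipSlope ψ (l ^ 2)) ξ) : ℝ) : ℂ) := by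
  have ha : 0 < l ^ 2 := by positivity
  have hfac := h.isWHFactorable hunb ha
  have hd := h.deriv_pos hunb ha
  have hI : ∫ ζ in Ioi (0 : ℝ), (ξ : ℂ) / ((ξ : ℂ) ^ 2 + (ζ : ℂ) ^ 2) *
        ((Real.log (deriv ψ (l ^ 2) * (l ^ 2 - ζ ^ 2) / (ψ (l ^ 2) - ψ (ζ ^ 2))) : ℝ) : ℂ) =
      ((Real.pi / 2 * Real.log (deriv ψ (l ^ 2)) + ∫ ζ in Ioi (0 : ℝ),
        ξ / (ξ ^ 2 + ζ ^ 2) * Real.log (recipSlope ψ (l ^ 2) (ζ ^ 2)) : ℝ) : ℂ) := by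
    rw [← integral_poisson hξ, ← integral_mul_const, ← integral_add
      ((integrableOn_poisson hξ).mul_const _) (hfac.integrableOn ha hξ), ← integral_complex_ofReal]
    refine integral_congr_ae ((ae_sq_ne (a := l ^ 2)).mono fun ζ hζ => ?_)
    have hp := hfac.pos (ζ ^ 2) (pow_pos hζ.1 2) hζ.2
    have e : deriv ψ (l ^ 2) * (l ^ 2 - ζ ^ 2) / (ψ (l ^ 2) - ψ (ζ ^ 2)) =
        deriv ψ (l ^ 2) * recipSlope ψ (l ^ 2) (ζ ^ 2) := by
      rw [recipSlope, mul_div_assoc, ← neg_div_neg_eq, neg_sub, neg_sub]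
    simp only
    rw [e, Real.log_mul hd.ne' hp.ne']
    push_cast
    ring
  rw [eigenLaplace, hI]
  have hs : √(deriv ψ (l ^ 2)) = Real.exp (Real.log (deriv ψ (l ^ 2)) / 2) := by
    rw [Real.exp_half, Real.exp_log hd]
  rw [wienerHopf, hs, ← Real.exp_add]
  push_cast
  congr 2
  have : (Real.pi : ℂ) ≠ 0 := by exact_mod_cast Real.pi_pos.ne'
  field_simp

/-- The factor is asymptotic to `√((ξ² - l²)/(ψ(ξ²) - ψ(l²)))`, where `l²` and `ψ(l²)` are
negligible against `ξ²` and `ψ(ξ²)`. -/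
theorem isEquivalent_wienerHopf {ψ : ℝ → ℝ} (h : IsCompleteBernstein ψ)
    (hunb : ¬ BddAbove (ψ '' Ioi 0)) {α : ℝ} (hreg : IsRegularlyVaryingAtTop ψ α)
    {l : ℝ} (hl : 0 < l) :
    Tendsto (fun ξ : ℝ => (l / (l ^ 2 + ξ ^ 2) *
      (√(deriv ψ (l ^ 2)) * wienerHopf (recipSlope ψ (l ^ 2)) ξ)) /
        √(l ^ 2 * deriv ψ (l ^ 2) / (ξ ^ 2 * ψ (ξ ^ 2)))) atTop (𝓝 1) := by
  have ha : 0 < l ^ 2 := by positivity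
  have hfac := h.isWHFactorable hunb ha
  have hd := h.deriv_pos hunb ha
  have htop := h.tendsto_atTop hunb
  have hsq : Tendsto (fun ξ : ℝ => ξ ^ 2) atTop atTop := tendsto_pow_atTop two_ne_zero
  have h1 := hfac.tendsto_wienerHopf_div ha (β := 1 - α)
    fun k hk => tendsto_recipSlope_ratio htop hreg hk
  have h2 : Tendsto (fun z : ℝ => l ^ 2 / z) atTop (𝓝 0) := tendsto_const_nhds.div_atTop tendsto_id
  have h3 : Tendsto (fun z => ψ (l ^ 2) / ψ z) atTop (𝓝 0) := tendsto_const_nhds.div_atTop htop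
  have h4 : Tendsto (fun z => (1 + l ^ 2 / z)⁻¹ * √((1 - l ^ 2 / z) / (1 - ψ (l ^ 2) / ψ z)))
      atTop (𝓝 ((1 + 0)⁻¹ * √((1 - 0) / (1 - 0)))) :=
    ((h2.const_add 1).inv₀ (by norm_num)).mul
      (((h2.const_sub 1).div (h3.const_sub 1) (by norm_num)).sqrt)
  have h5 := h1.mul (h4.comp hsq)
  simp only [add_zero, inv_one, sub_zero, div_one, Real.sqrt_one, mul_one] at h5
  refine h5.congr' ?_
  filter_upwards [eventually_gt_atTop 0, hsq.eventually (htop.eventually_gt_atTop 0),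
    hsq.eventually (htop.eventually_gt_atTop (ψ (l ^ 2))), hsq.eventually_gt_atTop (l ^ 2)]
    with ξ hξ hψ hψ' hξl
  have e1 : 0 < ξ ^ 2 - l ^ 2 := by linarith
  have e2 : 0 < ψ (ξ ^ 2) - ψ (l ^ 2) := by linarith
  have r1 : 1 + l ^ 2 / ξ ^ 2 = (l ^ 2 + ξ ^ 2) / ξ ^ 2 := by field_simp; ring
  have r2 : 1 - l ^ 2 / ξ ^ 2 = (ξ ^ 2 - l ^ 2) / ξ ^ 2 := by field_simp
  have r3 : 1 - ψ (l ^ 2) / ψ (ξ ^ 2) = (ψ (ξ ^ 2) - ψ (l ^ 2)) / ψ (ξ ^ 2) := by field_simp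
  simp only [Function.comp]
  rw [r1, r2, r3, recipSlope, Real.sqrt_div e1.le, Real.sqrt_div (by positivity),
    Real.sqrt_div e1.le, Real.sqrt_div e2.le, Real.sqrt_div (by positivity),
    Real.sqrt_mul (by positivity), Real.sqrt_mul (by positivity), Real.sqrt_sq hl.le,
    Real.sqrt_sq hξ.le]
  have := Real.sqrt_pos.2 e1
  have := Real.sqrt_pos.2 e2
  have := Real.sqrt_pos.2 hψ
  have := Real.sqrt_pos.2 hd
  change wienerHopf (recipSlope ψ (l ^ 2)) ξ / _ * _ = _
  field_simp

/-! ### Holomorphy on the right half-plane -/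

/-- A parametric integral of holomorphic functions with locally uniform integrable bounds is
holomorphic. -/
theorem differentiableOn_integral_of_locally_bounded {α : Type*} [MeasurableSpace α]
    {μ : Measure α} {F F' : ℂ → α → ℂ} {U : Set ℂ}
    (hF : ∀ z ∈ U, AEStronglyMeasurable (F z) μ) (hF' : ∀ z ∈ U, AEStronglyMeasurable (F' z) μ)
    (hd : ∀ a, ∀ z ∈ U, HasDerivAt (fun z => F z a) (F' z a) z)
    (hb : ∀ z ∈ U, ∃ r > 0, Metric.ball z r ⊆ U ∧ ∃ bound : α → ℝ, Integrable bound μ ∧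
      ∀ᵐ a ∂μ, ∀ w ∈ Metric.ball z r, ‖F w a‖ ≤ bound a) :
    DifferentiableOn ℂ (fun z => ∫ a, F z a ∂μ) U := by
  intro z hz
  obtain ⟨r, hr, hrU, bound, hbi, hbound⟩ := hb z hz
  have hnear : Metric.ball z (r / 2) ∈ 𝓝 z := Metric.ball_mem_nhds z (by positivity)
  have hsub : Metric.ball z (r / 2) ⊆ Metric.ball z r := Metric.ball_subset_ball (by linarith)
  -- Cauchy's estimate on circles of radius `r/4` centred in the ball of radius `r/2` turns a bound
  -- on `F` into one on `F'`.
  refine (hasDerivAt_integral_of_dominated_loc_of_deriv_le (F' := F')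
    (bound := fun a => bound a / (r / 4)) hnear
    ((eventually_of_mem hnear fun w hw => hF w (hrU (hsub hw)))) ?_ (hF' z hz) ?_
    (hbi.div_const _) ?_).2.differentiableAt.differentiableWithinAt
  · exact hbi.mono' (hF z hz) (hbound.mono fun a ha => ha z (Metric.mem_ball_self hr))
  · refine hbound.mono fun a ha w hw => ?_
    have hcl : Metric.closedBall w (r / 4) ⊆ Metric.ball z r := fun v hv => by
      rw [Metric.mem_closedBall] at hv
      rw [Metric.mem_ball] at hw ⊢
      have := dist_triangle v w z
      linarith
    rw [← (hd a w (hrU (hsub hw))).deriv]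
    refine Complex.norm_deriv_le_of_forall_mem_sphere_norm_le (by positivity) ?_ ?_
    · refine DifferentiableOn.diffContOnCl fun v hv => ?_
      have hv' : v ∈ Metric.closedBall w (r / 4) := Metric.closure_ball_subset_closedBall hv
      exact (hd a v (hrU (hcl hv'))).differentiableAt.differentiableWithinAt
    · intro v hv
      exact ha v (hcl (Metric.sphere_subset_closedBall hv))
  · exact Eventually.of_forall fun a w hw => hd a w (hrU (hsub hw))

/-- The kernel is `1/w` with `w = ξ + ζ²/ξ`, and `Re w = Re ξ (1 + ζ²/|ξ|²)` keeps `w` away from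
zero. -/
theorem norm_poisson_le {δ R : ℝ} (hδ : 0 < δ) {ξ : ℂ} (h1 : δ ≤ ξ.re) (h2 : ‖ξ‖ ≤ R) (ζ : ℝ) :
    ξ ^ 2 + (ζ : ℂ) ^ 2 ≠ 0 ∧
    ‖ξ / (ξ ^ 2 + (ζ : ℂ) ^ 2)‖ ≤ (1 + R ^ 2) / δ * (1 + ζ ^ 2)⁻¹ := by
  have hξ : ξ ≠ 0 := fun h => by rw [h] at h1; simp at h1; linarith
  have hn : 0 < ‖ξ‖ := norm_pos_iff.2 hξ
  set w : ℂ := ξ + (ζ : ℂ) ^ 2 / ξ with hw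
  have hre : δ * ((1 + ζ ^ 2) / (1 + R ^ 2)) ≤ ‖w‖ := by
    refine le_trans ?_ (Complex.re_le_norm w)
    have e : w.re = ξ.re * (1 + ζ ^ 2 / ‖ξ‖ ^ 2) := by
      rw [hw, Complex.add_re, ← Complex.ofReal_pow, Complex.div_re, ← Complex.normSq_eq_norm_sq]
      simp [-Complex.ofReal_pow]
      ring
    rw [e]
    refine mul_le_mul h1 ?_ (by positivity) (by linarith)
    have h3 : ‖ξ‖ ^ 2 ≤ R ^ 2 := pow_le_pow_left₀ hn.le h2 2
    have h4 : ζ ^ 2 / R ^ 2 ≤ ζ ^ 2 / ‖ξ‖ ^ 2 :=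
      div_le_div_of_nonneg_left (by positivity) (by positivity) h3
    refine le_trans ?_ (add_le_add_right h4 1)
    have hR : 0 < R ^ 2 := lt_of_lt_of_le (by positivity) h3
    rw [div_le_iff₀ (by positivity)]
    have : ζ ^ 2 / R ^ 2 * R ^ 2 = ζ ^ 2 := div_mul_cancel₀ _ hR.ne'
    have : 0 ≤ ζ ^ 2 / R ^ 2 := by positivity
    nlinarith
  have hw0 : 0 < ‖w‖ := lt_of_lt_of_le (by positivity) hre
  have e : ξ ^ 2 + (ζ : ℂ) ^ 2 = ξ * w := by rw [hw]; field_simp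
  have hwne : w ≠ 0 := norm_pos_iff.1 hw0
  rw [e]
  refine ⟨mul_ne_zero hξ hwne, ?_⟩
  rw [div_mul_cancel_left₀ hξ, norm_inv]
  have := inv_anti₀ (by positivity) hre
  refine this.trans_eq ?_
  field_simp

theorem sq_add_sq_ne_zero {ξ : ℂ} (h : 0 < ξ.re) (ζ : ℝ) : ξ ^ 2 + (ζ : ℂ) ^ 2 ≠ 0 :=
  (norm_poisson_le h le_rfl le_rfl ζ).1

theorem ball_half_re {ξ w : ℂ} (hw : w ∈ Metric.ball ξ (ξ.re / 2)) :
    ξ.re / 2 ≤ w.re ∧ ‖w‖ ≤ ‖ξ‖ + ξ.re / 2 := by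
  rw [Metric.mem_ball, dist_eq_norm] at hw
  have h1 := Complex.abs_re_le_norm (w - ξ)
  rw [Complex.sub_re] at h1
  have h2 := abs_le.1 h1
  have h3 := norm_sub_norm_le w ξ
  constructor <;> linarith

theorem differentiableOn_poisson_integral {L : ℝ → ℝ} {A B : ℝ}
    (hL : AEStronglyMeasurable L (volume.restrict (Ioi 0)))
    (hb : ∀ᵐ ζ ∂volume.restrict (Ioi (0 : ℝ)), |L ζ| ≤ A + B * |Real.log ζ|) :
    DifferentiableOn ℂ (fun ξ : ℂ => ∫ ζ in Ioi (0 : ℝ),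
      ξ / (ξ ^ 2 + (ζ : ℂ) ^ 2) * (L ζ : ℂ)) {ξ | 0 < ξ.re} := by
  have hLc : AEStronglyMeasurable (fun ζ => (L ζ : ℂ)) (volume.restrict (Ioi 0)) :=
    Complex.continuous_ofReal.comp_aestronglyMeasurable hL
  refine differentiableOn_integral_of_locally_bounded
    (F' := fun ξ (ζ : ℝ) => (1 * (ξ ^ 2 + (ζ : ℂ) ^ 2) - ξ * (2 * ξ)) / (ξ ^ 2 + (ζ : ℂ) ^ 2) ^ 2 *
      (L ζ : ℂ)) (fun ξ _ => ?_) (fun ξ _ => ?_) (fun ζ ξ hξ => ?_) fun ξ hξ => ?_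
  · exact (Measurable.aestronglyMeasurable (by fun_prop)).mul hLc
  · exact (Measurable.aestronglyMeasurable (by fun_prop)).mul hLc
  · refine HasDerivAt.mul_const ?_ _
    refine (hasDerivAt_id ξ).fun_div ?_ (sq_add_sq_ne_zero hξ ζ)
    simpa using (hasDerivAt_pow 2 ξ).add_const ((ζ : ℂ) ^ 2)
  · have hξ : 0 < ξ.re := hξ
    refine ⟨ξ.re / 2, by positivity, fun w hw => ?_, fun ζ =>
      (1 + (‖ξ‖ + ξ.re / 2) ^ 2) / (ξ.re / 2) * ((1 + ζ ^ 2)⁻¹ * (A + B * |Real.log ζ|)),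
      (integrableOn_log_bound A B).const_mul _, hb.mono fun ζ hζ w hw => ?_⟩
    · have := (ball_half_re hw).1
      change 0 < w.re
      linarith
    · obtain ⟨h1, h2⟩ := ball_half_re hw
      rw [norm_mul, Complex.norm_real, Real.norm_eq_abs]
      beta_reduce
      rw [← mul_assoc]
      exact mul_le_mul (norm_poisson_le (by positivity) h1 h2 ζ).2 hζ (abs_nonneg _)
        (by positivity)

theorem differentiableOn_eigenLaplace {ψ : ℝ → ℝ} (h : IsCompleteBernstein ψ)
    (hunb : ¬ BddAbove (ψ '' Ioi 0)) {l : ℝ} (hl : 0 < l) :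
    DifferentiableOn ℂ (eigenLaplace ψ l) {ξ | 0 < ξ.re} := by
  have ha : 0 < l ^ 2 := by positivity
  have hfac := h.isWHFactorable hunb ha
  have hd := h.deriv_pos hunb ha
  obtain ⟨A, hA⟩ := hfac.log_bound ha
  have hae : ∀ᵐ ζ ∂volume.restrict (Ioi (0 : ℝ)),
      Real.log (deriv ψ (l ^ 2) * (l ^ 2 - ζ ^ 2) / (ψ (l ^ 2) - ψ (ζ ^ 2))) =
      Real.log (deriv ψ (l ^ 2)) + Real.log (recipSlope ψ (l ^ 2) (ζ ^ 2)) :=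
    (ae_sq_ne (a := l ^ 2)).mono fun ζ hζ => by
      rw [← Real.log_mul hd.ne' (hfac.pos _ (pow_pos hζ.1 2) hζ.2).ne', recipSlope,
        mul_div_assoc, ← neg_div_neg_eq, neg_sub, neg_sub]
  have hI := differentiableOn_poisson_integral
    (L := fun ζ => Real.log (deriv ψ (l ^ 2) * (l ^ 2 - ζ ^ 2) / (ψ (l ^ 2) - ψ (ζ ^ 2))))
    (A := |Real.log (deriv ψ (l ^ 2))| + A) (B := 2)
    ((aestronglyMeasurable_const.add hfac.meas).congr (hae.mono fun ζ hζ => hζ.symm)) (by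
      filter_upwards [hae, hA] with ζ h1 h2
      rw [h1]
      refine (abs_add_le _ _).trans ?_
      linarith)
  unfold eigenLaplace
  refine DifferentiableOn.mul ?_ ((hI.const_mul _).cexp)
  refine DifferentiableOn.div (by fun_prop) (by fun_prop) fun ξ hξ => ?_
  rw [add_comm]
  exact sq_add_sq_ne_zero hξ l

/-- The denominator is a convex combination of `ξ` and `1`. -/
theorem re_denom_pos (ξ : ℂ) (u : unitInterval) :
    min ξ.re 1 ≤ (ξ * ((1 - (u : ℝ) : ℝ) : ℂ) + ((u : ℝ) : ℂ)).re := by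
  have h0 := u.2.1
  have h1 := u.2.2
  simp only [Complex.add_re, Complex.mul_re, Complex.ofReal_re, Complex.ofReal_im, mul_zero,
    sub_zero]
  rcases min_cases ξ.re 1 with h | h <;> rw [h.1] <;> nlinarith

theorem denom_ne_zero {ξ : ℂ} (hξ : 0 < ξ.re) (u : unitInterval) :
    ξ * ((1 - (u : ℝ) : ℝ) : ℂ) + ((u : ℝ) : ℂ) ≠ 0 := fun h => by
  have := re_denom_pos ξ u
  rw [h, Complex.zero_re] at this
  exact absurd this (not_le.2 (lt_min hξ one_pos))

theorem differentiableOn_cbf_integral (ν : Measure unitInterval) [IsFiniteMeasure ν] :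
    DifferentiableOn ℂ (fun ξ : ℂ => ∫ u, ξ / (ξ * ((1 - (u : ℝ) : ℝ) : ℂ) + ((u : ℝ) : ℂ)) ∂ν)
      {ξ | 0 < ξ.re} := by
  refine differentiableOn_integral_of_locally_bounded
    (F' := fun ξ (u : unitInterval) => (1 * (ξ * ((1 - (u : ℝ) : ℝ) : ℂ) + ((u : ℝ) : ℂ)) -
      ξ * ((1 - (u : ℝ) : ℝ) : ℂ)) / (ξ * ((1 - (u : ℝ) : ℝ) : ℂ) + ((u : ℝ) : ℂ)) ^ 2)
      (fun ξ _ => ?_) (fun ξ _ => ?_) (fun u ξ hξ => ?_) fun ξ hξ => ?_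
  · exact Measurable.aestronglyMeasurable (by fun_prop)
  · exact Measurable.aestronglyMeasurable (by fun_prop)
  · refine (hasDerivAt_id ξ).fun_div ?_ (denom_ne_zero hξ u)
    exact (hasDerivAt_mul_const _).add_const _
  · have hξ : 0 < ξ.re := hξ
    refine ⟨ξ.re / 2, by positivity, fun w hw => ?_, fun u =>
      (‖ξ‖ + ξ.re / 2) / min (ξ.re / 2) 1, integrable_const _,
      Eventually.of_forall fun u w hw => ?_⟩
    · have := (ball_half_re hw).1
      change 0 < w.re
      linarith
    · obtain ⟨h1, h2⟩ := ball_half_re hw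
      rw [norm_div]
      have h3 : min (ξ.re / 2) 1 ≤ ‖w * ((1 - (u : ℝ) : ℝ) : ℂ) + ((u : ℝ) : ℂ)‖ :=
        (min_le_min_right 1 h1).trans ((re_denom_pos w u).trans (Complex.re_le_norm _))
      have h4 : 0 < min (ξ.re / 2) 1 := lt_min (by positivity) one_pos
      exact div_le_div₀ (by positivity) h2 h4 h3

/-- A function holomorphic on the right half-plane is determined by its values on `(0, ∞)`. -/
theorem eqOn_re_pos {f g : ℂ → ℂ} (hf : DifferentiableOn ℂ f {ξ | 0 < ξ.re})
    (hg : DifferentiableOn ℂ g {ξ | 0 < ξ.re}) (h : ∀ ξ : ℝ, 0 < ξ → f ξ = g ξ) :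
    EqOn f g {ξ | 0 < ξ.re} := by
  have hopen : IsOpen {ξ : ℂ | 0 < ξ.re} := isOpen_lt continuous_const Complex.continuous_re
  have hconn : IsPreconnected {ξ : ℂ | 0 < ξ.re} := (convex_halfSpace_re_gt 0).isPreconnected
  refine (hf.analyticOnNhd hopen).eqOn_of_preconnected_of_frequently_eq (hg.analyticOnNhd hopen)
    hconn (z₀ := 1) (by simp) ?_
  have ht : Tendsto (fun n : ℕ => ((1 + 1 / ((n : ℝ) + 1) : ℝ) : ℂ)) atTop (𝓝[≠] 1) := by
    refine tendsto_nhdsWithin_iff.2 ⟨?_, Eventually.of_forall fun n => ?_⟩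
    · have := (tendsto_one_div_add_atTop_nhds_zero_nat (𝕜 := ℝ)).const_add 1
      rw [add_zero] at this
      exact (Complex.continuous_ofReal.tendsto 1).comp this
    · have : (0 : ℝ) < 1 / ((n : ℝ) + 1) := by positivity
      intro hc
      have hc : ((1 + 1 / ((n : ℝ) + 1) : ℝ) : ℂ) = ((1 : ℝ) : ℂ) := by simpa using hc
      have := Complex.ofReal_injective hc
      linarith
  exact ht.frequently (Frequently.of_forall fun n => h _ (by positivity))

/-! ### Explicit inversion of the Laplace transform -/

/-- The exponential `e^{-sx}` with `s = u / (1 - u)`, and `0` for `s = ∞`. -/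
noncomputable def expKernel (x : ℝ) (u : unitInterval) : ℝ :=
  if (u : ℝ) = 1 then 0 else Real.exp (-((u : ℝ) / (1 - u) * x))

theorem expKernel_bounds {x : ℝ} (hx : 0 ≤ x) (u : unitInterval) :
    0 ≤ expKernel x u ∧ expKernel x u ≤ 1 := by
  unfold expKernel
  split_ifs with h
  · simp
  · have h0 := u.2.1
    have h1 := u.2.2
    refine ⟨(Real.exp_pos _).le, Real.exp_le_one_iff.2 ?_⟩
    have : 0 ≤ (u : ℝ) / (1 - u) := div_nonneg h0 (by linarith)
    have := mul_nonneg this hx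
    linarith

theorem expKernel_antitone {x y : ℝ} (hxy : x ≤ y) (u : unitInterval) :
    expKernel y u ≤ expKernel x u := by
  unfold expKernel
  split_ifs with h
  · simp
  · have h0 := u.2.1
    have h1 := u.2.2
    have : 0 ≤ (u : ℝ) / (1 - u) := div_nonneg h0 (by linarith)
    exact Real.exp_le_exp.2 (neg_le_neg (mul_le_mul_of_nonneg_left hxy this))

theorem continuous_expKernel (u : unitInterval) : Continuous fun x => expKernel x u := by
  unfold expKernel
  split_ifs <;> fun_prop

theorem measurable_expKernel : Measurable fun p : ℝ × unitInterval => expKernel p.1 p.2 := by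
  unfold expKernel
  refine Measurable.ite ?_ measurable_const (by fun_prop)
  exact measurableSet_eq_fun (f := fun p : ℝ × unitInterval => ((p.2 : ℝ))) (by fun_prop)
    measurable_const

/-- The normalizing factor `l / (u² + l² (1 - u)²)`. -/
noncomputable def eigenWeight (l : ℝ) (u : unitInterval) : ℝ :=
  l / ((u : ℝ) ^ 2 + l ^ 2 * (1 - u) ^ 2)

theorem eigenWeight_denom_pos {l : ℝ} (hl : 0 < l) (u : unitInterval) :
    0 < (u : ℝ) ^ 2 + l ^ 2 * (1 - u) ^ 2 := by
  rcases u.2.1.eq_or_lt with h | h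
  · rw [← h]; simp; positivity
  · positivity

theorem eigenWeight_pos {l : ℝ} (hl : 0 < l) (u : unitInterval) : 0 < eigenWeight l u :=
  div_pos hl (eigenWeight_denom_pos hl u)

theorem continuous_eigenWeight {l : ℝ} (hl : 0 < l) : Continuous (eigenWeight l) := by
  unfold eigenWeight
  exact Continuous.div (by fun_prop) (by fun_prop) fun u => (eigenWeight_denom_pos hl u).ne'

/-- The function with Laplace transform `l / (l² + ξ²) * ξ / (ξ (1 - u) + u)`. -/
noncomputable def eigenKernel (l x : ℝ) (u : unitInterval) : ℝ :=
  eigenWeight l u * (u * Real.cos (l * x) + l * (1 - u) * Real.sin (l * x) - u * expKernel x u)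

theorem abs_eigenKernel_le {l x : ℝ} (hl : 0 < l) (hx : 0 ≤ x) (u : unitInterval) :
    |eigenKernel l x u| ≤ eigenWeight l u * (2 + l) := by
  rw [eigenKernel, abs_mul, abs_of_pos (eigenWeight_pos hl u)]
  refine mul_le_mul_of_nonneg_left ?_ (eigenWeight_pos hl u).le
  have h0 := u.2.1
  have h1 := u.2.2
  have hE := expKernel_bounds hx u
  have a1 : |(u : ℝ) * Real.cos (l * x)| ≤ 1 := by
    rw [abs_mul, abs_of_nonneg h0]
    exact mul_le_one₀ h1 (abs_nonneg _) (Real.abs_cos_le_one _)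
  have a2 : |l * (1 - (u : ℝ)) * Real.sin (l * x)| ≤ l := by
    rw [abs_mul, abs_of_nonneg (mul_nonneg hl.le (by linarith))]
    calc l * (1 - (u : ℝ)) * |Real.sin (l * x)| ≤ l * 1 * 1 :=
          mul_le_mul (mul_le_mul_of_nonneg_left (by linarith) hl.le) (Real.abs_sin_le_one _)
            (abs_nonneg _) (by linarith)
      _ = l := by ring
  have a3 : |(u : ℝ) * expKernel x u| ≤ 1 := by
    rw [abs_mul, abs_of_nonneg h0, abs_of_nonneg hE.1]
    exact mul_le_one₀ h1 hE.1 hE.2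
  have b1 := abs_sub (u * Real.cos (l * x) + l * (1 - u) * Real.sin (l * x)) (u * expKernel x u)
  have b2 := abs_add_le ((u : ℝ) * Real.cos (l * x)) (l * (1 - u) * Real.sin (l * x))
  linarith

theorem continuous_eigenKernel (l : ℝ) (u : unitInterval) :
    Continuous fun x => eigenKernel l x u := by
  have := continuous_expKernel u
  unfold eigenKernel
  fun_prop

theorem measurable_eigenKernel {l : ℝ} (hl : 0 < l) :
    Measurable fun p : ℝ × unitInterval => eigenKernel l p.1 p.2 := by
  have h1 := measurable_expKernel
  have h2 := (continuous_eigenWeight hl).measurable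
  unfold eigenKernel
  fun_prop

/-- The superposition of the functions `eigenKernel l · u`. -/
noncomputable def eigenSuperposition (l : ℝ) (ν : Measure unitInterval) (x : ℝ) : ℝ :=
  ∫ u, eigenKernel l x u ∂ν

section

variable {l : ℝ} (ν : Measure unitInterval) [IsFiniteMeasure ν]

theorem integrable_eigenWeight_mul (hl : 0 < l) {f : unitInterval → ℝ} (hf : Continuous f) :
    Integrable (fun u => eigenWeight l u * f u) ν :=
  integrable_of_continuous_unitInterval ((continuous_eigenWeight hl).mul hf) ν

theorem integrable_eigenKernel (hl : 0 < l) {x : ℝ} (hx : 0 ≤ x) :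
    Integrable (eigenKernel l x) ν :=
  (integrable_eigenWeight_mul ν hl (continuous_const (y := 2 + l))).mono'
    ((measurable_eigenKernel hl).comp measurable_prodMk_left).aestronglyMeasurable
    (Eventually.of_forall fun u => abs_eigenKernel_le hl hx u)

theorem abs_eigenSuperposition_le (hl : 0 < l) {x : ℝ} (hx : 0 ≤ x) :
    |eigenSuperposition l ν x| ≤ ∫ u, eigenWeight l u * (2 + l) ∂ν := by
  rw [← Real.norm_eq_abs, eigenSuperposition]
  exact norm_integral_le_of_norm_le (integrable_eigenWeight_mul ν hl (continuous_const (y := 2 + l)))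
    (Eventually.of_forall fun u => abs_eigenKernel_le hl hx u)

theorem continuousOn_eigenSuperposition (hl : 0 < l) :
    ContinuousOn (eigenSuperposition l ν) (Ioi 0) :=
  continuousOn_of_dominated
    (fun _ hx => (integrable_eigenKernel ν hl (le_of_lt hx)).1)
    (fun _ hx => Eventually.of_forall fun u => abs_eigenKernel_le hl (le_of_lt hx) u)
    (integrable_eigenWeight_mul ν hl (continuous_const (y := 2 + l)))
    (Eventually.of_forall fun u => (continuous_eigenKernel l u).continuousOn)

end

theorem laplace_exp {ξ b : ℂ} (h : b.re < ξ.re) :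
    IntegrableOn (fun x : ℝ => Complex.exp (-(ξ * x)) * Complex.exp (b * x)) (Ioi 0) ∧
    ∫ x in Ioi (0 : ℝ), Complex.exp (-(ξ * x)) * Complex.exp (b * x) = 1 / (ξ - b) := by
  have e : ∀ x : ℝ, Complex.exp (-(ξ * x)) * Complex.exp (b * x) = Complex.exp ((b - ξ) * x) :=
    fun x => by rw [← Complex.exp_add]; congr 1; ring
  have hre : (b - ξ).re < 0 := by simpa using h
  simp_rw [e]
  refine ⟨integrableOn_exp_mul_complex_Ioi hre 0, ?_⟩
  rw [integral_exp_mul_complex_Ioi hre]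
  simp only [Complex.ofReal_zero, mul_zero, Complex.exp_zero]
  rw [← neg_sub ξ b, neg_div_neg_eq]

/-- Partial fractions in `ξ`: the poles `±il` give the cosine and sine, the pole `-u/(1 - u)` the
exponential. -/
theorem laplace_eigenKernel {l : ℝ} (hl : 0 < l) {ξ : ℂ} (hξ : 0 < ξ.re) (u : unitInterval) :
    ∫ x in Ioi (0 : ℝ), Complex.exp (-(ξ * x)) * (eigenKernel l x u : ℂ) =
      (l : ℂ) / ((l : ℂ) ^ 2 + ξ ^ 2) *
        (ξ / (ξ * ((1 - (u : ℝ) : ℝ) : ℂ) + ((u : ℝ) : ℂ))) := by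
  obtain ⟨i1, h1⟩ := laplace_exp (ξ := ξ) (b := l * Complex.I) (by simpa using hξ)
  obtain ⟨i2, h2⟩ := laplace_exp (ξ := ξ) (b := -(l * Complex.I)) (by simpa using hξ)
  have hD := eigenWeight_denom_pos hl u
  have hDc : ((u : ℝ) : ℂ) ^ 2 + (l : ℂ) ^ 2 * (1 - ((u : ℝ) : ℂ)) ^ 2 ≠ 0 := by
    exact_mod_cast hD.ne'
  have hne := denom_ne_zero hξ u
  have hsq := sq_add_sq_ne_zero hξ l
  have hI : Complex.I ^ 2 = -1 := Complex.I_sq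
  have hfac : ξ ^ 2 + (l : ℂ) ^ 2 = (ξ - l * Complex.I) * (ξ - -(l * Complex.I)) := by
    linear_combination (l : ℂ) ^ 2 * hI
  have hf1 : ξ - l * Complex.I ≠ 0 := fun h => hsq (by rw [hfac, h, zero_mul])
  have hf2 : ξ - -(l * Complex.I) ≠ 0 := fun h => hsq (by rw [hfac, h, mul_zero])
  have hl1 : (l : ℂ) ^ 2 + ξ ^ 2 ≠ 0 := by rwa [add_comm]
  set w : ℂ := (eigenWeight l u : ℂ) with hw
  have hcos : ∀ x : ℝ, ((Real.cos (l * x) : ℝ) : ℂ) =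
      (Complex.exp (l * Complex.I * x) + Complex.exp (-(l * Complex.I) * x)) / 2 := fun x => by
    rw [Complex.ofReal_cos, Complex.cos]
    push_cast
    congr 3 <;> ring_nf
  have hsin : ∀ x : ℝ, ((Real.sin (l * x) : ℝ) : ℂ) =
      (Complex.exp (-(l * Complex.I) * x) - Complex.exp (l * Complex.I * x)) * Complex.I / 2 :=
    fun x => by
    rw [Complex.ofReal_sin, Complex.sin]
    push_cast
    congr 4 <;> ring_nf
  -- `J` is the transform of `expKernel · u`. Characterizing it by a product identity covers `u =
  -- 1`, where the exponential is absent and `J = 0`.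
  have hmain : ∃ J : ℂ, (∫ x in Ioi (0 : ℝ), Complex.exp (-(ξ * x)) * (eigenKernel l x u : ℂ)) =
      w * ((((u : ℝ) : ℂ) / 2 - l * (1 - ((u : ℝ) : ℂ)) * Complex.I / 2) * (1 / (ξ - l * Complex.I))
      + (((u : ℝ) : ℂ) / 2 + l * (1 - ((u : ℝ) : ℂ)) * Complex.I / 2) *
        (1 / (ξ - -(l * Complex.I))) - ((u : ℝ) : ℂ) * J) ∧
      J * (ξ * ((1 - (u : ℝ) : ℝ) : ℂ) + ((u : ℝ) : ℂ)) = ((1 - (u : ℝ) : ℝ) : ℂ) := by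
    have hsplit : ∀ (E : ℝ → ℂ) (J : ℂ),
        IntegrableOn (fun x : ℝ => Complex.exp (-(ξ * x)) * E x) (Ioi 0) →
        (∫ x in Ioi (0 : ℝ), Complex.exp (-(ξ * x)) * E x = J) →
        (∀ x : ℝ, ((expKernel x u : ℝ) : ℂ) = E x) →
        (∫ x in Ioi (0 : ℝ), Complex.exp (-(ξ * x)) * (eigenKernel l x u : ℂ)) =
      w * ((((u : ℝ) : ℂ) / 2 - l * (1 - ((u : ℝ) : ℂ)) * Complex.I / 2) * (1 / (ξ - l * Complex.I))
      + (((u : ℝ) : ℂ) / 2 + l * (1 - ((u : ℝ) : ℂ)) * Complex.I / 2) *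
        (1 / (ξ - -(l * Complex.I))) - ((u : ℝ) : ℂ) * J) := by
      intro E J hEi hEJ hE
      have i12 : Integrable (fun x : ℝ =>
          (((u : ℝ) : ℂ) / 2 - l * (1 - ((u : ℝ) : ℂ)) * Complex.I / 2) *
            (Complex.exp (-(ξ * x)) * Complex.exp (l * Complex.I * x)) +
          (((u : ℝ) : ℂ) / 2 + l * (1 - ((u : ℝ) : ℂ)) * Complex.I / 2) *
            (Complex.exp (-(ξ * x)) * Complex.exp (-(l * Complex.I) * x)))
          (volume.restrict (Ioi 0)) := (i1.const_mul _).add (i2.const_mul _)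
      rw [← h1, ← h2, ← hEJ, ← integral_const_mul, ← integral_const_mul,
        ← integral_add (i1.const_mul _) (i2.const_mul _), ← integral_const_mul,
        ← integral_sub i12 (hEi.const_mul _),
        ← integral_const_mul]
      refine integral_congr_ae (Eventually.of_forall fun x => ?_)
      simp only [eigenKernel]
      push_cast
      rw [← Complex.ofReal_mul, ← Complex.ofReal_cos, ← Complex.ofReal_sin, hcos, hsin, hE]
      ring
    by_cases hu : (u : ℝ) = 1
    · refine ⟨0, hsplit (fun _ => 0) 0 (by simp) (by simp) fun x => by simp [expKernel, hu], ?_⟩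
      simp [hu]
    · have hu1 : 0 < 1 - (u : ℝ) := sub_pos.2 (lt_of_le_of_ne u.2.2 hu)
      have hs0 : 0 ≤ (u : ℝ) / (1 - u) := div_nonneg u.2.1 hu1.le
      obtain ⟨i3, h3⟩ := laplace_exp (ξ := ξ) (b := ((-((u : ℝ) / (1 - u)) : ℝ) : ℂ))
        (by rw [Complex.ofReal_re]; linarith)
      refine ⟨_, hsplit _ _ i3 h3 fun x => ?_, ?_⟩
      · simp only [expKernel, if_neg hu]
        push_cast
        congr 1
        ring
      · have hc : ((1 - (u : ℝ) : ℝ) : ℂ) ≠ 0 := by exact_mod_cast hu1.ne'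
        have e : ξ * ((1 - (u : ℝ) : ℝ) : ℂ) + ((u : ℝ) : ℂ) =
            ((1 - (u : ℝ) : ℝ) : ℂ) * (ξ - ((-((u : ℝ) / (1 - u)) : ℝ) : ℂ)) := by
          rw [Complex.ofReal_neg, Complex.ofReal_div]
          field_simp
          ring
        have hne' : ξ - ((-((u : ℝ) / (1 - u)) : ℝ) : ℂ) ≠ 0 := fun h => hne (by
          rw [e, h, mul_zero])
        rw [e]
        field_simp
  obtain ⟨J, hJ1, hJ2⟩ := hmain
  rw [hJ1]
  have hJ3 : J = ((1 - (u : ℝ) : ℝ) : ℂ) / (ξ * ((1 - (u : ℝ) : ℝ) : ℂ) + ((u : ℝ) : ℂ)) :=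
    eq_div_of_mul_eq hne hJ2
  have hpair : ∀ A B : ℂ, (A / 2 - l * B * Complex.I / 2) * (1 / (ξ - l * Complex.I)) +
      (A / 2 + l * B * Complex.I / 2) * (1 / (ξ - -(l * Complex.I))) =
      (A * ξ + l ^ 2 * B) / ((l : ℂ) ^ 2 + ξ ^ 2) := by
    intro A B
    rw [add_comm ((l : ℂ) ^ 2), hfac]
    field_simp
    linear_combination (-2 * (l : ℂ) ^ 2 * B) * hI
  rw [hpair, hJ3, hw, eigenWeight]
  push_cast at hne ⊢
  rw [eq_comm]
  generalize ((u : ℝ) : ℂ) = v at *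
  field_simp
  ring

theorem laplaceTransform_eigenSuperposition {l : ℝ} (hl : 0 < l) (ν : Measure unitInterval)
    [IsFiniteMeasure ν] {ξ : ℂ} (hξ : 0 < ξ.re) :
    laplaceTransform (eigenSuperposition l ν) ξ = (l : ℂ) / ((l : ℂ) ^ 2 + ξ ^ 2) *
      ∫ u, ξ / (ξ * ((1 - (u : ℝ) : ℝ) : ℂ) + ((u : ℝ) : ℂ)) ∂ν := by
  have hint : Integrable (Function.uncurry fun (x : ℝ) (u : unitInterval) =>
      Complex.exp (-(ξ * x)) * (eigenKernel l x u : ℂ)) ((volume.restrict (Ioi 0)).prod ν) := by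
    have hb : IntegrableOn (fun x : ℝ => Real.exp (-ξ.re * x)) (Ioi 0) :=
      integrableOn_exp_mul_Ioi (by linarith) 0
    have hg := Integrable.mul_prod hb (integrable_eigenWeight_mul ν hl (continuous_const (y := 2 + l)))
    refine hg.mono' ?_ ?_
    · have := measurable_eigenKernel hl
      exact Measurable.aestronglyMeasurable (by unfold Function.uncurry; fun_prop)
    · have hae : ∀ᵐ p : ℝ × unitInterval ∂((volume.restrict (Ioi 0)).prod ν), 0 < p.1 := by
        have h1 : ∀ᵐ x ∂volume.restrict (Ioi (0 : ℝ)), 0 < x := ae_restrict_mem measurableSet_Ioi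
        exact Measure.quasiMeasurePreserving_fst.ae h1
      refine hae.mono fun p hp => ?_
      simp only [Function.uncurry]
      rw [norm_mul, Complex.norm_exp, Complex.norm_real, Real.norm_eq_abs]
      refine mul_le_mul (le_of_eq ?_) (abs_eigenKernel_le hl hp.le p.2) (abs_nonneg _)
        (Real.exp_pos _).le
      simp
  have h1 : laplaceTransform (eigenSuperposition l ν) ξ =
      ∫ x in Ioi (0 : ℝ), ∫ u, Complex.exp (-(ξ * x)) * (eigenKernel l x u : ℂ) ∂ν := by
    refine integral_congr_ae (Eventually.of_forall fun x => ?_)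
    simp only [eigenSuperposition]
    rw [← integral_complex_ofReal, integral_const_mul]
  rw [h1, integral_integral_swap hint, ← integral_const_mul]
  exact integral_congr_ae (Eventually.of_forall fun u => laplace_eigenKernel hl hξ u)

/-- The representing measure is only known to match on the positive axis; holomorphy of both sides
gives equality on the half-plane. -/
theorem isEigenfunctionFor_eigenSuperposition {ψ : ℝ → ℝ} (h : IsCompleteBernstein ψ)
    (hunb : ¬ BddAbove (ψ '' Ioi 0)) {l : ℝ} (hl : 0 < l) {ν : Measure unitInterval}
    [IsFiniteMeasure ν] (hν : ∀ ξ : ℝ, 0 < ξ → √(deriv ψ (l ^ 2)) *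
      wienerHopf (recipSlope ψ (l ^ 2)) ξ = ∫ u, cbfKernel ξ u ∂ν) :
    IsEigenfunctionFor ψ l (eigenSuperposition l ν) := by
  refine ⟨continuousOn_eigenSuperposition ν hl,
    ⟨_, fun x hx => abs_eigenSuperposition_le ν hl hx.le⟩, fun ξ hξ => ?_⟩
  rw [laplaceTransform_eigenSuperposition hl ν hξ]
  refine eqOn_re_pos (f := fun ξ => (l : ℂ) / ((l : ℂ) ^ 2 + ξ ^ 2) *
      ∫ u, ξ / (ξ * ((1 - (u : ℝ) : ℝ) : ℂ) + ((u : ℝ) : ℂ)) ∂ν) ?_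
    (differentiableOn_eigenLaplace h hunb hl) (fun x hx => ?_) hξ
  · refine DifferentiableOn.mul ?_ (differentiableOn_cbf_integral ν)
    refine DifferentiableOn.div (by fun_prop) (by fun_prop) fun ξ hξ => ?_
    rw [add_comm]
    exact sq_add_sq_ne_zero hξ l
  · rw [eigenLaplace_ofReal h hunb hl hx, hν x hx]
    push_cast
    rw [← integral_complex_ofReal]
    simp only [cbfKernel]
    push_cast
    rfl

/-! ### Moments in the variable `e^{-y}` and uniqueness -/

theorem exists_bound_comp_exp {φ : ℝ → ℝ} (hφ : Continuous φ) :
    ∃ C, ∀ y : ℝ, 0 < y → |φ (Real.exp (-y))| ≤ C := by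
  obtain ⟨C, hC⟩ := isCompact_Icc.exists_bound_of_continuousOn (s := Icc (0 : ℝ) 1) hφ.continuousOn
  exact ⟨C, fun y hy => hC _ ⟨(Real.exp_pos _).le, Real.exp_le_one_iff.2 (by linarith)⟩⟩

theorem integrableOn_comp_exp_mul {φ f : ℝ → ℝ} (hφ : Continuous φ) (hf : IntegrableOn f (Ioi 0)) :
    IntegrableOn (fun y => φ (Real.exp (-y)) * f y) (Ioi 0) := by
  obtain ⟨C, hC⟩ := exists_bound_comp_exp hφ
  exact hf.bdd_mul (c := C) (Continuous.aestronglyMeasurable (by fun_prop))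
    ((ae_restrict_mem measurableSet_Ioi).mono fun y hy => hC y hy)

theorem abs_integral_comp_exp_sub_le {φ p f : ℝ → ℝ} (hφ : Continuous φ) (hp : Continuous p)
    (hf : IntegrableOn f (Ioi 0)) {δ : ℝ} (h : ∀ t ∈ Icc (0 : ℝ) 1, |p t - φ t| ≤ δ) :
    |(∫ y in Ioi (0 : ℝ), p (Real.exp (-y)) * f y) - ∫ y in Ioi (0 : ℝ), φ (Real.exp (-y)) * f y|
      ≤ δ * ∫ y in Ioi (0 : ℝ), |f y| := by
  rw [← integral_sub (integrableOn_comp_exp_mul hp hf) (integrableOn_comp_exp_mul hφ hf),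
    ← integral_const_mul, ← Real.norm_eq_abs]
  refine norm_integral_le_of_norm_le (hf.abs.const_mul δ) ?_
  refine (ae_restrict_mem measurableSet_Ioi).mono fun y hy => ?_
  have hy : 0 < y := hy
  rw [← sub_mul, norm_mul, Real.norm_eq_abs, Real.norm_eq_abs]
  exact mul_le_mul_of_nonneg_right
    (h _ ⟨(Real.exp_pos _).le, Real.exp_le_one_iff.2 (by linarith)⟩) (abs_nonneg _)

/-- Convergence of the moments `∫ e^{-jy} f_i(y) dy` of `L¹`-bounded functions implies convergence
of `∫ φ(e^{-y}) f_i(y) dy` for continuous `φ`. -/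
theorem tendsto_integral_comp_exp {ι : Type*} {L : Filter ι} {f : ι → ℝ → ℝ} {g : ℝ → ℝ} {M : ℝ}
    (hf : ∀ᶠ i in L, IntegrableOn (f i) (Ioi 0))
    (hM : ∀ᶠ i in L, ∫ y in Ioi (0 : ℝ), |f i y| ≤ M) (hg : IntegrableOn g (Ioi 0))
    (hmom : ∀ j : ℕ, Tendsto (fun i => ∫ y in Ioi (0 : ℝ), Real.exp (-y) ^ j * f i y) L
      (𝓝 (∫ y in Ioi (0 : ℝ), Real.exp (-y) ^ j * g y))) {φ : ℝ → ℝ} (hφ : Continuous φ) :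
    Tendsto (fun i => ∫ y in Ioi (0 : ℝ), φ (Real.exp (-y)) * f i y) L
      (𝓝 (∫ y in Ioi (0 : ℝ), φ (Real.exp (-y)) * g y)) := by
  have hpoly : ∀ f : ℝ → ℝ, IntegrableOn f (Ioi 0) → ∀ p : Polynomial ℝ,
      ∫ y in Ioi (0 : ℝ), p.eval (Real.exp (-y)) * f y = ∑ j ∈ Finset.range (p.natDegree + 1),
        p.coeff j * ∫ y in Ioi (0 : ℝ), Real.exp (-y) ^ j * f y := fun f hf p => by
    simp_rw [Polynomial.eval_eq_sum_range, Finset.sum_mul, mul_assoc]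
    rw [integral_finsetSum _ fun j _ =>
      (integrableOn_comp_exp_mul (φ := fun t => t ^ j) (by fun_prop) hf).const_mul (p.coeff j)]
    simp_rw [integral_const_mul]
  set M' := ∫ y in Ioi (0 : ℝ), |g y| with hM'
  have hM'0 : 0 ≤ M' := integral_nonneg fun y => abs_nonneg _
  rw [Metric.tendsto_nhds]
  intro ε hε
  -- Weierstrass approximation within `δ` costs at most `ε/3` in total for `f i` and `g` together;
  -- the polynomial moments cost another `ε/3`.
  set δ := ε / (3 * (|M| + M' + 1)) with hδ
  have hden : 0 < |M| + M' + 1 := by positivity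
  have hδ0 : 0 < δ := by positivity
  have hδM : δ * (|M| + M' + 1) = ε / 3 := by rw [hδ]; field_simp
  obtain ⟨p, hp⟩ := exists_polynomial_near_of_continuousOn 0 1 φ hφ.continuousOn δ hδ0
  have hp' : ∀ t ∈ Icc (0 : ℝ) 1, |p.eval t - φ t| ≤ δ := fun t ht => (hp t ht).le
  have hlim : Tendsto (fun i => ∑ j ∈ Finset.range (p.natDegree + 1),
      p.coeff j * ∫ y in Ioi (0 : ℝ), Real.exp (-y) ^ j * f i y) L
      (𝓝 (∑ j ∈ Finset.range (p.natDegree + 1),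
        p.coeff j * ∫ y in Ioi (0 : ℝ), Real.exp (-y) ^ j * g y)) :=
    tendsto_finsetSum _ fun j _ => (hmom j).const_mul _
  filter_upwards [hf, hM, Metric.tendsto_nhds.1 hlim (ε / 3) (by positivity)] with i h1 h2 h3
  rw [← hpoly _ h1, ← hpoly _ hg, Real.dist_eq] at h3
  rw [Real.dist_eq]
  have e1 := abs_integral_comp_exp_sub_le hφ p.continuous h1 hp'
  have e2 := abs_integral_comp_exp_sub_le hφ p.continuous hg hp'
  have e3 : δ * ∫ y in Ioi (0 : ℝ), |f i y| ≤ δ * |M| :=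
    mul_le_mul_of_nonneg_left (h2.trans (le_abs_self M)) hδ0.le
  rw [abs_le] at e1 e2
  rw [abs_lt] at h3 ⊢
  constructor <;> nlinarith [e1.1, e1.2, e2.1, e2.2, h3.1, h3.2]

/-- A continuous bump function, composed with `y ↦ e^{-y}`, supported in `(p, q)`. -/
noncomputable def expBump (p q t : ℝ) : ℝ := max 0 ((t - Real.exp (-q)) * (Real.exp (-p) - t))

theorem continuous_expBump (p q : ℝ) : Continuous (expBump p q) := by
  unfold expBump; fun_prop

theorem expBump_nonneg (p q t : ℝ) : 0 ≤ expBump p q t := le_max_left _ _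

theorem expBump_pos {p q y : ℝ} (hy : y ∈ Ioo p q) : 0 < expBump p q (Real.exp (-y)) :=
  lt_max_of_lt_right (mul_pos (sub_pos.2 (Real.exp_lt_exp.2 (neg_lt_neg hy.2)))
    (sub_pos.2 (Real.exp_lt_exp.2 (neg_lt_neg hy.1))))

theorem expBump_eq_zero {p q y : ℝ} (hpq : p < q) (hy : y ∉ Ioo p q) :
    expBump p q (Real.exp (-y)) = 0 := by
  refine max_eq_left ?_
  rw [mem_Ioo, not_and_or, not_lt, not_lt] at hy
  rcases hy with h | h
  · exact mul_nonpos_of_nonneg_of_nonpos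
      (sub_nonneg.2 (Real.exp_le_exp.2 (by linarith))) (sub_nonpos.2 (Real.exp_le_exp.2 (by linarith)))
  · exact mul_nonpos_of_nonpos_of_nonneg
      (sub_nonpos.2 (Real.exp_le_exp.2 (by linarith))) (sub_nonneg.2 (Real.exp_le_exp.2 (by linarith)))

theorem integral_expBump_mul_pos {p q : ℝ} (hp : 0 ≤ p) (hpq : p < q) {f : ℝ → ℝ}
    (hf : IntegrableOn f (Ioi 0)) (hpos : ∀ y ∈ Ioo p q, 0 < f y) :
    0 < ∫ y in Ioi (0 : ℝ), expBump p q (Real.exp (-y)) * f y := by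
  have hnn : ∀ y, 0 ≤ expBump p q (Real.exp (-y)) * f y := fun y => by
    by_cases hy : y ∈ Ioo p q
    · exact (mul_pos (expBump_pos hy) (hpos y hy)).le
    · rw [expBump_eq_zero hpq hy, zero_mul]
  rw [setIntegral_pos_iff_support_of_nonneg_ae (Eventually.of_forall hnn)
    (integrableOn_comp_exp_mul (continuous_expBump p q) hf)]
  refine lt_of_lt_of_le (b := volume (Ioo p q)) (by simp [hpq]) (measure_mono fun y hy => ?_)
  exact ⟨(mul_pos (expBump_pos hy) (hpos y hy)).ne', hp.trans_lt hy.1⟩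

theorem laplaceTransform_ofReal (F : ℝ → ℝ) (ξ : ℝ) :
    laplaceTransform F (ξ : ℂ) = ((∫ x in Ioi (0 : ℝ), Real.exp (-(ξ * x)) * F x : ℝ) : ℂ) := by
  rw [laplaceTransform, ← integral_complex_ofReal]
  refine integral_congr_ae (Eventually.of_forall fun x => ?_)
  push_cast
  rfl

theorem integrableOn_exp_mul_of_bounded {F : ℝ → ℝ} (hF : ContinuousOn F (Ioi 0)) {C : ℝ}
    (hC : ∀ x, 0 < x → |F x| ≤ C) {k : ℝ} (hk : 0 < k) :
    IntegrableOn (fun x => Real.exp (-(k * x)) * F x) (Ioi 0) := by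
  have h1 : IntegrableOn (fun x : ℝ => Real.exp (-(k * x))) (Ioi 0) := by
    simpa using integrableOn_exp_mul_Ioi (neg_lt_zero.2 hk) 0
  exact h1.mul_bdd (c := C) (hF.aestronglyMeasurable measurableSet_Ioi)
    ((ae_restrict_mem measurableSet_Ioi).mono fun x hx => hC x hx)

/-- The `j`-th moment of `e^{-y} F(y)` is the Laplace transform of `F` at `j + 1`. -/
theorem exp_neg_pow_mul (y a : ℝ) (j : ℕ) :
    Real.exp (-y) ^ j * (Real.exp (-y) * a) = Real.exp (-((j + 1 : ℝ) * y)) * a := by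
  rw [← Real.exp_nat_mul, ← mul_assoc, ← Real.exp_add]; congr 2; ring

/-- A bounded continuous function on `(0, ∞)` is determined by its Laplace transform. -/
theorem IsEigenfunctionFor.unique {ψ : ℝ → ℝ} {l : ℝ} {F F' : ℝ → ℝ}
    (hF : IsEigenfunctionFor ψ l F) (hF' : IsEigenfunctionFor ψ l F') : EqOn F' F (Ioi 0) := by
  obtain ⟨hc, ⟨C, hC⟩, hL⟩ := hF
  obtain ⟨hc', ⟨C', hC'⟩, hL'⟩ := hF'
  have hi := fun {k : ℝ} (hk : 0 < k) => integrableOn_exp_mul_of_bounded hc hC hk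
  have hi' := fun {k : ℝ} (hk : 0 < k) => integrableOn_exp_mul_of_bounded hc' hC' hk
  have hD : IntegrableOn (fun y => Real.exp (-y) * (F' y - F y)) (Ioi 0) := by
    have := (hi' one_pos).sub (hi one_pos)
    simp only [one_mul] at this
    exact this.congr (Eventually.of_forall fun y => by simp only [Pi.sub_apply]; ring)
  have hmom : ∀ j : ℕ, ∫ y in Ioi (0 : ℝ), Real.exp (-y) ^ j * (Real.exp (-y) * (F' y - F y)) = 0 :=
    fun j => by
    have hk : (0 : ℝ) < j + 1 := by positivity
    simp_rw [exp_neg_pow_mul, mul_sub]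
    rw [integral_sub (hi' hk) (hi hk), sub_eq_zero]
    have hre : 0 < (((j + 1 : ℝ)) : ℂ).re := by rw [Complex.ofReal_re]; exact hk
    have h1 := (hL' _ hre).trans (hL _ hre).symm
    rw [laplaceTransform_ofReal, laplaceTransform_ofReal] at h1
    exact Complex.ofReal_injective h1
  have hzero : ∀ φ : ℝ → ℝ, Continuous φ →
      ∫ y in Ioi (0 : ℝ), φ (Real.exp (-y)) * (Real.exp (-y) * (F' y - F y)) = 0 := fun φ hφ => by
    have := tendsto_integral_comp_exp (L := (atTop : Filter ℕ))
      (f := fun _ y => Real.exp (-y) * (F' y - F y)) (g := fun _ => 0)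
      (Eventually.of_forall fun _ => hD) (Eventually.of_forall fun _ => le_rfl) (by simp)
      (fun j => by simp only [hmom, mul_zero, integral_zero]; exact tendsto_const_nhds) hφ
    simp only [mul_zero, integral_zero] at this
    exact tendsto_nhds_unique tendsto_const_nhds this
  -- A positive value of `D` persists on an interval by continuity, and a bump there has a nonzero
  -- integral. This is applied to the difference and its negative.
  have key : ∀ D : ℝ → ℝ, ContinuousOn D (Ioi 0) →
      IntegrableOn (fun y => Real.exp (-y) * D y) (Ioi 0) →
      (∀ φ : ℝ → ℝ, Continuous φ →
        ∫ y in Ioi (0 : ℝ), φ (Real.exp (-y)) * (Real.exp (-y) * D y) = 0) →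
      ∀ x, 0 < x → D x ≤ 0 := by
    intro D hDc hDi hDz x hx
    by_contra hcon
    push Not at hcon
    have hnear : ∀ᶠ y in 𝓝 x, 0 < D y ∧ 0 < y :=
      ((hDc.continuousAt (Ioi_mem_nhds hx)).eventually_const_lt hcon).and (eventually_gt_nhds hx)
    obtain ⟨ε, hε, hball⟩ := Metric.eventually_nhds_iff.1 hnear
    have hsub : ∀ y ∈ Ioo x (x + ε), 0 < D y := fun y hy => (hball (by
      rw [Real.dist_eq, abs_lt]; constructor <;> linarith [hy.1, hy.2])).1
    have := integral_expBump_mul_pos hx.le (by linarith : x < x + ε) hDi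
      fun y hy => mul_pos (Real.exp_pos _) (hsub y hy)
    rw [hDz _ (continuous_expBump _ _)] at this
    exact lt_irrefl _ this
  intro x hx
  have h1 := key (fun y => F' y - F y) (hc'.sub hc) hD hzero x hx
  have h2 := key (fun y => -(F' y - F y)) (hc'.sub hc).neg
    (hD.neg.congr (Eventually.of_forall fun y => by simp only [Pi.neg_apply]; ring))
    (fun φ hφ => by
      have := hzero φ hφ
      simp only [mul_neg, integral_neg, this, neg_zero]) x hx
  linarith

/-! ### Karamata's Tauberian theorem -/

theorem integral_exp_mul_rpow {α k : ℝ} (hα : 0 ≤ α) (hk : 0 < k) :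
    ∫ y in Ioi (0 : ℝ), Real.exp (-(k * y)) * (1 / Real.Gamma (1 + α) * y ^ α) =
      (1 / k) * k ^ (-α) := by
  have h1 := Real.integral_rpow_mul_exp_neg_mul_Ioi (a := 1 + α) (by linarith) hk
  have hG : Real.Gamma (1 + α) ≠ 0 := (Real.Gamma_pos_of_pos (by linarith)).ne'
  have e : ∀ y : ℝ, Real.exp (-(k * y)) * (1 / Real.Gamma (1 + α) * y ^ α) =
      1 / Real.Gamma (1 + α) * (y ^ (1 + α - 1) * Real.exp (-(k * y))) := fun y => by
    rw [show 1 + α - 1 = α by ring]; ring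
  simp_rw [e]
  rw [integral_const_mul, h1, one_div k, Real.inv_rpow hk.le, Real.rpow_add hk, Real.rpow_one,
    Real.rpow_neg hk.le]
  field_simp

theorem integrableOn_exp_mul_rpow {α : ℝ} (hα : 0 ≤ α) :
    IntegrableOn (fun y : ℝ => Real.exp (-y) * (1 / Real.Gamma (1 + α) * y ^ α)) (Ioi 0) := by
  have h1 := (Real.GammaIntegral_convergent (s := 1 + α) (by linarith)).const_mul
    (1 / Real.Gamma (1 + α))
  refine h1.congr (Eventually.of_forall fun y => ?_)
  rw [show 1 + α - 1 = α by ring]; ring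

/-- **Karamata's Tauberian theorem** for a bounded function that is nonnegative and monotone
near `0`. -/
theorem tendsto_div_of_laplace {F ρ : ℝ → ℝ} {C δ c α : ℝ} (hF : ContinuousOn F (Ioi 0))
    (hC : ∀ x, 0 < x → |F x| ≤ C) (hδ : 0 < δ) (hmono : MonotoneOn F (Ioo 0 δ))
    (hnn : ∀ x ∈ Ioo 0 δ, 0 ≤ F x) (hα : 0 ≤ α) (hρ : ∀ᶠ ξ in atTop, 0 < ρ ξ)
    (hc : 0 < c) (hρc : ∀ᶠ ξ in atTop, c ≤ ξ ^ 2 * ρ ξ)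
    (hreg : ∀ k, 0 < k → Tendsto (fun ξ => ρ (k * ξ) / ρ ξ) atTop (𝓝 (k ^ (-α))))
    (hlap : Tendsto (fun ξ => ξ * (∫ x in Ioi (0 : ℝ), Real.exp (-(ξ * x)) * F x) / ρ ξ)
      atTop (𝓝 1)) :
    Tendsto (fun ξ => F ξ⁻¹ / ρ ξ) atTop (𝓝 (1 / Real.Gamma (1 + α))) := by
  have hC0 : 0 ≤ C := (abs_nonneg _).trans (hC 1 one_pos)
  -- The rescaled functions `F(y/ξ)/ρ(ξ)`, weighted by `e^{-y}`, should approach `y^α/Γ(1 + α)` with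
  -- the same weight; regular variation of `ρ` gives the convergence of all moments.
  set f : ℝ → ℝ → ℝ := fun ξ y => Real.exp (-y) * (F (y / ξ) / ρ ξ) with hf
  have hFs : ∀ ξ, 0 < ξ → ContinuousOn (fun y => F (y / ξ)) (Ioi 0) := fun ξ hξ =>
    hF.comp (by fun_prop) fun y hy => div_pos hy hξ
  have hCs : ∀ ξ, 0 < ξ → ∀ y, 0 < y → |F (y / ξ)| ≤ C := fun ξ hξ y hy => hC _ (div_pos hy hξ)
  have hint : ∀ ξ, 0 < ξ → IntegrableOn (f ξ) (Ioi 0) := fun ξ hξ => by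
    have h1 := (integrableOn_exp_mul_of_bounded (hFs ξ hξ) (hCs ξ hξ) one_pos).div_const (ρ ξ)
    refine h1.congr (Eventually.of_forall fun y => ?_)
    simp only [hf, one_mul]; ring
  have hscale : ∀ ξ k, 0 < ξ → 0 < k → ∫ y in Ioi (0 : ℝ), Real.exp (-(k * y)) * F (y / ξ) =
      ξ * ∫ x in Ioi (0 : ℝ), Real.exp (-((k * ξ) * x)) * F x := fun ξ k hξ _ => by
    have h1 := integral_comp_mul_left_Ioi (fun y => Real.exp (-(k * y)) * F (y / ξ)) 0 hξ
    rw [mul_zero, smul_eq_mul, eq_comm, inv_mul_eq_iff_eq_mul₀ hξ.ne'] at h1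
    rw [h1]
    congr 1
    refine integral_congr_ae (Eventually.of_forall fun y => ?_)
    simp only
    rw [mul_div_cancel_left₀ _ hξ.ne', mul_assoc]
  have hmomk : ∀ k, 0 < k → Tendsto (fun ξ =>
      ∫ y in Ioi (0 : ℝ), Real.exp (-(k * y)) * (F (y / ξ) / ρ ξ)) atTop
      (𝓝 ((1 / k) * k ^ (-α))) := fun k hk => by
    have hkt : Tendsto (fun ξ : ℝ => k * ξ) atTop atTop := tendsto_id.const_mul_atTop hk
    have h1 := ((hlap.comp hkt).mul (hreg k hk)).const_mul (1 / k)
    rw [one_mul] at h1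
    refine h1.congr' ?_
    filter_upwards [eventually_gt_atTop 0, hρ, hkt.eventually hρ] with ξ hξ h2 h3
    have e : ∀ y, Real.exp (-(k * y)) * (F (y / ξ) / ρ ξ) =
        (Real.exp (-(k * y)) * F (y / ξ)) / ρ ξ := fun y => by ring
    simp_rw [e]
    rw [integral_div, hscale ξ k hξ hk]
    simp only [Function.comp]
    field_simp
  have hmom : ∀ j : ℕ, Tendsto (fun ξ => ∫ y in Ioi (0 : ℝ), Real.exp (-y) ^ j * f ξ y) atTop
      (𝓝 (∫ y in Ioi (0 : ℝ), Real.exp (-y) ^ j *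
        (Real.exp (-y) * (1 / Real.Gamma (1 + α) * y ^ α)))) := fun j => by
    simp only [hf, exp_neg_pow_mul]
    rw [integral_exp_mul_rpow hα (by positivity)]
    exact hmomk (j + 1) (by positivity)
  -- Where `y < δξ`, `f` is nonnegative, so its absolute integral is controlled by its integral,
  -- which tends to `1 < 2`. Where `y ≥ δξ`, the bound `|F| ≤ C` and `1/ρ(ξ) ≤ ξ²/c ≤ y²/(δ² c)`
  -- give an integrable majorant.
  have hM : ∃ M, ∀ᶠ ξ in atTop, ∫ y in Ioi (0 : ℝ), |f ξ y| ≤ M := by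
    have h2 : IntegrableOn (fun y : ℝ => Real.exp (-y) * y ^ 2) (Ioi 0) := by
      have := Real.GammaIntegral_convergent (s := 3) (by norm_num)
      refine this.congr (Eventually.of_forall fun y => ?_)
      simp only
      rw [show (3 : ℝ) - 1 = (2 : ℕ) by norm_num, Real.rpow_natCast]
    set K := ∫ y in Ioi (0 : ℝ), Real.exp (-y) * y ^ 2 with hK
    have h1 := (hmomk 1 one_pos).eventually (eventually_le_nhds
      (show (1 / 1 : ℝ) * 1 ^ (-α) < 2 by simp))
    refine ⟨2 + 2 * C / (δ ^ 2 * c) * K, ?_⟩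
    filter_upwards [eventually_gt_atTop 0, hρ, hρc, h1] with ξ hξ hρξ hcξ h3
    simp only [one_mul] at h3
    have hle : ∀ y ∈ Ioi (0 : ℝ), |f ξ y| ≤ f ξ y + 2 * C / (δ ^ 2 * c) * (Real.exp (-y) * y ^ 2) := by
      intro y hy
      have hy : 0 < y := hy
      have hcoef : 0 ≤ 2 * C / (δ ^ 2 * c) := by positivity
      by_cases hyδ : y / ξ < δ
      · have : 0 ≤ f ξ y := mul_nonneg (Real.exp_pos _).le
          (div_nonneg (hnn _ ⟨div_pos hy hξ, hyδ⟩) hρξ.le)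
        rw [abs_of_nonneg this]
        have := mul_nonneg hcoef (mul_nonneg (Real.exp_pos (-y)).le (sq_nonneg y))
        linarith
      · have hyδ : δ * ξ ≤ y := (le_div_iff₀ hξ).1 (not_lt.1 hyδ)
        have hF1 : |F (y / ξ) / ρ ξ| ≤ C / (δ ^ 2 * c) * y ^ 2 := by
          rw [abs_div, abs_of_pos hρξ, div_mul_eq_mul_div, div_le_div_iff₀ hρξ (by positivity)]
          have h4 : (δ * ξ) ^ 2 ≤ y ^ 2 := pow_le_pow_left₀ (by positivity) hyδ 2
          have h5 : δ ^ 2 * c ≤ y ^ 2 * ρ ξ := by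
            calc δ ^ 2 * c ≤ δ ^ 2 * (ξ ^ 2 * ρ ξ) := by gcongr
              _ = (δ * ξ) ^ 2 * ρ ξ := by ring
              _ ≤ y ^ 2 * ρ ξ := by gcongr
          calc |F (y / ξ)| * (δ ^ 2 * c) ≤ C * (y ^ 2 * ρ ξ) :=
                mul_le_mul (hCs ξ hξ y hy) h5 (by positivity) hC0
            _ = C * y ^ 2 * ρ ξ := by ring
        have hfa : |f ξ y| ≤ C / (δ ^ 2 * c) * (Real.exp (-y) * y ^ 2) := by
          simp only [hf]
          rw [abs_mul, abs_of_pos (Real.exp_pos _), mul_left_comm]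
          exact mul_le_mul_of_nonneg_left hF1 (Real.exp_pos _).le
        have e : 2 * C / (δ ^ 2 * c) * (Real.exp (-y) * y ^ 2) =
            2 * (C / (δ ^ 2 * c) * (Real.exp (-y) * y ^ 2)) := by ring
        rw [e]
        have := neg_abs_le (f ξ y)
        linarith
    have h4 := setIntegral_mono_on (hint ξ hξ).abs
      ((hint ξ hξ).add (h2.const_mul (2 * C / (δ ^ 2 * c)))) measurableSet_Ioi hle
    rw [integral_add' (hint ξ hξ) (h2.const_mul _), integral_const_mul] at h4
    linarith
  obtain ⟨M, hM⟩ := hM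
  have hweak : ∀ φ : ℝ → ℝ, Continuous φ →
      Tendsto (fun ξ => ∫ y in Ioi (0 : ℝ), φ (Real.exp (-y)) * f ξ y) atTop
      (𝓝 (∫ y in Ioi (0 : ℝ), φ (Real.exp (-y)) *
        (Real.exp (-y) * (1 / Real.Gamma (1 + α) * y ^ α)))) := fun φ hφ =>
    tendsto_integral_comp_exp ((eventually_gt_atTop 0).mono hint) hM
      (integrableOn_exp_mul_rpow hα) hmom hφ
  have hG : 0 < Real.Gamma (1 + α) := Real.Gamma_pos_of_pos (by linarith)
  have hexp : IntegrableOn (fun y : ℝ => Real.exp (-y)) (Ioi 0) := by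
    simpa using integrableOn_exp_mul_Ioi (neg_lt_zero.2 one_pos) 0
  -- comparison of a bump average with a constant
  have hcmp : ∀ {p q : ℝ}, p < q → ∀ {u v : ℝ → ℝ}, IntegrableOn (fun y => Real.exp (-y) * u y) (Ioi 0) →
      IntegrableOn (fun y => Real.exp (-y) * v y) (Ioi 0) → (∀ y ∈ Ioo p q, u y ≤ v y) →
      ∫ y in Ioi (0 : ℝ), expBump p q (Real.exp (-y)) * (Real.exp (-y) * u y) ≤
      ∫ y in Ioi (0 : ℝ), expBump p q (Real.exp (-y)) * (Real.exp (-y) * v y) := by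
    intro p q hpq u v hu hv huv
    refine integral_mono (integrableOn_comp_exp_mul (continuous_expBump p q) hu)
      (integrableOn_comp_exp_mul (continuous_expBump p q) hv) fun y => ?_
    by_cases hy : y ∈ Ioo p q
    · exact mul_le_mul_of_nonneg_left (mul_le_mul_of_nonneg_left (huv y hy) (Real.exp_pos _).le)
        (expBump_nonneg _ _ _)
    · simp only [expBump_eq_zero hpq hy, zero_mul, le_refl]
  have hconst : ∀ (p q b : ℝ), ∫ y in Ioi (0 : ℝ), expBump p q (Real.exp (-y)) *
      (Real.exp (-y) * b) = b * ∫ y in Ioi (0 : ℝ), expBump p q (Real.exp (-y)) * Real.exp (-y) :=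
    fun p q b => by
    rw [← integral_const_mul]
    exact integral_congr_ae (Eventually.of_forall fun y => by ring)
  have hcl : ∀ b : ℝ, IntegrableOn (fun y : ℝ => Real.exp (-y) * b) (Ioi 0) := fun b =>
    hexp.mul_const b
  have hKpos : ∀ {p q : ℝ}, 0 ≤ p → p < q →
      0 < ∫ y in Ioi (0 : ℝ), expBump p q (Real.exp (-y)) * Real.exp (-y) := fun hp hpq =>
    integral_expBump_mul_pos hp hpq hexp fun y _ => Real.exp_pos _
  have hcontα : ContinuousAt (fun q : ℝ => 1 / Real.Gamma (1 + α) * q ^ α) 1 :=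
    continuousAt_const.mul (Real.continuousAt_rpow_const _ _ (Or.inl one_ne_zero))
  rw [tendsto_order]
  constructor
  -- Averaging over `y ∈ (p, 1)` bounds `F(1/ξ)` from below by monotonicity; `p < 1` is close enough
  -- to `1` that `p^α/Γ(1 + α)` still exceeds `b`.
  · intro b hb
    have h1 : ∀ᶠ p in 𝓝[<] (1 : ℝ), b < 1 / Real.Gamma (1 + α) * p ^ α :=
      (hcontα.eventually_const_lt (by simpa using hb)).filter_mono nhdsWithin_le_nhds
    have h2 : ∀ᶠ p in 𝓝[<] (1 : ℝ), 0 < p ∧ p < 1 :=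
      (((eventually_gt_nhds one_pos).filter_mono nhdsWithin_le_nhds)).and self_mem_nhdsWithin
    obtain ⟨p, hp, hp0, hp1⟩ := (h1.and h2).exists
    have hK := hKpos hp0.le hp1
    have hlow := hcmp hp1 (hcl (1 / Real.Gamma (1 + α) * p ^ α)) (integrableOn_exp_mul_rpow hα)
      fun y hy => mul_le_mul_of_nonneg_left
        (Real.rpow_le_rpow hp0.le hy.1.le hα) (by positivity)
    rw [hconst] at hlow
    have hlt := (mul_lt_mul_of_pos_right hp hK).trans_le hlow
    filter_upwards [(hweak _ (continuous_expBump p 1)).eventually_const_lt hlt,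
      eventually_gt_atTop 0, eventually_gt_atTop δ⁻¹, hρ] with ξ h3 hξ hξδ hρξ
    have hξ1 : 1 / ξ < δ := by rw [one_div]; exact inv_lt_of_inv_lt₀ hδ hξδ
    have hup := hcmp hp1 (u := fun y => F (y / ξ) / ρ ξ) (hint ξ hξ) (hcl (F ξ⁻¹ / ρ ξ))
      fun y hy => div_le_div_of_nonneg_right (by
        rw [← one_div]
        have hy1 : y / ξ ≤ 1 / ξ := div_le_div_of_nonneg_right hy.2.le hξ.le
        exact hmono ⟨div_pos (hp0.trans hy.1) hξ, hy1.trans_lt hξ1⟩ ⟨by positivity, hξ1⟩ hy1) hρξ.le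
    rw [hconst] at hup
    exact lt_of_mul_lt_mul_right (h3.trans_le hup) hK.le
  -- Symmetrically, averaging over `y ∈ (1, q)` bounds `F(1/ξ)` from above. Here `ξ > q/δ` keeps all
  -- of `y/ξ` in the monotone range.
  · intro b hb
    have h1 : ∀ᶠ q in 𝓝[>] (1 : ℝ), 1 / Real.Gamma (1 + α) * q ^ α < b :=
      (hcontα.eventually_lt_const (by simpa using hb)).filter_mono nhdsWithin_le_nhds
    obtain ⟨q, hq, hq1⟩ := (h1.and self_mem_nhdsWithin).exists
    have hq1 : 1 < q := hq1
    have hK := hKpos zero_le_one hq1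
    have hup := hcmp hq1 (integrableOn_exp_mul_rpow hα) (hcl (1 / Real.Gamma (1 + α) * q ^ α))
      fun y hy => mul_le_mul_of_nonneg_left
        (Real.rpow_le_rpow (by linarith [hy.1]) hy.2.le hα) (by positivity)
    rw [hconst] at hup
    have hlt := hup.trans_lt (mul_lt_mul_of_pos_right hq hK)
    filter_upwards [(hweak _ (continuous_expBump 1 q)).eventually_lt_const hlt,
      eventually_gt_atTop 0, eventually_gt_atTop (q / δ), hρ] with ξ h3 hξ hξδ hρξ
    have hξ1 : q / ξ < δ := by rw [div_lt_iff₀ hξ]; rw [div_lt_iff₀ hδ] at hξδ; linarith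
    have hlow := hcmp hq1 (v := fun y => F (y / ξ) / ρ ξ) (hcl (F ξ⁻¹ / ρ ξ)) (hint ξ hξ)
      fun y hy => div_le_div_of_nonneg_right (by
        rw [← one_div]
        have hy1 : 1 / ξ ≤ y / ξ := div_le_div_of_nonneg_right hy.1.le hξ.le
        have hy2 : y / ξ < δ := (div_le_div_of_nonneg_right hy.2.le hξ.le).trans_lt hξ1
        exact hmono ⟨by positivity, hy1.trans_lt hy2⟩ ⟨lt_of_lt_of_le (by positivity) hy1, hy2⟩ hy1)
        hρξ.le
    rw [hconst] at hlow
    exact lt_of_mul_lt_mul_right (hlow.trans_lt h3) hK.le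

/-! ### Behaviour of the eigenfunction near zero -/

theorem exists_monotoneOn_cos_add_sin {l A B : ℝ} (hl : 0 < l) (hB : 0 < B) :
    ∃ δ > 0, MonotoneOn (fun x => A * Real.cos (l * x) + B * Real.sin (l * x)) (Ico 0 δ) := by
  set D : ℝ → ℝ := fun x => A * (-Real.sin (l * x) * l) + B * (Real.cos (l * x) * l) with hD
  have hd : ∀ x, HasDerivAt (fun x => A * Real.cos (l * x) + B * Real.sin (l * x)) (D x) x :=
    fun x => by
    have h0 : HasDerivAt (fun x : ℝ => l * x) l x := by simpa using (hasDerivAt_id x).const_mul l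
    exact (h0.cos.const_mul A).add (h0.sin.const_mul B)
  have hDc : Continuous D := by simp only [hD]; fun_prop
  have hD0 : 0 < D 0 := by simp only [hD]; simp; positivity
  obtain ⟨δ, hδ, hball⟩ := Metric.eventually_nhds_iff.1
    (hDc.continuousAt.eventually_const_lt hD0)
  refine ⟨δ, hδ, monotoneOn_of_deriv_nonneg (convex_Ico 0 δ)
    (fun x _ => (hd x).continuousAt.continuousWithinAt)
    (fun x _ => (hd x).differentiableAt.differentiableWithinAt) fun x hx => ?_⟩
  rw [interior_Ico] at hx
  rw [(hd x).deriv]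
  refine (hball ?_).le
  rw [Real.dist_eq, sub_zero, abs_of_pos hx.1]
  exact hx.2

/-- Here `F(x) = A cos(lx) + B sin(lx) - E(x)`, where `E` is nonincreasing and at most `A`. The
trigonometric part starts at `A` with slope `lB > 0`, so it increases near `0` and stays above `E`.
-/
theorem eigenSuperposition_near_zero {l : ℝ} (hl : 0 < l) (ν : Measure unitInterval)
    [IsFiniteMeasure ν] (hB : 0 < ∫ u, eigenWeight l u * (l * (1 - (u : ℝ))) ∂ν) :
    ∃ δ > 0, MonotoneOn (eigenSuperposition l ν) (Ioo 0 δ) ∧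
      ∀ x ∈ Ioo 0 δ, 0 ≤ eigenSuperposition l ν x := by
  set A := ∫ u, eigenWeight l u * (u : ℝ) ∂ν with hA
  set B := ∫ u, eigenWeight l u * (l * (1 - (u : ℝ))) ∂ν with hBdef
  have hAi : Integrable (fun u : unitInterval => eigenWeight l u * (u : ℝ)) ν :=
    integrable_eigenWeight_mul ν hl (by fun_prop)
  have hBi : Integrable (fun u : unitInterval => eigenWeight l u * (l * (1 - (u : ℝ)))) ν :=
    integrable_eigenWeight_mul ν hl (by fun_prop)
  have hEle : ∀ x, 0 ≤ x → ∀ u : unitInterval,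
      0 ≤ eigenWeight l u * u * expKernel x u ∧
      eigenWeight l u * u * expKernel x u ≤ eigenWeight l u * u := fun x hx u => by
    have h1 := mul_nonneg (eigenWeight_pos hl u).le u.2.1
    have h2 := expKernel_bounds hx u
    exact ⟨mul_nonneg h1 h2.1, mul_le_of_le_one_right h1 h2.2⟩
  have hEi : ∀ x, 0 ≤ x →
      Integrable (fun u : unitInterval => eigenWeight l u * u * expKernel x u) ν := fun x hx => by
    refine hAi.mono' ?_ (Eventually.of_forall fun u => ?_)
    · have h1 : Measurable fun u => expKernel x u :=
        measurable_expKernel.comp measurable_prodMk_left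
      have h2 := (continuous_eigenWeight hl).measurable
      exact Measurable.aestronglyMeasurable (by fun_prop)
    · rw [Real.norm_of_nonneg (hEle x hx u).1]; exact (hEle x hx u).2
  have hsplit : ∀ x, 0 ≤ x → eigenSuperposition l ν x =
      (A * Real.cos (l * x) + B * Real.sin (l * x)) -
        ∫ u : unitInterval, eigenWeight l u * u * expKernel x u ∂ν := fun x hx => by
    rw [hA, hBdef, ← integral_mul_const, ← integral_mul_const,
      ← integral_add (hAi.mul_const _) (hBi.mul_const _), ← integral_sub
        ((hAi.mul_const _).fun_add (hBi.mul_const _)) (hEi x hx), eigenSuperposition]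
    refine integral_congr_ae (Eventually.of_forall fun u => ?_)
    simp only [eigenKernel]
    ring
  obtain ⟨δ, hδ, hmono⟩ := exists_monotoneOn_cos_add_sin (A := A) hl hB
  refine ⟨δ, hδ, fun x hx y hy hxy => ?_, fun x hx => ?_⟩
  · rw [hsplit x hx.1.le, hsplit y hy.1.le]
    have h1 := hmono ⟨hx.1.le, hx.2⟩ ⟨hy.1.le, hy.2⟩ hxy
    have h2 : ∫ u : unitInterval, eigenWeight l u * u * expKernel y u ∂ν ≤
        ∫ u : unitInterval, eigenWeight l u * u * expKernel x u ∂ν :=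
      integral_mono (hEi y hy.1.le) (hEi x hx.1.le) fun u =>
        mul_le_mul_of_nonneg_left (expKernel_antitone hxy u)
          (mul_nonneg (eigenWeight_pos hl u).le u.2.1)
    simp only at h1
    linarith
  · rw [hsplit x hx.1.le]
    have h1 := hmono ⟨le_rfl, hδ⟩ ⟨hx.1.le, hx.2⟩ hx.1.le
    have h2 : ∫ u : unitInterval, eigenWeight l u * u * expKernel x u ∂ν ≤ A :=
      integral_mono (hEi x hx.1.le) hAi fun u => (hEle x hx.1.le u).2
    simp only [mul_zero, Real.cos_zero, Real.sin_zero, mul_one, add_zero] at h1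
    linarith

/-- If the integral vanished, `ν` would be concentrated at `u = 1` and the Wiener–Hopf factor would
be linear in `ξ`. Its ratio to the known asymptotics `ξ/√ψ(ξ²)` would then grow like `√ψ(ξ²) → ∞`.
-/
theorem integral_eigenWeight_pos {ψ : ℝ → ℝ} (h : IsCompleteBernstein ψ)
    (hunb : ¬ BddAbove (ψ '' Ioi 0)) {α : ℝ} (hreg : IsRegularlyVaryingAtTop ψ α)
    {l : ℝ} (hl : 0 < l) {ν : Measure unitInterval}
    [IsFiniteMeasure ν] (hν : ∀ ξ : ℝ, 0 < ξ → √(deriv ψ (l ^ 2)) *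
      wienerHopf (recipSlope ψ (l ^ 2)) ξ = ∫ u, cbfKernel ξ u ∂ν) :
    0 < ∫ u, eigenWeight l u * (l * (1 - (u : ℝ))) ∂ν := by
  have hd := h.deriv_pos hunb (show 0 < l ^ 2 by positivity)
  have htop := h.tendsto_atTop hunb
  have hsq : Tendsto (fun ξ : ℝ => ξ ^ 2) atTop atTop := tendsto_pow_atTop two_ne_zero
  have hnn : ∀ u : unitInterval, 0 ≤ eigenWeight l u * (l * (1 - (u : ℝ))) := fun u =>
    mul_nonneg (eigenWeight_pos hl u).le (mul_nonneg hl.le (sub_nonneg.2 u.2.2))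
  refine lt_of_le_of_ne (integral_nonneg hnn) fun h0 => ?_
  have hae : ∀ᵐ u : unitInterval ∂ν, (u : ℝ) = 1 := by
    have h1 := (integral_eq_zero_iff_of_nonneg hnn
      (integrable_eigenWeight_mul ν hl (by fun_prop))).1 h0.symm
    refine h1.mono fun u hu => ?_
    have h2 := (mul_eq_zero.1 hu).resolve_left (eigenWeight_pos hl u).ne'
    have h3 := (mul_eq_zero.1 h2).resolve_left hl.ne'
    linarith
  set c := ν.real univ with hc
  have hlin : ∀ ξ : ℝ, 0 < ξ → √(deriv ψ (l ^ 2)) *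
      wienerHopf (recipSlope ψ (l ^ 2)) ξ = c * ξ := fun ξ hξ => by
    rw [hν ξ hξ, integral_congr_ae (g := fun _ => ξ) (hae.mono fun u hu => by simp [cbfKernel, hu])]
    simp [hc]
  have hcpos : 0 < c := by
    have h1 := hlin 1 one_pos
    rw [mul_one] at h1
    rw [← h1]
    exact mul_pos (Real.sqrt_pos.2 hd) (Real.exp_pos _)
  have hlim := isEquivalent_wienerHopf h hunb hreg hl
  refine not_tendsto_nhds_of_tendsto_atTop ?_ 1 hlim
  have hbig : Tendsto (fun ξ : ℝ => (c / (2 * √(deriv ψ (l ^ 2)))) * √(ψ (ξ ^ 2))) atTop atTop := by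
    have h2 := Real.tendsto_sqrt_atTop.comp (htop.comp hsq)
    exact h2.const_mul_atTop (by have := Real.sqrt_pos.2 hd; positivity)
  refine tendsto_atTop_mono' _ ?_ hbig
  filter_upwards [eventually_gt_atTop 0, eventually_gt_atTop l,
    hsq.eventually (htop.eventually_gt_atTop 0)] with ξ hξ hξl hψ
  have s1 := Real.sqrt_pos.2 hd
  have s2 := Real.sqrt_pos.2 hψ
  rw [hlin ξ hξ, Real.sqrt_div (by positivity), Real.sqrt_mul (by positivity),
    Real.sqrt_mul (by positivity), Real.sqrt_sq hl.le, Real.sqrt_sq hξ.le]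
  have e : l / (l ^ 2 + ξ ^ 2) * (c * ξ) / (l * √(deriv ψ (l ^ 2)) / (ξ * √(ψ (ξ ^ 2)))) =
      (c / √(deriv ψ (l ^ 2)) * √(ψ (ξ ^ 2))) * (ξ ^ 2 / (l ^ 2 + ξ ^ 2)) := by
    field_simp
  have e' : c / (2 * √(deriv ψ (l ^ 2))) * √(ψ (ξ ^ 2)) =
      (c / √(deriv ψ (l ^ 2)) * √(ψ (ξ ^ 2))) * (1 / 2) := by
    field_simp
  rw [e, e']
  refine mul_le_mul_of_nonneg_left ?_ (by positivity)
  rw [div_le_div_iff₀ two_pos (by positivity)]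
  nlinarith

/-- At most linear growth of `ψ` keeps `ρ` from decaying too fast, as the Tauberian theorem
requires. -/
theorem IsCompleteBernstein.exists_le_mul_add_one {ψ : ℝ → ℝ} (h : IsCompleteBernstein ψ) :
    ∃ K > 0, ∀ z, 0 < z → ψ z ≤ K * (z + 1) := by
  obtain ⟨c₁, c, m, hc₁, hc, hm, hint, hψ⟩ := h
  set I := ∫ s in Ioi (0 : ℝ), min 1 s * m s with hI
  have hI0 : 0 ≤ I := setIntegral_nonneg measurableSet_Ioi fun s hs =>
    mul_nonneg (le_min zero_le_one (le_of_lt hs)) (hm.nonneg hs)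
  refine ⟨c₁ + c + I + 1, by positivity, fun z hz => ?_⟩
  have h1 : ∫ s in Ioi (0 : ℝ), (1 - Real.exp (-(z * s))) * m s ≤ (z + 1) * I := by
    rw [hI, ← integral_const_mul]
    refine setIntegral_mono_on (integrableOn_one_sub_exp_mul hm hint hz) (hint.const_mul _)
      measurableSet_Ioi fun s hs => ?_
    rw [← mul_assoc]
    exact mul_le_mul_of_nonneg_right (one_sub_exp_bounds hz hs).2 (hm.nonneg hs)
  rw [hψ z hz]
  nlinarith [mul_nonneg hc₁ hz.le]

end HalfLine

/-! ### Assembly -/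

open HalfLine in
theorem mainTheorem7 (ψ : ℝ → ℝ) (hψ : HalfLine.IsCompleteBernstein ψ)
    (hunb : ¬ BddAbove (ψ '' Ioi 0)) (α : ℝ) (hα : α ∈ Icc (0 : ℝ) 1)
    (hreg : HalfLine.IsRegularlyVaryingAtTop ψ α) (l : ℝ) (hl : 0 < l) :
    ∃ F : ℝ → ℝ, HalfLine.IsEigenfunctionFor ψ l F ∧
      (∀ F' : ℝ → ℝ, HalfLine.IsEigenfunctionFor ψ l F' → EqOn F' F (Ioi 0)) ∧
      (fun ξ : ℝ => HalfLine.laplaceTransform F (ξ : ℂ)) ~[atTop]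
        (fun ξ : ℝ =>
          ((√(l ^ 2 * deriv ψ (l ^ 2) / (ξ ^ 2 * ψ (ξ ^ 2))) : ℝ) : ℂ)) ∧
      F ~[𝓝[>] (0 : ℝ)]
        (fun x : ℝ =>
          1 / Real.Gamma (1 + α) * √(l ^ 2 * deriv ψ (l ^ 2) / ψ (x ^ (-2 : ℤ)))) := by
  have ha : 0 < l ^ 2 := by positivity
  have hd := hψ.deriv_pos hunb ha
  have htop := hψ.tendsto_atTop hunb
  have hsq : Tendsto (fun ξ : ℝ => ξ ^ 2) atTop atTop := tendsto_pow_atTop two_ne_zero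
  have hψpos : ∀ᶠ ξ : ℝ in atTop, 0 < ψ (ξ ^ 2) := hsq.eventually (htop.eventually_gt_atTop 0)
  obtain ⟨ν, _, hν⟩ := (hψ.isWHFactorable hunb ha).rep.const_mul (Real.sqrt_nonneg (deriv ψ (l ^ 2)))
  have hEig := isEigenfunctionFor_eigenSuperposition hψ hunb hl hν
  have hasymp := isEquivalent_wienerHopf hψ hunb hreg hl
  refine ⟨eigenSuperposition l ν, hEig, fun F' hF' => hEig.unique hF', ?_, ?_⟩
  · refine (isEquivalent_iff_tendsto_one ?_).2 ?_
    · filter_upwards [eventually_gt_atTop 0, hψpos] with ξ hξ h1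
      exact_mod_cast (Real.sqrt_pos.2 (by positivity)).ne'
    · have h1 := (Complex.continuous_ofReal.tendsto 1).comp hasymp
      rw [Complex.ofReal_one] at h1
      refine h1.congr' ?_
      filter_upwards [eventually_gt_atTop 0] with ξ hξ
      rw [Pi.div_apply, hEig.2.2 _ (by simpa using hξ), eigenLaplace_ofReal hψ hunb hl hξ]
      simp only [Function.comp]
      rw [Complex.ofReal_div]
  · set ρ : ℝ → ℝ := fun ξ => √(l ^ 2 * deriv ψ (l ^ 2) / ψ (ξ ^ 2)) with hρ
    have hρpos : ∀ᶠ ξ in atTop, 0 < ρ ξ := hψpos.mono fun ξ h => Real.sqrt_pos.2 (by positivity)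
    obtain ⟨δ, hδ, hmono, hnn⟩ := eigenSuperposition_near_zero hl ν
      (integral_eigenWeight_pos hψ hunb hreg hl hν)
    obtain ⟨C, hC⟩ := hEig.2.1
    obtain ⟨K, hK, hKψ⟩ := hψ.exists_le_mul_add_one
    have hρreg : ∀ k, 0 < k → Tendsto (fun ξ => ρ (k * ξ) / ρ ξ) atTop (𝓝 (k ^ (-α))) := by
      intro k hk
      have h1 := (((hreg (k ^ 2) (by positivity)).comp hsq).inv₀
        (Real.rpow_pos_of_pos (by positivity) α).ne').sqrt
      have e : √(((k ^ 2) ^ α)⁻¹) = k ^ (-α) := by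
        rw [Real.sqrt_eq_iff_mul_self_eq (by positivity) (by positivity), ← Real.rpow_add hk,
          ← Real.rpow_neg (by positivity), ← Real.rpow_natCast, ← Real.rpow_mul hk.le]
        congr 1; push_cast; ring
      rw [e] at h1
      refine h1.congr' ?_
      have hkt : Tendsto (fun ξ : ℝ => k * ξ) atTop atTop := tendsto_id.const_mul_atTop hk
      filter_upwards [hψpos, hkt.eventually hψpos] with ξ h2 h3
      simp only [Function.comp, hρ]
      rw [← Real.sqrt_div (by positivity), ← mul_pow]
      congr 1
      field_simp
    -- For `ξ > 1`, `ψ(ξ²) ≤ K (ξ² + 1) ≤ 2K ξ⁴`, whence the constant.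
    have hρc : ∀ᶠ ξ in atTop, √(l ^ 2 * deriv ψ (l ^ 2) / (2 * K)) ≤ ξ ^ 2 * ρ ξ := by
      filter_upwards [eventually_gt_atTop 1, hψpos] with ξ hξ h1
      have hξ0 : 0 < ξ := by linarith
      have e : ξ ^ 2 * ρ ξ = √((ξ ^ 2) ^ 2 * (l ^ 2 * deriv ψ (l ^ 2) / ψ (ξ ^ 2))) := by
        rw [Real.sqrt_mul (by positivity), Real.sqrt_sq (by positivity)]
      rw [e]
      refine Real.sqrt_le_sqrt ?_
      rw [mul_div_assoc', div_le_div_iff₀ (by positivity) h1, mul_comm ((ξ ^ 2) ^ 2),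
        mul_assoc (l ^ 2 * deriv ψ (l ^ 2))]
      refine mul_le_mul_of_nonneg_left ?_ (show 0 ≤ l ^ 2 * deriv ψ (l ^ 2) by positivity)
      have h2 := hKψ (ξ ^ 2) (by positivity)
      have h3 : 1 ≤ ξ ^ 2 := by nlinarith
      have h4 : ξ ^ 2 + 1 ≤ (ξ ^ 2) ^ 2 * 2 := by nlinarith
      have := mul_le_mul_of_nonneg_left h4 hK.le
      linarith
    -- This is the asymptotics of the transform again, since its comparison function is `ρ(ξ)/ξ`.
    have hlap : Tendsto (fun ξ => ξ * (∫ x in Ioi (0 : ℝ),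
        Real.exp (-(ξ * x)) * eigenSuperposition l ν x) / ρ ξ) atTop (𝓝 1) := by
      refine hasymp.congr' ?_
      filter_upwards [eventually_gt_atTop 0, hψpos] with ξ hξ h1
      have h2 := hEig.2.2 (ξ : ℂ) (by simpa using hξ)
      rw [laplaceTransform_ofReal, eigenLaplace_ofReal hψ hunb hl hξ] at h2
      rw [Complex.ofReal_injective h2]
      have e : √(l ^ 2 * deriv ψ (l ^ 2) / (ξ ^ 2 * ψ (ξ ^ 2))) = ρ ξ / ξ := by
        simp only [hρ]
        rw [mul_comm (ξ ^ 2), ← div_div, Real.sqrt_div (by positivity), Real.sqrt_sq hξ.le]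
      rw [e, div_div_eq_mul_div, mul_comm ξ]
    have hmain := tendsto_div_of_laplace hEig.1 hC hδ hmono hnn hα.1 hρpos
      (Real.sqrt_pos.2 (by positivity)) hρc hρreg hlap
    have hinv : Tendsto (fun x : ℝ => x⁻¹) (𝓝[>] 0) atTop := tendsto_inv_nhdsGT_zero
    have hG : 0 < Real.Gamma (1 + α) := Real.Gamma_pos_of_pos (by linarith [hα.1])
    have hρx : ∀ x : ℝ, √(l ^ 2 * deriv ψ (l ^ 2) / ψ (x ^ (-2 : ℤ))) = ρ x⁻¹ := fun x => by
      simp only [hρ]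
      rw [zpow_neg, inv_pow]
      rfl
    refine (isEquivalent_iff_tendsto_one ?_).2 ?_
    · filter_upwards [hinv.eventually hρpos] with x hx
      rw [hρx]
      positivity
    · have h1 := (hmain.comp hinv).const_mul (Real.Gamma (1 + α))
      rw [mul_one_div, div_self hG.ne'] at h1
      refine h1.congr' ?_
      filter_upwards [hinv.eventually hρpos] with x hx
      simp only [Function.comp, Pi.div_apply]
      rw [hρx, inv_inv]
      field_simp
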